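/- Let $K$ be a local field of characteristic $0$: $K=\mathbb R$, $K=\mathbb C$, or a finite extension of some $\mathbb Q_p$. Let $|y|$ be its normalized absolute value ($|y|=|N_{K/\mathbb Q_\nu}(y)|_\nu$, so $|z|=z\bar z$ on $\mathbb C$), let $\lambda$ be the additive character $\lambda(x)=e^{-2\pi i\,\mathrm{Tr}(x)}$ ($K$ archimedean), respectively $\lambda(x)=e^{2\pi i\,\mathrm{Tr}(x)}$ ($K$ finite over $\mathbb Q_p$), and let $dy$ be the self-dual Haar measure (Lebesgue measure on $\mathbb R$, twice Lebesgue measure on $\mathbb C$). Let $A$ be multiplication by $\log|y|$ on $L^2(K,dy)$ with its maximal domain, let $B$ be the operator which is multiplication by $\log|x|$ in the dual variable $x$ of the Fourier transform $\widetilde\varphi(x)=\int\varphi(y)\lambda(-xy)\,dy$, and let $H=A+B$ on $\mathrm{dom}(A)\cap\mathrm{dom}(B)$ (the conductor operator $\log|y|+\log|x|$). For the characters $\chi_+=1$, $\chi_-=\mathrm{sgn}$ of $\mathbb R^\times$ and $\chi_N(z)=z^N(z\bar z)^{-N/2}$, $N\in\mathbb Z$, of $\mathbb C^\times$, let $h_\alpha=\gamma_\alpha'/\gamma_\alpha$,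 where $$\gamma_+(s)=\pi^{\frac12-s}\frac{\Gamma(\frac s2)}{\Gamma(\frac{1-s}2)},\qquad \gamma_-(s)=i\,\pi^{\frac12-s}\frac{\Gamma(\frac{s+1}2)}{\Gamma(\frac{2-s}2)},\qquad \gamma_N(s)=i^{|N|}(2\pi)^{1-2s}\frac{\Gamma(\frac{|N|}2+s)}{\Gamma(\frac{|N|}2+1-s)} .$$ **Theorem.** (1) $h_\pm$ and $h_N$ are the spectral functions of $H$ on the critical line, at the real and at the complex place respectively: for $\alpha\in\{+,-\}$ if $K=\mathbb R$, and $\alpha=N\in\mathbb Z$ if $K=\mathbb C$, if $f\in\mathrm{dom}(H)$ and $f|y|^{-1/2}$, $(Hf)|y|^{-1/2}$ are integrable, then for $\mathrm{Re}(s)=\frac12$ $$\int_K (Hf)(y)\,\chi_\alpha(y)^{-1}|y|^{-s}\,dy=h_\alpha(s)\int_K f(y)\,\chi_\alpha(y)^{-1}|y|^{-s}\,dy .$$ (2) Each of the functions $t\mapsto h_\alpha(\frac12+it)$ ($\alpha=\pm$ or $\alpha=N\in\mathbb Z$) is real-valued and even on $\mathbb R$, takes its minimal value at $t=0$, is strictly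 increasing on $[0,\infty)$, and tends to $\infty$ as $|t|\to\infty$, with logarithmic growth: $h_\alpha(\frac12+it)\asymp\log|t|$. (3) With Euler's constant $\gamma$ and the minimal values $\mu_\alpha=h_\alpha(\frac12)$, $$\mu_\pm=-(\log(8\pi)+\gamma)\mp\frac\pi2,\qquad \mu_N=-2\log(2\pi)+2\,\frac{\Gamma'}{\Gamma}\Bigl(\frac{|N|+1}2\Bigr)\quad(N\in\mathbb Z),$$ and for $N\in\mathbb Z$, $n\ge0$: if $|N|=2n$ then $\mu_N=-2(\log(8\pi)+\gamma)+2\sum_{j=1}^n\frac1{j-\frac12}$, and if $|N|=2n+1$ then $\mu_N=-2(\log(8\pi)+\gamma)+4\log2+2\sum_{j=1}^n\frac1j$. (4) The conductor operator is bounded below: for every $K$ as above there is a real $c$ such that $\langle Hf,f\rangle$ is real and $\langle Hf,f\rangle\ge c\,\|f\|^2$ for all $f\in\mathrm{dom}(H)$. For $K=\mathbb R$ one can take $c=\mu_+$, and for $K=\mathbb C$ one can take $c=\mu_0=-2(\log(8\pi)+\gamma)$. -/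

import Mathlib

open MeasureTheory Filter Set Asymptotics

noncomputable section

/-! ### The conductor operator `H = log|y| + log|x|` on `L²(K, dy)` -/

/-- The analytic data of a local field `K` used to write down the operator `H`: the normalized
absolute value `|y|`, the additive character `λ`, and the measure `dy`. It is only ever used for
the concrete data `realPlace`, `complexPlace` and `finitePlace` below. -/
structure LocalPlace (K : Type*) [MeasurableSpace K] where
  /-- the normalized absolute value -/
  abs : K → ℝ
  /-- the additive character -/
  char : K → ℂ
  /-- the additive Haar measure -/
  haar : Measure K

section Operator

variable {K : Type*} [Field K] [MeasurableSpace K]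

/-- The Fourier integral `φ̃(x) = ∫ φ(y) λ(-xy) dy`. -/
def fourierIntegralAt (P : LocalPlace K) (φ : K → ℂ) (x : K) : ℂ :=
  ∫ y, φ y * P.char (-(x * y)) ∂P.haar

/-- `ψ ∈ L²` is the Fourier transform of `f ∈ L²`: it satisfies the duality formula
`∫ ψ g = ∫ f g̃` for all `g ∈ L¹ ∩ L²`. -/
def IsL2Fourier (P : LocalPlace K) (f ψ : Lp ℂ 2 P.haar) : Prop :=
  ∀ g : K → ℂ, Integrable g P.haar → MemLp g 2 P.haar →
    ∫ x, ψ x * g x ∂P.haar = ∫ y, f y * fourierIntegralAt P g y ∂P.haar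

/-- The graph of the operator `A` of multiplication by `log|y|`, with its maximal domain:
`f` is in the domain of `A` and `A f = g`. -/
def IsLogMul (P : LocalPlace K) (f g : Lp ℂ 2 P.haar) : Prop :=
  g =ᵐ[P.haar] fun y => (Real.log (P.abs y) : ℂ) * f y

/-- The graph of the operator `B`, multiplication by `log|x|` in the Fourier dual variable `x`:
the Fourier transform `ψ` of `f` is in the domain of multiplication by `log|x|`, and `g` is the
inverse Fourier transform of `log|x| ψ`. -/
def IsDualLogMul (P : LocalPlace K) (f g : Lp ℂ 2 P.haar) : Prop :=
  ∃ ψ ψ' : Lp ℂ 2 P.haar, IsL2Fourier P f ψ ∧ IsLogMul P ψ ψ' ∧ IsL2Fourier P g ψ'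

/-- The graph of the conductor operator `H = A + B`, on the intersection of the domains of `A`
and `B`: `f` is in this intersection and `H f = g`. -/
def IsConductor (P : LocalPlace K) (f g : Lp ℂ 2 P.haar) : Prop :=
  ∃ a b : Lp ℂ 2 P.haar, IsLogMul P f a ∧ IsDualLogMul P f b ∧ g = a + b

/-- `H` is bounded below by `c`: for each `f` in its domain, `⟨H f, f⟩` is real and is at least
`c ‖f‖²`. -/
def ConductorBoundedBelowBy (P : LocalPlace K) (c : ℝ) : Prop :=
  ∀ f g : Lp ℂ 2 P.haar, IsConductor P f g →
    (inner ℂ g f : ℂ).im = 0 ∧ c * ‖f‖ ^ 2 ≤ (inner ℂ g f : ℂ).re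

/-- `F` is the spectral function of `H` on the component of the multiplicative character `χ`:
`H` acts as multiplication by `F(s)` on the Mellin transforms `∫ f(y) χ(y)⁻¹ |y|^{-s} dy` along
the critical line `Re s = 1/2`. -/
def IsSpectralFunction (P : LocalPlace K) (χ : K → ℂ) (F : ℂ → ℂ) : Prop :=
  ∀ f g : Lp ℂ 2 P.haar, IsConductor P f g →
    Integrable (fun y => f y * (P.abs y : ℂ) ^ (-(1 / 2) : ℂ)) P.haar →
    Integrable (fun y => g y * (P.abs y : ℂ) ^ (-(1 / 2) : ℂ)) P.haar →
    ∀ s : ℂ, s.re = 1 / 2 →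
      ∫ y, g y * ((χ y)⁻¹ * (P.abs y : ℂ) ^ (-s)) ∂P.haar =
        F s * ∫ y, f y * ((χ y)⁻¹ * (P.abs y : ℂ) ^ (-s)) ∂P.haar

end Operator

/-! ### The three kinds of places -/

/-- The real place: the usual absolute value, `λ(x) = exp(-2πix)`, Lebesgue measure. -/
def realPlace : LocalPlace ℝ where
  abs x := |x|
  char x := Complex.exp (-(2 * Real.pi * Complex.I * x))
  haar := volume

/-- The complex place: `|z| = z z̄`, `λ(z) = exp(-2πi Tr z) = exp(-2πi (2 Re z))`, and twice the
Lebesgue measure. -/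
def complexPlace : LocalPlace ℂ where
  abs z := Complex.normSq z
  char z := Complex.exp (-(2 * Real.pi * Complex.I * ((2 * z.re : ℝ) : ℂ)))
  haar := (2 : ENNReal) • volume

section Finite

variable (p : ℕ) [Fact p.Prime]

lemma norm_mul_pow_neg_valuation_le_one (x : ℚ_[p]) :
    ‖x * (p : ℚ_[p]) ^ (-x.valuation).toNat‖ ≤ 1 := by
  have hp : (1 : ℝ) < p := by exact_mod_cast (Fact.out : p.Prime).one_lt
  rcases eq_or_ne x 0 with rfl | hx
  · simp
  · rw [norm_mul, Padic.norm_eq_zpow_neg_valuation hx, norm_pow, Padic.norm_p, inv_pow,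
      ← zpow_natCast, ← zpow_neg, ← zpow_add₀ (by positivity)]
    apply zpow_le_one_of_nonpos₀ hp.le
    omega

/-- The fractional part of `x ∈ ℚ_p`: the element `m / p ^ n` of `ℤ[1/p] ∩ [0, 1)` with
`x - m / p ^ n ∈ ℤ_p`. -/
def padicFract (x : ℚ_[p]) : ℚ :=
  (PadicInt.appr (⟨x * (p : ℚ_[p]) ^ (-x.valuation).toNat,
    norm_mul_pow_neg_valuation_le_one p x⟩ : ℤ_[p]) (-x.valuation).toNat : ℚ) /
      (p : ℚ) ^ (-x.valuation).toNat

variable (K : Type*) [NormedField K] [NormedAlgebra ℚ_[p] K] [MeasurableSpace K]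

/-- A finite place, `K` being a finite extension of `ℚ_p`: the normalized absolute value
`|y| = |N_{K/ℚ_p}(y)|_p`, the character `λ(x) = exp(2πi Tr_{K/ℚ_p}(x))`, and the measure `μ`. -/
def finitePlace (μ : Measure K) : LocalPlace K where
  abs y := ‖Algebra.norm ℚ_[p] y‖
  char x := Complex.exp (2 * Real.pi * Complex.I * (padicFract p (Algebra.trace ℚ_[p] K x) : ℂ))
  haar := μ

/-- The Haar measure is self-dual: the Fourier inversion formula `φ̃̃(y) = φ(-y)` holds for all
Schwartz–Bruhat functions. -/
def IsSelfDualHaar (μ : Measure K) : Prop :=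
  ∀ φ : K → ℂ, IsLocallyConstant φ → HasCompactSupport φ → ∀ y : K,
    fourierIntegralAt (finitePlace p K μ) (fourierIntegralAt (finitePlace p K μ) φ) y = φ (-y)

end Finite

/-! ### Archimedean characters, Gamma functions, and their logarithmic derivatives -/

/-- The trivial character `χ₊ = 1` of `ℝˣ`. -/
def chiPlus : ℝ → ℂ := fun _ => 1

/-- The sign character `χ₋ = sgn` of `ℝˣ`. -/
def chiMinus : ℝ → ℂ := fun u => ((SignType.sign u : ℝ) : ℂ)

/-- The character `χ_N(z) = z^N (z z̄)^{-N/2}` of `ℂˣ`. -/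
def chiComplex (N : ℤ) : ℂ → ℂ := fun z => z ^ N * (Complex.normSq z : ℂ) ^ (-(N : ℂ) / 2)

/-- `γ₊(s) = Γ(χ₊, s)`. -/
def gammaPlus (s : ℂ) : ℂ :=
  (Real.pi : ℂ) ^ (1 / 2 - s) * (Complex.Gamma (s / 2) / Complex.Gamma ((1 - s) / 2))

/-- `γ₋(s) = Γ(χ₋, s)`. -/
def gammaMinus (s : ℂ) : ℂ :=
  Complex.I * (Real.pi : ℂ) ^ (1 / 2 - s) *
    (Complex.Gamma ((s + 1) / 2) / Complex.Gamma ((2 - s) / 2))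

/-- `γ_N(s) = Γ(χ_N, s)`. -/
def gammaComplex (N : ℤ) (s : ℂ) : ℂ :=
  Complex.I ^ N.natAbs * (2 * Real.pi : ℂ) ^ (1 - 2 * s) *
    (Complex.Gamma ((N.natAbs : ℂ) / 2 + s) / Complex.Gamma ((N.natAbs : ℂ) / 2 + 1 - s))

/-- `h₊(s) = ∂/∂s log Γ(χ₊, s)`. -/
def hPlus : ℂ → ℂ := logDeriv gammaPlus

/-- `h₋(s) = ∂/∂s log Γ(χ₋, s)`. -/
def hMinus : ℂ → ℂ := logDeriv gammaMinus

/-- `h_N(s) = ∂/∂s log Γ(χ_N, s)`. -/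
def hComplex (N : ℤ) : ℂ → ℂ := logDeriv (gammaComplex N)

/-- The function `t ↦ F(1/2 + it)` is real, even, minimal at `t = 0`, strictly increasing in
`|t|`, and tends to `∞` with logarithmic growth. -/
structure CriticalLineShape (F : ℂ → ℂ) : Prop where
  real : ∀ t : ℝ, (F (1 / 2 + t * Complex.I)).im = 0
  even : ∀ t : ℝ, F (1 / 2 + (-t : ℝ) * Complex.I) = F (1 / 2 + t * Complex.I)
  min_at_zero : ∀ t : ℝ, (F (1 / 2)).re ≤ (F (1 / 2 + t * Complex.I)).re
  increasing : StrictMonoOn (fun t : ℝ => (F (1 / 2 + t * Complex.I)).re) (Ici 0)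
  tendsto_top : Tendsto (fun t : ℝ => (F (1 / 2 + t * Complex.I)).re) atTop atTop
  log_growth : (fun t : ℝ => (F (1 / 2 + t * Complex.I)).re) =Θ[atTop] Real.log

end

/-! Frullani's integral `log q = ∫ (e^{-v} - e^{-vq}) dv/v` carries both the spectral formula and
the lower bound: it replaces the logarithm by a superposition of functions whose Fourier transforms
are explicit.

Spectral functions. `H f` is paired with Gaussians `p e^{-cκQ}`, where `|y| = Q^r` and `p` has the
type of `χ⁻¹`. The duality formula moves `log|x|` onto the Gaussian (`integral_conductor`). By
Frullani, the transform of `log|x|` times a Gaussian is an integral of dilated Gaussians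
(`fourier_log_mul`), hence `p` times a function of `cκQ`. Integration against `c^{w-1} dc` with `w =
n/2 + rs` separates variables (`integral_mellin_comp_mul`): the side of `H f` gives its Mellin
integral times `Γ(w)`, the side of `f` gives its own times `Γ(w) r (ψ(w) + ψ(n+r-w) - 2 log κ)`,
with `ψ` the digamma function. Both values of `ψ` come from Dirichlet's integral and the derivative
of Euler's integral (`digamma_eq_integral`, `mellin_conductorProfile`). Dividing by `Γ(w)` leaves
the logarithmic derivative of the local Gamma factor.

Shape and minimal values. On the critical line the two arguments of `ψ` are conjugate, so the
function is `2r Re ψ((n+r)/2 + irt) - 2r log κ`. The recurrence of `ψ`, with a remainder that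
vanishes far to the right, bounds increments of `Re ψ` below by partial sums of positive terms
(`le_reDigamma_sub`); monotonicity follows, and comparison with harmonic sums gives logarithmic
growth. Reflection and duplication give `ψ(1/4)` and `ψ(3/4)`; recurrence from `ψ(1/2)` and `ψ(1)`
gives the complex values.

Lower bound. With `φ` the transform of `f`, Plancherel gives `⟨H f, f⟩ = ∫ log|y| |f|² + ∫ log|x|
|φ|²`. In the second integral the logarithm is bounded below by `r ∫ (c(t) - e_t) dt/t + c₀`, where
`e_t` has a nonnegative Fourier transform `k_t`; then `∫ e_t |φ|²` is the quadratic form of the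
kernel `k_t(z-y)`. Schur's test with a weight `w` satisfying `k_t * w ≤ ρ_t w` bounds it by `∫ ρ_t
|f|²`, and summing over `t` again leaves a multiplication operator that is bounded below
(`conductorBoundedBelowBy_of_kernel`). At an archimedean place `e_t` is a Gaussian and `w` is
`|y|^{-1/2}` up to a constant; the logarithms then cancel exactly and leave `μ_+`, respectively
`μ_0` (`integral_exp_neg_sub_schurProfile`). At a finite place `e_t` is the indicator of a ball and
`k_t` a multiple of the indicator of the dual ball; the ultrametric inequality gives the Schur bound
up to constants (`IsUltrametricPlace.schur_bound`). -/

/-! ### Frullani's integral, Dirichlet's integral and the dilation kernel -/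

theorem abs_exp_neg_sub_exp_neg_le (a b : ℝ) :
    |Real.exp (-a) - Real.exp (-b)| ≤ |a - b| * Real.exp (-min a b) := by
  wlog h : a ≤ b generalizing a b
  · rw [abs_sub_comm, abs_sub_comm a, min_comm]
    exact this b a (le_of_not_ge h)
  rw [min_eq_left h, abs_of_nonneg (sub_nonneg.2 (Real.exp_le_exp.2 (by linarith))), abs_sub_comm,
    abs_of_nonneg (sub_nonneg.2 h)]
  have h1 : Real.exp (-b) = Real.exp (-a) * Real.exp (-(b - a)) := by
    rw [← Real.exp_add]; ring_nf
  have h2 := Real.add_one_le_exp (-(b - a))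
  rw [h1]
  nlinarith [Real.exp_pos (-a)]

theorem integrableOn_exp_neg_sub_div {q : ℝ} (hq : 0 < q) :
    IntegrableOn (fun v : ℝ => (Real.exp (-v) - Real.exp (-(v * q))) / v) (Ioi 0) := by
  have hm : 0 < min 1 q := lt_min one_pos hq
  refine Integrable.mono' (g := fun v => |1 - q| * Real.exp (-(min 1 q) * v))
    ((exp_neg_integrableOn_Ioi 0 hm).const_mul _)
    (by fun_prop : Measurable _).aestronglyMeasurable ?_
  refine (ae_restrict_iff' measurableSet_Ioi).2 (ae_of_all _ fun v hv => ?_)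
  have hv : 0 < v := hv
  rw [norm_div, Real.norm_eq_abs, Real.norm_eq_abs, abs_of_pos hv, div_le_iff₀ hv]
  refine (abs_exp_neg_sub_exp_neg_le v (v * q)).trans (le_of_eq ?_)
  have h1 : v - v * q = v * (1 - q) := by ring
  have h2 : min v (v * q) = v * min 1 q := by rw [mul_min_of_nonneg _ _ hv.le, mul_one]
  rw [h1, h2, abs_mul, abs_of_pos hv]
  ring_nf

theorem integral_exp_neg_sub_div {q : ℝ} (hq : 0 < q) :
    ∫ v in Ioi (0 : ℝ), (Real.exp (-v) - Real.exp (-(v * q))) / v = Real.log q := by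
  have hc : Continuous (fun v : ℝ => Real.exp (-v)) := by fun_prop
  have h := Frullani.integral_Ioi_eq (f := fun v : ℝ => Real.exp (-v)) (a := 1) (b := q) (L := 1)
    (R := 0) (hc.locallyIntegrable.locallyIntegrableOn _) one_pos hq
    (tendsto_nhdsWithin_of_tendsto_nhds (by simpa using hc.tendsto 0))
    (Real.tendsto_exp_neg_atTop_nhds_zero) ?_
  · simp only [div_one, sub_zero, smul_eq_mul, mul_one, one_mul] at h
    rw [← h]
    exact setIntegral_congr_fun measurableSet_Ioi fun v _ => by
      simp only [mul_comm q]; ring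
  · refine (integrableOn_exp_neg_sub_div hq).congr_fun (fun v _ => ?_) measurableSet_Ioi
    simp only [mul_comm q, smul_eq_mul, one_mul]; ring

/-- The integrand has the constant sign of `log q`. Absolute convergence of the double integrals
below therefore reduces to integrability against `|log|`. -/
theorem integral_abs_exp_neg_sub_div {q : ℝ} (hq : 0 < q) :
    ∫ v in Ioi (0 : ℝ), |(Real.exp (-v) - Real.exp (-(v * q))) / v| = |Real.log q| := by
  rcases le_total 1 q with h | h
  · rw [abs_of_nonneg (Real.log_nonneg h), ← integral_exp_neg_sub_div hq]
    refine setIntegral_congr_fun measurableSet_Ioi fun v (hv : 0 < v) => abs_of_nonneg ?_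
    exact div_nonneg (sub_nonneg.2 (Real.exp_le_exp.2 (by nlinarith))) hv.le
  · rw [abs_of_nonpos (Real.log_nonpos hq.le h), ← integral_exp_neg_sub_div hq, ← integral_neg]
    refine setIntegral_congr_fun measurableSet_Ioi fun v (hv : 0 < v) => abs_of_nonpos ?_
    exact div_nonpos_of_nonpos_of_nonneg (sub_nonpos.2 (Real.exp_le_exp.2 (by nlinarith))) hv.le

theorem mellinConvergent_exp_neg_mul {w : ℂ} (hw : 0 < w.re) {a : ℝ} (ha : 0 < a) :
    MellinConvergent (fun x : ℝ => (Real.exp (-(a * x)) : ℂ)) w := by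
  have h := (Complex.GammaIntegral_convergent hw)
  have h1 : MellinConvergent (fun x : ℝ => (Real.exp (-x) : ℂ)) w := by
    refine h.congr_fun (fun x _ => ?_) measurableSet_Ioi
    simp [mul_comm]
  exact (MellinConvergent.comp_mul_left (f := fun x : ℝ => (Real.exp (-x) : ℂ)) ha).2 h1

theorem mellin_exp_neg_mul {w : ℂ} (hw : 0 < w.re) {a : ℝ} (ha : 0 < a) :
    mellin (fun x : ℝ => (Real.exp (-(a * x)) : ℂ)) w = (a : ℂ) ^ (-w) * Complex.Gamma w := by
  have h := Complex.integral_cpow_mul_exp_neg_mul_Ioi hw ha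
  rw [one_div, Complex.inv_cpow _ _ (by
    rw [Complex.arg_ofReal_of_nonneg ha.le]; exact Real.pi_ne_zero.symm), ← Complex.cpow_neg] at h
  rw [← h, mellin]
  refine setIntegral_congr_fun measurableSet_Ioi fun x _ => ?_
  simp

/-- Differentiation of Euler's integral under the integral sign; `Γ ψ` stands for `Γ'`. -/
theorem mellinConvergent_log_mul_exp_neg {w : ℂ} (hw : 0 < w.re) :
    MellinConvergent (fun x : ℝ => ((Real.log x * Real.exp (-x) : ℝ) : ℂ)) w ∧
      mellin (fun x : ℝ => ((Real.log x * Real.exp (-x) : ℝ) : ℂ)) w =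
        Complex.Gamma w * Complex.digamma w := by
  have key := mellin_hasDerivAt_of_isBigO_rpow (E := ℂ) (f := fun x : ℝ => (Real.exp (-x) : ℂ))
    (a := w.re + 1) (b := 0) (s := w) ?_ ?_ (lt_add_one _) ?_ hw
  · have h1 : (fun x : ℝ => ((Real.log x * Real.exp (-x) : ℝ) : ℂ)) =
        fun t : ℝ => Real.log t • (Real.exp (-t) : ℂ) := by
      funext x; simp
    rw [h1]
    refine ⟨key.1, ?_⟩
    have h2 : mellin (fun x : ℝ => (Real.exp (-x) : ℂ)) =ᶠ[nhds w] Complex.Gamma := by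
      filter_upwards [(isOpen_lt continuous_const Complex.continuous_re).mem_nhds hw] with s hs
      have := mellin_exp_neg_mul (w := s) hs one_pos
      simpa using this
    have h3 := (key.2.congr_of_eventuallyEq h2.symm).deriv
    rw [← h3, Complex.digamma_def, logDeriv_apply, mul_div_cancel₀]
    exact Complex.Gamma_ne_zero_of_re_pos hw
  · refine (Continuous.continuousOn ?_).locallyIntegrableOn measurableSet_Ioi
    exact Complex.continuous_ofReal.comp (Real.continuous_exp.comp continuous_neg)
  · rw [← isBigO_norm_left]
    simp_rw [Complex.norm_real, isBigO_norm_left]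
    simpa only [neg_one_mul] using (isLittleO_exp_neg_mul_rpow_atTop zero_lt_one _).isBigO
  · simp_rw [neg_zero, Real.rpow_zero]
    refine isBigO_const_of_tendsto (y := (1 : ℂ)) ?_ one_ne_zero
    refine (Continuous.tendsto' ?_ 0 _ (by simp)).mono_left nhdsWithin_le_nhds
    fun_prop

theorem norm_cpow_sub_one {x : ℝ} (hx : 0 < x) (w : ℂ) : ‖(x : ℂ) ^ (w - 1)‖ = x ^ (w.re - 1) := by
  rw [Complex.norm_cpow_eq_rpow_re_of_pos hx]; simp

theorem integrableOn_rpow_mul_exp_neg {σ a : ℝ} (hσ : 0 < σ) (ha : 0 < a) :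
    IntegrableOn (fun x : ℝ => x ^ (σ - 1) * Real.exp (-(a * x))) (Ioi 0) := by
  have h := (mellinConvergent_exp_neg_mul (w := σ) (by simpa) ha).norm
  refine IntegrableOn.congr_fun h (fun x (hx : 0 < x) => ?_) measurableSet_Ioi
  simp only [norm_smul, norm_cpow_sub_one hx, Complex.norm_real, Complex.ofReal_re, Real.norm_eq_abs,
    Real.abs_exp]

theorem integral_rpow_mul_exp_neg {σ a : ℝ} (hσ : 0 < σ) (ha : 0 < a) :
    ∫ x in Ioi (0 : ℝ), x ^ (σ - 1) * Real.exp (-(a * x)) = a ^ (-σ) * Real.Gamma σ := by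
  rw [Real.integral_rpow_mul_exp_neg_mul_Ioi hσ ha, one_div, Real.inv_rpow ha.le,
    Real.rpow_neg ha.le]

theorem integrableOn_rpow_mul_abs_log_mul_exp_neg {σ : ℝ} (hσ : 0 < σ) :
    IntegrableOn (fun x : ℝ => x ^ (σ - 1) * (|Real.log x| * Real.exp (-x))) (Ioi 0) := by
  have h := (mellinConvergent_log_mul_exp_neg (w := σ) (by simpa)).1.norm
  refine IntegrableOn.congr_fun h (fun x (hx : 0 < x) => ?_) measurableSet_Ioi
  simp only [norm_smul, norm_cpow_sub_one hx, Complex.norm_real, Complex.ofReal_re,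
    Real.norm_eq_abs, abs_mul, Real.abs_exp]

/-- Integrating the norm over `p.2` first gives `x^{Re w - 1} |log x| e^{-x}`, which is integrable.
-/
theorem integrable_digamma_aux {w : ℂ} (hw : 0 < w.re) :
    Integrable (fun p : ℝ × ℝ => (p.1 : ℂ) ^ (w - 1) *
      ((Real.exp (-p.1) * ((Real.exp (-p.2) - Real.exp (-(p.2 * p.1))) / p.2) : ℝ) : ℂ))
      ((volume.restrict (Ioi 0)).prod (volume.restrict (Ioi 0))) := by
  rw [integrable_prod_iff (by fun_prop : Measurable _).aestronglyMeasurable]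
  refine ⟨(ae_restrict_iff' measurableSet_Ioi).2 (ae_of_all _ fun x hx => ?_), ?_⟩
  · exact (((integrableOn_exp_neg_sub_div hx).const_mul (Real.exp (-x))).ofReal (𝕜 := ℂ)).const_mul
      ((x : ℂ) ^ (w - 1))
  · refine IntegrableOn.congr_fun (integrableOn_rpow_mul_abs_log_mul_exp_neg hw)
      (fun x (hx : 0 < x) => ?_) measurableSet_Ioi
    simp only [norm_mul, norm_cpow_sub_one hx, Complex.norm_real, Real.norm_eq_abs, Real.abs_exp]
    rw [integral_const_mul, integral_const_mul, integral_abs_exp_neg_sub_div hx]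
    ring

/-- Dirichlet's integral for the digamma function. -/
theorem digamma_eq_integral {w : ℂ} (hw : 0 < w.re) :
    IntegrableOn (fun v : ℝ => ((Real.exp (-v) : ℂ) - (1 + v : ℂ) ^ (-w)) / v) (Ioi 0) ∧
      ∫ v in Ioi (0 : ℝ), ((Real.exp (-v) : ℂ) - (1 + v : ℂ) ^ (-w)) / v = Complex.digamma w := by
  have hG := Complex.Gamma_ne_zero_of_re_pos hw
  have hint := integrable_digamma_aux hw
  -- One double integral is computed twice: over `x` first it yields `Γ(w)` times Dirichlet's
  -- integrand, over `v` first it yields, by Frullani, the Mellin transform of `log x e^{-x}`.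
  have hinner : ∀ v ∈ Ioi (0 : ℝ), ∫ x in Ioi (0 : ℝ), (x : ℂ) ^ (w - 1) *
      ((Real.exp (-x) * ((Real.exp (-v) - Real.exp (-(v * x))) / v) : ℝ) : ℂ) =
      Complex.Gamma w * (((Real.exp (-v) : ℂ) - (1 + v : ℂ) ^ (-w)) / v) := by
    intro v (hv : 0 < v)
    have h1 := mellin_exp_neg_mul hw one_pos
    have h2 := mellin_exp_neg_mul hw (by linarith : 0 < 1 + v)
    have i1 := mellinConvergent_exp_neg_mul hw one_pos
    have i2 := mellinConvergent_exp_neg_mul hw (by linarith : 0 < 1 + v)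
    have : ∀ x : ℝ, (x : ℂ) ^ (w - 1) *
        ((Real.exp (-x) * ((Real.exp (-v) - Real.exp (-(v * x))) / v) : ℝ) : ℂ) =
        (Real.exp (-v) / v : ℂ) * ((x : ℂ) ^ (w - 1) • (Real.exp (-(1 * x)) : ℂ)) -
          (v : ℂ)⁻¹ * ((x : ℂ) ^ (w - 1) • (Real.exp (-((1 + v) * x)) : ℂ)) := by
      intro x
      have : Real.exp (-((1 + v) * x)) = Real.exp (-x) * Real.exp (-(v * x)) := by
        rw [← Real.exp_add]; ring_nf
      rw [this, one_mul, smul_eq_mul, smul_eq_mul]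
      push_cast
      field_simp
    simp_rw [this]
    rw [integral_sub (i1.const_mul _) (i2.const_mul _), integral_const_mul, integral_const_mul]
    rw [mellin] at h1 h2
    rw [h1, h2]
    push_cast
    rw [Complex.one_cpow]
    field_simp
  constructor
  · have h := hint.integral_prod_right
    have h' := (IntegrableOn.congr_fun h hinner measurableSet_Ioi).const_mul (Complex.Gamma w)⁻¹
    refine IntegrableOn.congr_fun h' (fun v _ => ?_) measurableSet_Ioi
    exact inv_mul_cancel_left₀ hG _
  · have h := integral_integral_swap (f := fun x v : ℝ => (x : ℂ) ^ (w - 1) *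
      ((Real.exp (-x) * ((Real.exp (-v) - Real.exp (-(v * x))) / v) : ℝ) : ℂ)) hint
    rw [setIntegral_congr_fun measurableSet_Ioi hinner, integral_const_mul] at h
    have h2 := (mellinConvergent_log_mul_exp_neg hw).2
    have h3 : ∀ x ∈ Ioi (0 : ℝ), ∫ v in Ioi (0 : ℝ), (x : ℂ) ^ (w - 1) *
        ((Real.exp (-x) * ((Real.exp (-v) - Real.exp (-(v * x))) / v) : ℝ) : ℂ) =
        (x : ℂ) ^ (w - 1) • ((Real.log x * Real.exp (-x) : ℝ) : ℂ) := by
      intro x hx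
      rw [integral_const_mul, integral_complex_ofReal, integral_const_mul, integral_exp_neg_sub_div hx,
        smul_eq_mul, mul_comm (Real.log x)]
    rw [setIntegral_congr_fun measurableSet_Ioi h3] at h
    rw [mellin, h] at h2
    exact mul_left_cancel₀ hG h2

theorem one_add_rpow_sub_one_le {σ v : ℝ} (hσ : 0 < σ) (hv : 0 < v) :
    0 ≤ (1 + v) ^ σ - 1 ∧ (1 + v) ^ σ - 1 ≤ σ * v * (1 + v) ^ σ := by
  have h0 : 0 < 1 + v := by linarith
  refine ⟨sub_nonneg.2 (Real.one_le_rpow (by linarith) hσ.le), ?_⟩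
  have h1 := Real.add_one_le_exp (-(σ * Real.log (1 + v)))
  have h2 : Real.log (1 + v) ≤ v := by linarith [Real.log_le_sub_one_of_pos h0]
  have h3 : Real.exp (-(σ * Real.log (1 + v))) * (1 + v) ^ σ = 1 := by
    rw [Real.rpow_def_of_pos h0, ← Real.exp_add]; ring_nf; exact Real.exp_zero
  have h4 : 0 < (1 + v) ^ σ := Real.rpow_pos_of_pos h0 _
  nlinarith [mul_le_mul_of_nonneg_left h2 hσ.le]

theorem integrableOn_exp_neg_mul_one_add_rpow {σ : ℝ} (hσ : 0 < σ) :
    IntegrableOn (fun v : ℝ => Real.exp (-v) * (1 + v) ^ σ) (Ioi 0) := by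
  have h1 := integrableOn_rpow_mul_exp_neg one_pos one_pos
  have h2 := integrableOn_rpow_mul_exp_neg (by linarith : 0 < σ + 1) one_pos
  refine Integrable.mono' ((h1.add h2).const_mul (2 ^ σ))
    (by fun_prop : Measurable _).aestronglyMeasurable ?_
  refine (ae_restrict_iff' measurableSet_Ioi).2 (ae_of_all _ fun v (hv : 0 < v) => ?_)
  have hp : 0 < (1 + v) ^ σ := Real.rpow_pos_of_pos (by linarith) _
  have key : (1 + v) ^ σ ≤ 2 ^ σ * (1 + v ^ σ) := by
    have hvσ : 0 < v ^ σ := Real.rpow_pos_of_pos hv _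
    have h2σ : (0 : ℝ) < 2 ^ σ := Real.rpow_pos_of_pos two_pos _
    rcases le_total v 1 with h | h
    · have := Real.rpow_le_rpow (by linarith) (by linarith : 1 + v ≤ 2) hσ.le
      nlinarith
    · have := Real.rpow_le_rpow (by linarith) (by linarith : 1 + v ≤ 2 * v) hσ.le
      rw [Real.mul_rpow two_pos.le hv.le] at this
      nlinarith
  rw [Real.norm_eq_abs, abs_of_pos (by positivity)]
  simp only [Pi.add_apply, sub_self, Real.rpow_zero, add_sub_cancel_right, one_mul]
  nlinarith [Real.exp_pos (-v)]

theorem integrableOn_exp_neg_mul_one_add_rpow_sub_one {σ : ℝ} (hσ : 0 < σ) :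
    IntegrableOn (fun v : ℝ => Real.exp (-v) * ((1 + v) ^ σ - 1) / v) (Ioi 0) := by
  refine Integrable.mono' ((integrableOn_exp_neg_mul_one_add_rpow hσ).const_mul σ)
    (by fun_prop : Measurable _).aestronglyMeasurable ?_
  refine (ae_restrict_iff' measurableSet_Ioi).2 (ae_of_all _ fun v (hv : 0 < v) => ?_)
  obtain ⟨h0, h1⟩ := one_add_rpow_sub_one_le hσ hv
  rw [Real.norm_eq_abs, abs_of_nonneg (div_nonneg (mul_nonneg (Real.exp_pos _).le h0) hv.le),
    div_le_iff₀ hv]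
  nlinarith [Real.exp_pos (-v)]

/-- The difference quotient, in logarithmic scale, of a dilated exponential. -/
noncomputable def dilationKernel (β x v : ℝ) : ℝ :=
  (Real.exp (-v) * Real.exp (-x) - (1 + v) ^ (-β) * Real.exp (-(x / (1 + v)))) / v

@[fun_prop]
theorem measurable_dilationKernel (β : ℝ) :
    Measurable (fun p : ℝ × ℝ => dilationKernel β p.1 p.2) := by
  unfold dilationKernel; fun_prop

/-- The kernel splits as `(e^{-v} - (1+v)^{-β})/v · e^{-x/(1+v)}` plus `e^{-v}/v · (e^{-x} -
e^{-x/(1+v)})`. For fixed `v` each piece has constant sign in `x`, so the integral of its norm is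
explicit. The first is dominated by Dirichlet's integrand at `β - σ`, which needs `σ < β`, plus
`e^{-v}((1+v)^σ - 1)/v`; the second is a multiple of that last function. -/
theorem integrable_dilationKernel {β : ℝ} {w : ℂ} (hw : 0 < w.re) (hwβ : w.re < β) :
    Integrable (fun p : ℝ × ℝ => (p.1 : ℂ) ^ (w - 1) * (dilationKernel β p.1 p.2 : ℂ))
      ((volume.restrict (Ioi 0)).prod (volume.restrict (Ioi 0))) := by
  set σ := w.re with hσ
  have hΓ : 0 < Real.Gamma σ := Real.Gamma_pos_of_pos hw
  have hA : Integrable (fun p : ℝ × ℝ => (p.1 : ℂ) ^ (w - 1) *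
      (((Real.exp (-p.2) - (1 + p.2) ^ (-β)) / p.2 * Real.exp (-((1 + p.2)⁻¹ * p.1)) : ℝ) : ℂ))
      ((volume.restrict (Ioi 0)).prod (volume.restrict (Ioi 0))) := by
    rw [integrable_prod_iff' (by fun_prop : Measurable _).aestronglyMeasurable]
    refine ⟨(ae_restrict_iff' measurableSet_Ioi).2 (ae_of_all _ fun v (hv : 0 < v) => ?_), ?_⟩
    · have h0 : 0 < (1 + v)⁻¹ := by positivity
      refine IntegrableOn.congr_fun ((mellinConvergent_exp_neg_mul hw h0).const_mul
        ((Real.exp (-v) - (1 + v) ^ (-β)) / v : ℝ)) (fun x _ => ?_) measurableSet_Ioi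
      simp only [smul_eq_mul]; push_cast; ring
    · have hc : ∀ v ∈ Ioi (0 : ℝ), Real.Gamma σ *
          (|Real.exp (-v) - (1 + v) ^ (-β)| / v * (1 + v) ^ σ) =
          ∫ x in Ioi (0 : ℝ), ‖(x : ℂ) ^ (w - 1) * (((Real.exp (-v) - (1 + v) ^ (-β)) / v *
            Real.exp (-((1 + v)⁻¹ * x)) : ℝ) : ℂ)‖ := by
        intro v (hv : 0 < v)
        have h0 : 0 < (1 + v)⁻¹ := by positivity
        have : ∀ x ∈ Ioi (0 : ℝ), ‖(x : ℂ) ^ (w - 1) * (((Real.exp (-v) - (1 + v) ^ (-β)) / v *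
            Real.exp (-((1 + v)⁻¹ * x)) : ℝ) : ℂ)‖ = |Real.exp (-v) - (1 + v) ^ (-β)| / v *
            (x ^ (σ - 1) * Real.exp (-((1 + v)⁻¹ * x))) := by
          intro x (hx : 0 < x)
          rw [norm_mul, norm_cpow_sub_one hx, Complex.norm_real, Real.norm_eq_abs, abs_mul,
            Real.abs_exp, abs_div, abs_of_pos hv]
          ring
        rw [setIntegral_congr_fun measurableSet_Ioi this, integral_const_mul,
          integral_rpow_mul_exp_neg hw h0, Real.inv_rpow (by linarith),
          Real.rpow_neg (x := 1 + v) (by linarith) σ, inv_inv]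
        ring
      refine IntegrableOn.congr_fun (Integrable.const_mul ?_ (Real.Gamma σ)) hc measurableSet_Ioi
      have hd := (digamma_eq_integral (w := ((β - σ : ℝ) : ℂ)) (by simpa using hwβ)).1.norm
      refine Integrable.mono' (hd.add (integrableOn_exp_neg_mul_one_add_rpow_sub_one hw))
        (by fun_prop : Measurable _).aestronglyMeasurable ?_
      refine (ae_restrict_iff' measurableSet_Ioi).2 (ae_of_all _ fun v (hv : 0 < v) => ?_)
      have h0 : 0 < 1 + v := by linarith
      have hn : ‖((Real.exp (-v) : ℂ) - (1 + v : ℂ) ^ (-((β - σ : ℝ) : ℂ))) / v‖ =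
          |Real.exp (-v) - (1 + v) ^ (-(β - σ))| / v := by
        rw [← Real.norm_eq_abs, ← Complex.norm_real, norm_div, Complex.norm_real v,
          Real.norm_of_nonneg hv.le]
        congr 2
        rw [Complex.ofReal_sub (Real.exp (-v)), Complex.ofReal_cpow h0.le]
        push_cast; rfl
      have hp : (1 + v) ^ (-(β - σ)) = (1 + v) ^ (-β) * (1 + v) ^ σ := by
        rw [← Real.rpow_add h0]; ring_nf
      have hσp : 0 < (1 + v) ^ σ := Real.rpow_pos_of_pos h0 _
      obtain ⟨h1, -⟩ := one_add_rpow_sub_one_le hw hv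
      rw [Pi.add_apply, hn, ← add_div, Real.norm_eq_abs, abs_mul, abs_div, abs_abs, abs_of_pos hv,
        abs_of_pos hσp, div_mul_eq_mul_div]
      refine (div_le_div_iff_of_pos_right hv).2 ?_
      rw [hp, ← abs_of_pos hσp, ← abs_mul, abs_of_pos hσp]
      have : (Real.exp (-v) - (1 + v) ^ (-β)) * (1 + v) ^ σ =
        (Real.exp (-v) - (1 + v) ^ (-β) * (1 + v) ^ σ) + Real.exp (-v) * ((1 + v) ^ σ - 1) := by
        ring
      rw [this]
      refine (abs_add_le _ _).trans (add_le_add le_rfl (le_of_eq (abs_of_nonneg ?_)))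
      exact mul_nonneg (Real.exp_pos _).le h1
  have hB : Integrable (fun p : ℝ × ℝ => (p.1 : ℂ) ^ (w - 1) *
      ((Real.exp (-p.2) / p.2 * (Real.exp (-(1 * p.1)) - Real.exp (-((1 + p.2)⁻¹ * p.1))) : ℝ) : ℂ))
      ((volume.restrict (Ioi 0)).prod (volume.restrict (Ioi 0))) := by
    rw [integrable_prod_iff' (by fun_prop : Measurable _).aestronglyMeasurable]
    refine ⟨(ae_restrict_iff' measurableSet_Ioi).2 (ae_of_all _ fun v (hv : 0 < v) => ?_), ?_⟩
    · have h0 : 0 < (1 + v)⁻¹ := by positivity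
      refine IntegrableOn.congr_fun (((mellinConvergent_exp_neg_mul hw one_pos).sub
        (mellinConvergent_exp_neg_mul hw h0)).const_mul
        (Real.exp (-v) / v : ℝ)) (fun x _ => ?_) measurableSet_Ioi
      simp only [smul_eq_mul, Pi.sub_apply]; push_cast; ring
    · have hc : ∀ v ∈ Ioi (0 : ℝ), Real.Gamma σ * (Real.exp (-v) * ((1 + v) ^ σ - 1) / v) =
          ∫ x in Ioi (0 : ℝ), ‖(x : ℂ) ^ (w - 1) * ((Real.exp (-v) / v *
            (Real.exp (-(1 * x)) - Real.exp (-((1 + v)⁻¹ * x))) : ℝ) : ℂ)‖ := by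
        intro v (hv : 0 < v)
        have h0 : 0 < (1 + v)⁻¹ := by positivity
        have h1 : (1 + v)⁻¹ ≤ 1 := inv_le_one_of_one_le₀ (by linarith)
        have : ∀ x ∈ Ioi (0 : ℝ), ‖(x : ℂ) ^ (w - 1) * ((Real.exp (-v) / v *
            (Real.exp (-(1 * x)) - Real.exp (-((1 + v)⁻¹ * x))) : ℝ) : ℂ)‖ = Real.exp (-v) / v *
            (x ^ (σ - 1) * Real.exp (-((1 + v)⁻¹ * x)) - x ^ (σ - 1) * Real.exp (-(1 * x))) := by
          intro x (hx : 0 < x)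
          rw [norm_mul, norm_cpow_sub_one hx, Complex.norm_real, Real.norm_eq_abs, abs_mul,
            abs_div, Real.abs_exp, abs_of_pos hv, abs_of_nonpos
              (sub_nonpos.2 (Real.exp_le_exp.2 (by nlinarith)))]
          ring
        rw [setIntegral_congr_fun measurableSet_Ioi this, integral_const_mul,
          integral_sub (integrableOn_rpow_mul_exp_neg hw h0)
            (integrableOn_rpow_mul_exp_neg hw one_pos), integral_rpow_mul_exp_neg hw h0,
          integral_rpow_mul_exp_neg hw one_pos, Real.inv_rpow (by linarith),
          Real.rpow_neg (by linarith), inv_inv, Real.one_rpow]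
        ring
      exact IntegrableOn.congr_fun
        ((integrableOn_exp_neg_mul_one_add_rpow_sub_one hw).const_mul (Real.Gamma σ)) hc
        measurableSet_Ioi
  refine (hA.add hB).congr (ae_of_all _ fun p => ?_)
  simp only [Pi.add_apply]
  rw [← mul_add, ← Complex.ofReal_add]
  congr 2
  rw [dilationKernel, div_eq_inv_mul p.1, one_mul]
  ring

/-- After exchanging the integrals, the one over `x` is `Γ(w)` times Dirichlet's integrand at `β -
w`, because the dilation by `1 + v` contributes `(1+v)^{w-β}`. -/
theorem integral_cpow_mul_dilationKernel {β : ℝ} {w : ℂ} (hw : 0 < w.re) (hwβ : w.re < β) :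
    ∫ x in Ioi (0 : ℝ), ∫ v in Ioi (0 : ℝ), (x : ℂ) ^ (w - 1) * (dilationKernel β x v : ℂ) =
      Complex.Gamma w * Complex.digamma (β - w) := by
  rw [integral_integral_swap (f := fun x v : ℝ => (x : ℂ) ^ (w - 1) * (dilationKernel β x v : ℂ))
    (integrable_dilationKernel hw hwβ)]
  have hβ : 0 < ((β : ℂ) - w).re := by simpa using hwβ
  rw [← (digamma_eq_integral hβ).2, ← integral_const_mul]
  refine setIntegral_congr_fun measurableSet_Ioi fun v (hv : 0 < v) => ?_
  have h0 : 0 < 1 + v := by linarith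
  have h1 : 0 < (1 + v)⁻¹ := by positivity
  have : ∀ x : ℝ, (x : ℂ) ^ (w - 1) * (dilationKernel β x v : ℂ) =
      (Real.exp (-v) / v : ℂ) * ((x : ℂ) ^ (w - 1) • (Real.exp (-(1 * x)) : ℂ)) -
      (((1 + v) ^ (-β) / v : ℝ) : ℂ) *
        ((x : ℂ) ^ (w - 1) • (Real.exp (-((1 + v)⁻¹ * x)) : ℂ)) := by
    intro x
    rw [dilationKernel, div_eq_inv_mul x, one_mul, smul_eq_mul, smul_eq_mul]
    push_cast; ring
  simp_rw [this]
  have e1 := mellin_exp_neg_mul hw one_pos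
  have e2 := mellin_exp_neg_mul hw h1
  rw [mellin] at e1 e2
  rw [integral_sub ((mellinConvergent_exp_neg_mul hw one_pos).const_mul _)
    ((mellinConvergent_exp_neg_mul hw h1).const_mul _), integral_const_mul, integral_const_mul,
    e1, e2]
  have h2 : ((1 + v : ℝ) : ℂ) ≠ 0 := by exact_mod_cast h0.ne'
  have h3 : (((1 + v)⁻¹ : ℝ) : ℂ) ^ (-w) = ((1 + v : ℝ) : ℂ) ^ w := by
    rw [Complex.ofReal_inv, Complex.inv_cpow _ _ (by
      rw [Complex.arg_ofReal_of_nonneg h0.le]; exact Real.pi_ne_zero.symm), Complex.cpow_neg,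
      inv_inv]
  have h4 : (1 + v : ℂ) ^ (-((β : ℂ) - w)) = (((1 + v) ^ (-β) : ℝ) : ℂ) * ((1 + v : ℝ) : ℂ) ^ w := by
    rw [Complex.ofReal_cpow h0.le, ← Complex.cpow_add _ _ h2]
    push_cast; ring_nf
  rw [h3, h4]
  simp only [Complex.ofReal_one, Complex.one_cpow, Complex.ofReal_div]
  ring


/-! ### The digamma function on vertical lines -/

theorem hasDerivAt_Gamma_digamma {z : ℂ} (hz : 0 < z.re) :
    HasDerivAt Complex.Gamma (Complex.Gamma z * Complex.digamma z) z := by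
  have hd : DifferentiableAt ℂ Complex.Gamma z := Complex.differentiableAt_Gamma z fun m h => by
    rw [h] at hz; simp at hz; linarith [(Nat.cast_nonneg m : (0 : ℝ) ≤ m)]
  have h := hd.hasDerivAt
  rwa [Complex.digamma_def, logDeriv_apply, mul_div_cancel₀ _ (Complex.Gamma_ne_zero_of_re_pos hz)]

theorem digamma_conj (z : ℂ) :
    Complex.digamma ((starRingEnd ℂ) z) = (starRingEnd ℂ) (Complex.digamma z) := by
  have h : (fun x => (starRingEnd ℂ) (Complex.Gamma ((starRingEnd ℂ) x))) = Complex.Gamma := by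
    funext x; rw [Complex.Gamma_conj, Complex.conj_conj]
  have h2 := congrFun (deriv_conj_conj (f := Complex.Gamma)) ((starRingEnd ℂ) z)
  have h3 : ((starRingEnd ℂ) ∘ Complex.Gamma ∘ (starRingEnd ℂ)) = Complex.Gamma := h
  rw [h3] at h2
  simp only [Function.comp_apply, Complex.conj_conj] at h2
  rw [Complex.digamma_def, logDeriv_apply, logDeriv_apply, h2, Complex.Gamma_conj, map_div₀]

theorem digamma_add_nat {z : ℂ} (hz : 0 < z.re) (N : ℕ) :
    Complex.digamma (z + N) = Complex.digamma z + ∑ n ∈ Finset.range N, (z + n)⁻¹ := by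
  induction N with
  | zero => simp
  | succ N ih =>
    rw [Finset.sum_range_succ, ← add_assoc, ← ih, Nat.cast_succ, ← add_assoc,
      Complex.digamma_apply_add_one]
    intro m h
    have := congrArg Complex.re h
    simp at this
    linarith [(Nat.cast_nonneg m : (0 : ℝ) ≤ m), (Nat.cast_nonneg N : (0 : ℝ) ≤ N)]

/-- In the difference of two Dirichlet integrals the terms `e^{-v}` cancel. The phases differ by at
most `log(1+v) |u - u'| ≤ v |u - u'|`, which absorbs the denominator and leaves `|u - u'| ∫
(1+v)^{-a} dv`. The point is the decay as `a → ∞`. -/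
theorem norm_digamma_sub_le {a : ℝ} (ha : 1 < a) (u u' : ℝ) :
    ‖Complex.digamma (a + u * Complex.I) - Complex.digamma (a + u' * Complex.I)‖ ≤
      |u - u'| / (a - 1) := by
  have hre : ∀ u : ℝ, 0 < ((a : ℂ) + u * Complex.I).re := fun u => by simp; linarith
  have hi : IntegrableOn (fun v : ℝ => |u - u'| * (v + 1) ^ (-a)) (Ioi 0) :=
    (integrableOn_add_rpow_Ioi_of_lt (by linarith) (by norm_num)).const_mul _
  rw [← (digamma_eq_integral (hre u)).2, ← (digamma_eq_integral (hre u')).2,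
    ← integral_sub (digamma_eq_integral (hre u)).1 (digamma_eq_integral (hre u')).1]
  have hval : ∫ v in Ioi (0 : ℝ), |u - u'| * (v + 1) ^ (-a) = |u - u'| / (a - 1) := by
    rw [integral_const_mul]
    have h := integral_Ioi_rpow_of_lt (a := -a) (c := 1) (by linarith) one_pos
    have h2 := (measurePreserving_add_right volume (1 : ℝ)).setIntegral_preimage_emb
      (measurableEmbedding_addRight 1) (fun x : ℝ => x ^ (-a)) (Ioi 1)
    rw [Set.preimage_add_const_Ioi, sub_self] at h2
    rw [h2, h, Real.one_rpow]
    have h1 : a - 1 ≠ 0 := by linarith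
    have h3 : -a + 1 ≠ 0 := by intro h; apply h1; linarith
    field_simp
    ring
  rw [← hval]
  refine norm_integral_le_of_norm_le hi ?_
  refine (ae_restrict_iff' measurableSet_Ioi).2 (ae_of_all _ fun v (hv : 0 < v) => ?_)
  have h0 : 0 < 1 + v := by linarith
  have h0' : (1 + v : ℂ) ≠ 0 := by exact_mod_cast h0.ne'
  have hc : ∀ u : ℝ, (1 + v : ℂ) ^ (-((a : ℂ) + u * Complex.I)) = (((1 + v) ^ (-a) : ℝ) : ℂ) *
      Complex.exp (Complex.I * ((-(Real.log (1 + v) * u) : ℝ) : ℂ)) := by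
    intro u
    rw [Complex.ofReal_cpow h0.le, neg_add, Complex.cpow_add _ _ h0',
      Complex.cpow_def_of_ne_zero h0' (-(u * Complex.I))]
    have : Complex.log (1 + v) = (Real.log (1 + v) : ℂ) := by
      rw [Complex.ofReal_log h0.le]; push_cast; rfl
    rw [this]
    push_cast
    ring_nf
  rw [hc u, hc u']
  set L := Real.log (1 + v)
  have hL0 : 0 ≤ L := Real.log_nonneg (by linarith)
  have hL : L ≤ v := by linarith [Real.log_le_sub_one_of_pos h0]
  have hp : 0 < (1 + v) ^ (-a) := Real.rpow_pos_of_pos h0 _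
  have e : Complex.exp (Complex.I * ((-(L * u') : ℝ) : ℂ)) -
      Complex.exp (Complex.I * ((-(L * u) : ℝ) : ℂ)) =
      Complex.exp (Complex.I * ((-(L * u) : ℝ) : ℂ)) *
        (Complex.exp (Complex.I * ((L * (u - u') : ℝ) : ℂ)) - 1) := by
    rw [mul_sub, ← Complex.exp_add, mul_one]
    congr 2
    push_cast; ring
  have : ((Real.exp (-v) : ℂ) - (((1 + v) ^ (-a) : ℝ) : ℂ) *
      Complex.exp (Complex.I * ((-(L * u) : ℝ) : ℂ))) / v - ((Real.exp (-v) : ℂ) -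
      (((1 + v) ^ (-a) : ℝ) : ℂ) * Complex.exp (Complex.I * ((-(L * u') : ℝ) : ℂ))) / v =
      (((1 + v) ^ (-a) : ℝ) : ℂ) * (Complex.exp (Complex.I * ((-(L * u) : ℝ) : ℂ)) *
        (Complex.exp (Complex.I * ((L * (u - u') : ℝ) : ℂ)) - 1)) / v := by
    rw [← e]; ring
  rw [this, norm_div, norm_mul, norm_mul, Complex.norm_exp_I_mul_ofReal, one_mul,
    Complex.norm_real, Complex.norm_real, Real.norm_of_nonneg hv.le, Real.norm_of_nonneg hp.le,
    div_le_iff₀ hv]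
  have h5 : ‖Complex.exp (Complex.I * ((L * (u - u') : ℝ) : ℂ)) - 1‖ ≤ L * |u - u'| := by
    refine (Real.norm_exp_I_mul_ofReal_sub_one_le).trans (le_of_eq ?_)
    rw [Real.norm_eq_abs, abs_mul, abs_of_nonneg hL0]
  rw [add_comm v 1]
  nlinarith [mul_le_mul_of_nonneg_right hL (abs_nonneg (u - u')), mul_le_mul_of_nonneg_left h5 hp.le,
    mul_le_mul_of_nonneg_left (mul_le_mul_of_nonneg_right hL (abs_nonneg (u - u'))) hp.le]

/-- The real part of the digamma function on a vertical line. -/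
noncomputable def reDigamma (a u : ℝ) : ℝ := (Complex.digamma (a + u * Complex.I)).re

theorem re_inv_add_mul_I (x u : ℝ) : ((x + u * Complex.I : ℂ)⁻¹).re = x / (x ^ 2 + u ^ 2) := by
  rw [Complex.inv_re]; simp [Complex.normSq_apply]; ring_nf

theorem reDigamma_add_nat {a : ℝ} (ha : 0 < a) (u : ℝ) (N : ℕ) :
    reDigamma (a + N) u =
      reDigamma a u + ∑ n ∈ Finset.range N, (a + n) / ((a + n) ^ 2 + u ^ 2) := by
  have h := congrArg Complex.re (digamma_add_nat (z := a + u * Complex.I) (by simpa using ha) N)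
  rw [Complex.add_re, Complex.re_sum] at h
  rw [reDigamma, reDigamma]
  convert h using 2
  · push_cast; ring_nf
  · refine Finset.sum_congr rfl fun n _ => ?_
    rw [← re_inv_add_mul_I]
    push_cast; ring_nf

theorem reDigamma_sub {a : ℝ} (ha : 0 < a) (u u' : ℝ) (N : ℕ) :
    reDigamma a u' - reDigamma a u = ∑ n ∈ Finset.range N,
      ((a + n) / ((a + n) ^ 2 + u ^ 2) - (a + n) / ((a + n) ^ 2 + u' ^ 2)) +
      (reDigamma (a + N) u' - reDigamma (a + N) u) := by
  rw [reDigamma_add_nat ha, reDigamma_add_nat ha, Finset.sum_sub_distrib]; ring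

theorem abs_reDigamma_sub_le {a : ℝ} (ha : 1 < a) (u u' : ℝ) :
    |reDigamma a u - reDigamma a u'| ≤ |u - u'| / (a - 1) := by
  rw [reDigamma, reDigamma, ← Complex.sub_re]
  exact (Complex.abs_re_le_norm _).trans (norm_digamma_sub_le ha u u')

/-- After `M` recurrences the remainder is a difference at abscissa `a + M`, which tends to `0` by
`abs_reDigamma_sub_le`. The increment is thus a series of nonnegative terms and dominates each
partial sum. A single term already gives strict monotonicity. -/
theorem le_reDigamma_sub {a : ℝ} (ha : 0 < a) {u u' : ℝ} (hu : 0 ≤ u) (huu : u ≤ u') (N : ℕ) :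
    ∑ n ∈ Finset.range N,
      ((a + n) / ((a + n) ^ 2 + u ^ 2) - (a + n) / ((a + n) ^ 2 + u' ^ 2)) ≤
      reDigamma a u' - reDigamma a u := by
  have hpos : ∀ n : ℕ, 0 ≤ (a + n) / ((a + n) ^ 2 + u ^ 2) - (a + n) / ((a + n) ^ 2 + u' ^ 2) := by
    intro n
    have : 0 < a + n := by positivity
    rw [sub_nonneg]
    gcongr
  have hlim : Tendsto (fun M : ℕ => reDigamma (a + M) u' - reDigamma (a + M) u) atTop (nhds 0) := by
    have h1 : Tendsto (fun M : ℕ => |u' - u| / (a + M - 1)) atTop (nhds 0) := by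
      refine Tendsto.const_div_atTop ?_ _
      refine tendsto_atTop_add_const_right _ _ ?_
      exact tendsto_atTop_add_const_left _ _ tendsto_natCast_atTop_atTop
    refine squeeze_zero_norm' ?_ h1
    filter_upwards [eventually_ge_atTop 2] with M hM
    have : (2 : ℝ) ≤ M := by exact_mod_cast hM
    exact abs_reDigamma_sub_le (by linarith) _ _
  have hev : ∀ᶠ M : ℕ in atTop, (∑ n ∈ Finset.range N,
      ((a + n) / ((a + n) ^ 2 + u ^ 2) - (a + n) / ((a + n) ^ 2 + u' ^ 2))) +
      (reDigamma (a + M) u' - reDigamma (a + M) u) ≤ reDigamma a u' - reDigamma a u := by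
    filter_upwards [eventually_ge_atTop N] with M hM
    rw [reDigamma_sub ha u u' M]
    gcongr ?_ + _
    exact Finset.sum_le_sum_of_subset_of_nonneg (Finset.range_mono hM) fun n _ _ => hpos n
  have hl := hlim.const_add (∑ n ∈ Finset.range N,
      ((a + n) / ((a + n) ^ 2 + u ^ 2) - (a + n) / ((a + n) ^ 2 + u' ^ 2)))
  rw [add_zero] at hl
  exact le_of_tendsto hl hev

theorem strictMonoOn_reDigamma {a : ℝ} (ha : 0 < a) : StrictMonoOn (reDigamma a) (Ici 0) := by
  intro u (hu : 0 ≤ u) u' _ huu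
  have h := le_reDigamma_sub ha hu huu.le 1
  have : 0 < a / (a ^ 2 + u ^ 2) - a / (a ^ 2 + u' ^ 2) := by
    rw [sub_pos]; gcongr
  simp only [Finset.range_one, Finset.sum_singleton, Nat.cast_zero, add_zero] at h
  linarith

theorem sum_range_inv_add_one_eq_harmonic (N : ℕ) :
    ∑ n ∈ Finset.range N, ((n : ℝ) + 1)⁻¹ = harmonic N := by
  simp [harmonic]

/-- For `n < ⌊u⌋` the point `x = a + n` is at most `2u`, so the `n`-th term `u²/(x(x²+u²))` is at
least `1/(5x)`. With `x ≤ (a+1)(n+1)` the sum is at least a harmonic number over `5(a+1)`. -/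
theorem reDigamma_lower {a : ℝ} (ha : 0 < a) {u : ℝ} (hua : a ≤ u) :
    reDigamma a 0 + Real.log u / (5 * (a + 1)) ≤ reDigamma a u := by
  have hu : 0 < u := ha.trans_le hua
  have h := le_reDigamma_sub ha le_rfl hu.le ⌊u⌋₊
  suffices Real.log u / (5 * (a + 1)) ≤ ∑ n ∈ Finset.range ⌊u⌋₊,
      ((a + n) / ((a + n) ^ 2 + 0 ^ 2) - (a + n) / ((a + n) ^ 2 + u ^ 2)) by linarith
  have h1 : Real.log u ≤ ∑ n ∈ Finset.range ⌊u⌋₊, ((n : ℝ) + 1)⁻¹ := by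
    rw [sum_range_inv_add_one_eq_harmonic]
    refine le_trans ?_ (log_add_one_le_harmonic _)
    refine Real.log_le_log hu ?_
    push_cast
    exact (Nat.lt_floor_add_one u).le
  rw [div_le_iff₀ (by positivity), Finset.sum_mul]
  refine h1.trans (Finset.sum_le_sum fun n hn => ?_)
  have hn : (n : ℝ) ≤ u := by
    have h2 := Finset.mem_range.1 hn
    exact (Nat.cast_le.2 h2.le).trans (Nat.floor_le hu.le)
  have hn0 : (0 : ℝ) ≤ n := Nat.cast_nonneg n
  set x := a + n with hx
  have hx0 : 0 < x := by positivity
  have hx1 : x ≤ 2 * u := by linarith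
  have e : x / (x ^ 2 + 0 ^ 2) - x / (x ^ 2 + u ^ 2) = u ^ 2 / (x * (x ^ 2 + u ^ 2)) := by
    field_simp; ring
  rw [e, inv_eq_one_div, div_mul_eq_mul_div, div_le_div_iff₀ (by positivity) (by positivity)]
  have h3 : x ^ 2 + u ^ 2 ≤ 5 * u ^ 2 := by nlinarith
  have h4 : x ≤ (a + 1) * (n + 1) := by rw [hx]; nlinarith
  calc 1 * (x * (x ^ 2 + u ^ 2)) ≤ ((a + 1) * (n + 1)) * (5 * u ^ 2) := by
        rw [one_mul]; gcongr
    _ = _ := by ring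

/-- With `M = ⌈u⌉`, the recurrence is applied `M + 1` times. The remainder is at most `u/(a+M) ≤ 1`,
the term `n = 0` at most `a⁻¹`, and the others sum to at most the harmonic number of `M`, bounded by
`1 + log(3u)`. -/
theorem reDigamma_upper {a : ℝ} (ha : 0 < a) {u : ℝ} (hu : 1 ≤ u) :
    reDigamma a u ≤ reDigamma a 0 + a⁻¹ + 2 + Real.log 3 + Real.log u := by
  set M := ⌈u⌉₊ with hM
  have hM1 : u ≤ M := Nat.le_ceil u
  have hM2 : (M : ℝ) < u + 1 := Nat.ceil_lt_add_one (by linarith)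
  have h := reDigamma_sub ha 0 u (M + 1)
  have h1 := (abs_le.1 (abs_reDigamma_sub_le (a := a + (M + 1 : ℕ)) (by push_cast; linarith) u 0)).2
  have h2 : |u - 0| / (a + (M + 1 : ℕ) - 1) ≤ 1 := by
    rw [sub_zero, abs_of_pos (by linarith), div_le_one (by push_cast; linarith)]
    push_cast; linarith
  have h3 : ∑ n ∈ Finset.range (M + 1), ((a + n) / ((a + n) ^ 2 + 0 ^ 2) -
      (a + n) / ((a + n) ^ 2 + u ^ 2)) ≤ a⁻¹ + harmonic M := by
    rw [Finset.sum_range_succ', ← sum_range_inv_add_one_eq_harmonic, add_comm]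
    have key : ∀ x : ℝ, 0 < x → x / (x ^ 2 + 0 ^ 2) - x / (x ^ 2 + u ^ 2) ≤ x⁻¹ := by
      intro x hx
      have : x / (x ^ 2 + 0 ^ 2) = x⁻¹ := by field_simp; ring
      rw [this]
      linarith [div_nonneg hx.le (by positivity : 0 ≤ x ^ 2 + u ^ 2)]
    refine add_le_add ?_ (Finset.sum_le_sum fun n _ => ?_)
    · simpa using key a ha
    · refine (key _ (by positivity)).trans ?_
      push_cast
      exact inv_anti₀ (by positivity) (by linarith)
  have h4 := harmonic_le_one_add_log M
  have h5 : Real.log M ≤ Real.log 3 + Real.log u := by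
    rw [← Real.log_mul (by norm_num) (by linarith)]
    exact Real.log_le_log (by linarith) (by linarith)
  have h6 : ((harmonic M : ℚ) : ℝ) ≤ 1 + Real.log M := by exact_mod_cast h4
  linarith

theorem reDigamma_neg (a u : ℝ) : reDigamma a (-u) = reDigamma a u := by
  rw [reDigamma, reDigamma, ← Complex.conj_re, ← digamma_conj]
  simp

theorem digamma_add_digamma_conj (a u : ℝ) :
    Complex.digamma (a + u * Complex.I) + Complex.digamma (a - u * Complex.I) =
      ((2 * reDigamma a u : ℝ) : ℂ) := by
  have : (a - u * Complex.I : ℂ) = (starRingEnd ℂ) (a + u * Complex.I) := by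
    simp [sub_eq_add_neg]
  rw [this, digamma_conj, Complex.add_conj, reDigamma]

theorem criticalLineShape_of_eq {F : ℂ → ℂ} {a r c : ℝ} (ha : 0 < a) (hr : 0 < r)
    (hF : ∀ t : ℝ, F (1 / 2 + t * Complex.I) = ((2 * r * reDigamma a (r * t) + c : ℝ) : ℂ)) :
    CriticalLineShape F := by
  have hre : ∀ t : ℝ, (F (1 / 2 + t * Complex.I)).re = 2 * r * reDigamma a (r * t) + c := fun t => by
    rw [hF, Complex.ofReal_re]
  have hmono : StrictMonoOn (fun t : ℝ => 2 * r * reDigamma a (r * t) + c) (Ici 0) := by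
    intro t (ht : 0 ≤ t) t' (ht' : 0 ≤ t') htt
    have := strictMonoOn_reDigamma ha (mul_nonneg hr.le ht : 0 ≤ r * t) (mul_nonneg hr.le ht' : 0 ≤ r * t')
      (mul_lt_mul_of_pos_left htt hr)
    dsimp only
    nlinarith
  have heven : ∀ t : ℝ, reDigamma a (r * -t) = reDigamma a (r * t) := fun t => by
    rw [mul_neg, reDigamma_neg]
  set k := 2 * r / (5 * (a + 1)) with hk
  have hk0 : 0 < k := by positivity
  set d := 2 * r * reDigamma a 0 + k * Real.log r + c with hd
  have hlow : ∀ᶠ t : ℝ in atTop, k * Real.log t + d ≤ 2 * r * reDigamma a (r * t) + c := by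
    filter_upwards [eventually_ge_atTop (a / r), eventually_gt_atTop 0] with t ht ht0
    have h := reDigamma_lower ha (u := r * t) (by rwa [div_le_iff₀' hr] at ht)
    rw [Real.log_mul hr.ne' ht0.ne'] at h
    have e : k * Real.log t + d = 2 * r * (reDigamma a 0 + (Real.log r + Real.log t) / (5 * (a + 1))) + c := by
      rw [hd, hk]; field_simp; ring
    rw [e]
    gcongr
  set d' := 2 * r * (reDigamma a 0 + a⁻¹ + 2 + Real.log 3 + Real.log r) + c with hd'
  have hup : ∀ᶠ t : ℝ in atTop, 2 * r * reDigamma a (r * t) + c ≤ 2 * r * Real.log t + d' := by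
    filter_upwards [eventually_ge_atTop (1 / r), eventually_gt_atTop 0] with t ht ht0
    have h := reDigamma_upper ha (u := r * t) (by rwa [div_le_iff₀' hr] at ht)
    rw [Real.log_mul hr.ne' ht0.ne'] at h
    have e : 2 * r * Real.log t + d' = 2 * r * (reDigamma a 0 + a⁻¹ + 2 + Real.log 3 +
      (Real.log r + Real.log t)) + c := by rw [hd']; ring
    rw [e]
    gcongr
  have htop : Tendsto (fun t : ℝ => k * Real.log t + d) atTop atTop :=
    tendsto_atTop_add_const_right _ _ (Real.tendsto_log_atTop.const_mul_atTop hk0)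
  refine ⟨fun t => ?_, fun t => ?_, fun t => ?_, ?_, ?_, ?_, ?_⟩
  · rw [hF, Complex.ofReal_im]
  · rw [hF, hF, heven]
  · have h0 := hre 0
    simp only [Complex.ofReal_zero, zero_mul, add_zero] at h0
    rw [h0, hre]
    have habs : reDigamma a (r * t) = reDigamma a (r * |t|) := by
      rcases abs_choice t with h | h <;> rw [h]
      exact (heven t).symm
    rw [habs]
    exact hmono.monotoneOn (self_mem_Ici) (abs_nonneg t : |t| ∈ Ici (0:ℝ)) (abs_nonneg t)
  · simpa only [hre] using hmono
  · simpa only [hre] using tendsto_atTop_mono' _ hlow htop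
  · simp only [hre]
    have hc : ∀ C : ℝ, (fun _ : ℝ => C) =O[atTop] Real.log := fun C =>
      (isLittleO_const_left.2 (Or.inr (tendsto_norm_atTop_atTop.comp Real.tendsto_log_atTop))).isBigO
    have hb : (fun t : ℝ => 2 * r * Real.log t + d') =O[atTop] Real.log :=
      ((isBigO_refl _ _).const_mul_left _).add (hc _)
    refine IsBigO.trans (IsBigO.of_bound 1 ?_) hb
    filter_upwards [hlow, hup, htop.eventually_ge_atTop 0] with t h1 h2 h3
    rw [Real.norm_of_nonneg (by linarith), Real.norm_of_nonneg (by linarith)]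
    linarith
  · simp only [hre]
    refine IsBigO.of_bound (2 / k) ?_
    -- Half of `k log t` absorbs the constant `d`, whatever its sign.
    have h4 : Tendsto (fun t : ℝ => k / 2 * Real.log t) atTop atTop :=
      Real.tendsto_log_atTop.const_mul_atTop (by positivity)
    filter_upwards [hlow, Real.tendsto_log_atTop.eventually_ge_atTop 0,
      h4.eventually_ge_atTop (-d)] with t h1 h2 h3
    have h5 : k / 2 * Real.log t ≤ 2 * r * reDigamma a (r * t) + c := by linarith
    rw [Real.norm_of_nonneg h2, Real.norm_of_nonneg ((mul_nonneg (by positivity) h2).trans h5)]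
    calc Real.log t = 2 / k * (k / 2 * Real.log t) := by field_simp
      _ ≤ _ := by gcongr

/-! ### Logarithmic derivatives of the local Gamma factors and their values at `1/2` -/

theorem logDeriv_cpow_mul_Gamma_div_Gamma {C : ℂ} (hC : C ≠ 0) {b r p : ℝ} (hb : 0 < b) (e : ℂ)
    {s : ℂ} (h1 : 0 < (p + r * s : ℂ).re) (h2 : 0 < (p + r - r * s : ℂ).re) :
    logDeriv (fun s : ℂ => C * (b : ℂ) ^ (e - 2 * r * s) *
        (Complex.Gamma (p + r * s) / Complex.Gamma (p + r - r * s))) s =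
      r * (Complex.digamma (p + r * s) + Complex.digamma (p + r - r * s) - 2 * Real.log b) := by
  have hb' : (b : ℂ) ≠ 0 := by exact_mod_cast hb.ne'
  have g1 : HasDerivAt (fun s : ℂ => (p + r * s : ℂ)) (r : ℂ) s := by
    simpa using ((hasDerivAt_id s).const_mul (r : ℂ)).const_add (p : ℂ)
  have g2 : HasDerivAt (fun s : ℂ => (p + r - r * s : ℂ)) (-r : ℂ) s := by
    simpa using ((hasDerivAt_id s).const_mul (r : ℂ)).const_sub (p + r : ℂ)
  have g3 : HasDerivAt (fun s : ℂ => (e - 2 * r * s : ℂ)) (-(2 * r) : ℂ) s := by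
    simpa using ((hasDerivAt_id s).const_mul (2 * r : ℂ)).const_sub e
  have d1 := (hasDerivAt_Gamma_digamma h1).comp s g1
  have d2 := (hasDerivAt_Gamma_digamma h2).comp s g2
  have d3 := (g3.const_cpow (c := (b : ℂ)) (Or.inl hb')).const_mul C
  have n1 := Complex.Gamma_ne_zero_of_re_pos h1
  have n2 := Complex.Gamma_ne_zero_of_re_pos h2
  have n3 : (b : ℂ) ^ (e - 2 * r * s) ≠ 0 := by simp [Complex.cpow_eq_zero_iff, hb']
  have h := (d3.mul (d1.div d2 n2)).deriv
  rw [logDeriv_apply]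
  rw [show (fun s : ℂ => C * (b : ℂ) ^ (e - 2 * r * s) *
        (Complex.Gamma (p + r * s) / Complex.Gamma (p + r - r * s))) = _ from rfl]
  erw [h]
  rw [Complex.ofReal_log hb.le]
  simp only [Function.comp_apply, Pi.div_apply]
  field_simp
  ring

/-- The logarithmic derivative of a local Gamma factor. -/
noncomputable def localSpectral (n r κ : ℝ) (s : ℂ) : ℂ :=
  r * (Complex.digamma ((n / 2 : ℝ) + r * s) + Complex.digamma ((n / 2 : ℝ) + r - r * s) -
    2 * Real.log κ)

/-- All the Gamma factors have one form: `(n, r, κ)` is `(0, 1/2, π)` for `γ₊`, `(1, 1/2, π)` for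
`γ₋` and `(|N|, 1, 2π)` for `γ_N`. On the critical line both Gamma arguments have real part `(n+r)/2
> 0`, away from the poles. -/
theorem logDeriv_eq_localSpectral {γ : ℂ → ℂ} {C : ℂ} (hC : C ≠ 0) {n r κ : ℝ} (hn : 0 ≤ n)
    (hr : 0 < r) (hκ : 0 < κ) (e : ℂ) (hγ : ∀ s, γ s = C * (κ : ℂ) ^ (e - 2 * r * s) *
      (Complex.Gamma ((n / 2 : ℝ) + r * s) / Complex.Gamma ((n / 2 : ℝ) + r - r * s)))
    {s : ℂ} (hs : s.re = 1 / 2) : logDeriv γ s = localSpectral n r κ s := by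
  rw [funext hγ, logDeriv_cpow_mul_Gamma_div_Gamma hC hκ e, localSpectral] <;> simp [hs] <;> linarith

theorem hPlus_eq {s : ℂ} (hs : s.re = 1 / 2) : hPlus s = localSpectral 0 (1 / 2) Real.pi s := by
  refine logDeriv_eq_localSpectral one_ne_zero le_rfl (by norm_num) Real.pi_pos (1 / 2)
    (fun s => ?_) hs
  rw [gammaPlus]
  push_cast
  ring_nf

theorem hMinus_eq {s : ℂ} (hs : s.re = 1 / 2) : hMinus s = localSpectral 1 (1 / 2) Real.pi s := by
  refine logDeriv_eq_localSpectral Complex.I_ne_zero one_pos.le (by norm_num) Real.pi_pos (1 / 2)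
    (fun s => ?_) hs
  rw [gammaMinus]
  push_cast
  ring_nf

theorem hComplex_eq (N : ℤ) {s : ℂ} (hs : s.re = 1 / 2) :
    hComplex N s = localSpectral N.natAbs 1 (2 * Real.pi) s := by
  refine logDeriv_eq_localSpectral (pow_ne_zero N.natAbs Complex.I_ne_zero) (Nat.cast_nonneg _)
    one_pos Real.two_pi_pos 1 (fun s => ?_) hs
  rw [gammaComplex]
  push_cast
  ring_nf

theorem localSpectral_critical (n r κ t : ℝ) :
    localSpectral n r κ (1 / 2 + t * Complex.I) =
      ((2 * r * reDigamma ((n + r) / 2) (r * t) + -(2 * r * Real.log κ) : ℝ) : ℂ) := by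
  have h := digamma_add_digamma_conj ((n + r) / 2) (r * t)
  rw [localSpectral]
  have e1 : (((n / 2 : ℝ) : ℂ) + r * (1 / 2 + t * Complex.I)) =
    (((n + r) / 2 : ℝ) : ℂ) + ((r * t : ℝ) : ℂ) * Complex.I := by push_cast; ring
  have e2 : (((n / 2 : ℝ) : ℂ) + r - r * (1 / 2 + t * Complex.I)) =
    (((n + r) / 2 : ℝ) : ℂ) - ((r * t : ℝ) : ℂ) * Complex.I := by push_cast; ring
  rw [e1, e2, h]
  push_cast; ring

theorem criticalLineShape_of_localSpectral {F : ℂ → ℂ} {n r κ : ℝ} (hn : 0 ≤ n) (hr : 0 < r)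
    (hF : ∀ s : ℂ, s.re = 1 / 2 → F s = localSpectral n r κ s) : CriticalLineShape F :=
  criticalLineShape_of_eq (a := (n + r) / 2) (by positivity) hr fun t => by
    rw [hF _ (by simp), localSpectral_critical]

theorem localSpectral_one_half (n r κ : ℝ) :
    localSpectral n r κ (1 / 2) =
      2 * r * (Complex.digamma (((n + r) / 2 : ℝ) : ℂ) - Real.log κ) := by
  rw [localSpectral]
  have e1 : (((n / 2 : ℝ) : ℂ) + r * (1 / 2)) = (((n + r) / 2 : ℝ) : ℂ) := by push_cast; ring
  have e2 : (((n / 2 : ℝ) : ℂ) + r - r * (1 / 2)) = (((n + r) / 2 : ℝ) : ℂ) := by push_cast; ring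
  rw [e1, e2]; ring

/-- Both sides of Euler's reflection formula are differentiated, and the result is divided by
`Γ(z)Γ(1-z) sin(πz) = π`. -/
theorem digamma_one_sub {z : ℂ} (h0 : 0 < z.re) (h1 : z.re < 1) :
    Complex.digamma z - Complex.digamma (1 - z) = -(Real.pi * Complex.cot (Real.pi * z)) := by
  have h1' : 0 < (1 - z).re := by simpa using h1
  have n1 := Complex.Gamma_ne_zero_of_re_pos h0
  have n2 := Complex.Gamma_ne_zero_of_re_pos h1'
  have hR := Complex.Gamma_mul_Gamma_one_sub z
  have hsin : Complex.sin (Real.pi * z) ≠ 0 := by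
    -- Under the convention `π / 0 = 0`, a zero of the sine would force the product of two nonzero
    -- Gamma values to vanish.
    intro h; rw [h, div_zero] at hR; exact mul_ne_zero n1 n2 hR
  have g1 : HasDerivAt (fun z : ℂ => 1 - z) (-1) z := by simpa using (hasDerivAt_id z).const_sub 1
  have g2 : HasDerivAt (fun z : ℂ => (Real.pi : ℂ) * z) Real.pi z := by
    simpa using (hasDerivAt_id z).const_mul (Real.pi : ℂ)
  have d1 := (hasDerivAt_Gamma_digamma h0).mul ((hasDerivAt_Gamma_digamma h1').comp z g1)
  have d2 := (hasDerivAt_const z (Real.pi : ℂ)).div ((Complex.hasDerivAt_sin _).comp z g2) hsin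
  have d3 := d1.unique (d2.congr_of_eventuallyEq
    (Eventually.of_forall Complex.Gamma_mul_Gamma_one_sub))
  simp only [Function.comp_apply, zero_mul, zero_sub] at d3
  rw [Complex.cot_eq_cos_div_sin]
  rw [eq_div_iff hsin] at hR
  have hπ : (Real.pi : ℂ) ≠ 0 := by exact_mod_cast Real.pi_ne_zero
  rw [eq_div_iff (pow_ne_zero 2 hsin)] at d3
  have hG : Complex.Gamma z * Complex.Gamma (1 - z) * Complex.sin (Real.pi * z) ≠ 0 := by
    rw [hR]; exact hπ
  rw [mul_div_assoc', ← neg_div, eq_div_iff hsin]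
  apply mul_left_cancel₀ hG
  linear_combination d3 + Real.pi * Complex.cos (Real.pi * z) * hR

theorem digamma_duplication {z : ℂ} (h0 : 0 < z.re) :
    Complex.digamma z + Complex.digamma (z + 1 / 2) =
      2 * Complex.digamma (2 * z) - 2 * Real.log 2 := by
  have h1 : 0 < (z + 1 / 2).re := by simp; linarith
  have h2 : 0 < (2 * z).re := by simpa using h0
  have n1 := Complex.Gamma_ne_zero_of_re_pos h0
  have n2 := Complex.Gamma_ne_zero_of_re_pos h1
  have g1 : HasDerivAt (fun z : ℂ => z + 1 / 2) 1 z := (hasDerivAt_id z).add_const _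
  have g2 : HasDerivAt (fun z : ℂ => 2 * z) 2 z := by
    simpa using (hasDerivAt_id z).const_mul (2 : ℂ)
  have g3 : HasDerivAt (fun z : ℂ => 1 - 2 * z) (-2) z := by simpa using g2.const_sub 1
  have d1 := (hasDerivAt_Gamma_digamma h0).mul ((hasDerivAt_Gamma_digamma h1).comp z g1)
  have d2 := (((hasDerivAt_Gamma_digamma h2).comp z g2).mul
    (g3.const_cpow (c := (2 : ℂ)) (Or.inl two_ne_zero))).mul_const (√Real.pi : ℂ)
  have d3 := d1.unique (d2.congr_of_eventuallyEq
    (Eventually.of_forall Complex.Gamma_mul_Gamma_add_half))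
  simp only [Function.comp_apply] at d3
  have hR := Complex.Gamma_mul_Gamma_add_half z
  have hl : ((Real.log 2 : ℝ) : ℂ) = Complex.log 2 := by
    rw [Complex.ofReal_log two_pos.le]; norm_num
  rw [hl]
  apply mul_left_cancel₀ (mul_ne_zero n1 n2)
  linear_combination d3 - (2 * Complex.digamma (2 * z) - 2 * Complex.log 2) * hR

/-- At `z = 1/4`, reflection gives the difference of the two values and duplication gives their sum
in terms of `ψ(1/2)`. -/
theorem digamma_quarters :
    Complex.digamma (1 / 4) =
      ((-(3 * Real.log 2) - Real.eulerMascheroniConstant - Real.pi / 2 : ℝ) : ℂ) ∧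
    Complex.digamma (3 / 4) =
      ((-(3 * Real.log 2) - Real.eulerMascheroniConstant + Real.pi / 2 : ℝ) : ℂ) := by
  have h1 := digamma_one_sub (z := 1 / 4) (by norm_num) (by norm_num)
  have h2 := digamma_duplication (z := 1 / 4) (by norm_num)
  have hc : Complex.cot (Real.pi * (1 / 4)) = 1 := by
    rw [Complex.cot_eq_cos_div_sin]
    have : (Real.pi * (1 / 4) : ℂ) = ((Real.pi / 4 : ℝ) : ℂ) := by push_cast; ring
    rw [this, ← Complex.ofReal_cos, ← Complex.ofReal_sin, Real.cos_pi_div_four,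
      Real.sin_pi_div_four, div_self]
    simp
  rw [hc] at h1
  norm_num at h1 h2
  have h3 := Complex.digamma_one_half
  have hl : ((Real.log 2 : ℝ) : ℂ) = Complex.log 2 := by
    rw [Complex.ofReal_log two_pos.le]; norm_num
  norm_num at h3
  rw [h3] at h2
  constructor
  · push_cast
    linear_combination (1 / 2) * h1 + (1 / 2) * h2 + 3 * hl
  · push_cast
    linear_combination (-1 / 2) * h1 + (1 / 2) * h2 + 3 * hl

theorem hPlus_half : hPlus (1 / 2) =
    ((-(Real.log (8 * Real.pi) + Real.eulerMascheroniConstant) - Real.pi / 2 : ℝ) : ℂ) := by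
  have e : (((0 + 1 / 2 : ℝ) / 2 : ℝ) : ℂ) = 1 / 4 := by norm_num
  rw [hPlus_eq (by norm_num), localSpectral_one_half, e, digamma_quarters.1,
    show (8 : ℝ) = 2 ^ 3 by norm_num, Real.log_mul (by norm_num) Real.pi_ne_zero, Real.log_pow]
  push_cast; ring

theorem hMinus_half : hMinus (1 / 2) =
    ((-(Real.log (8 * Real.pi) + Real.eulerMascheroniConstant) + Real.pi / 2 : ℝ) : ℂ) := by
  have e : (((1 + 1 / 2 : ℝ) / 2 : ℝ) : ℂ) = 3 / 4 := by norm_num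
  rw [hMinus_eq (by norm_num), localSpectral_one_half, e, digamma_quarters.2,
    show (8 : ℝ) = 2 ^ 3 by norm_num, Real.log_mul (by norm_num) Real.pi_ne_zero, Real.log_pow]
  push_cast; ring

theorem hComplex_half (N : ℤ) : hComplex N (1 / 2) =
    ((-2 * Real.log (2 * Real.pi) : ℝ) : ℂ) +
      2 * Complex.digamma (((N.natAbs : ℂ) + 1) / 2) := by
  rw [hComplex_eq N (by norm_num), localSpectral_one_half]
  push_cast; ring_nf

theorem hComplex_half_even (N : ℤ) (n : ℕ) (hN : N.natAbs = 2 * n) : hComplex N (1 / 2) =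
    ((-2 * (Real.log (8 * Real.pi) + Real.eulerMascheroniConstant)
      + 2 * ∑ j ∈ Finset.Icc 1 n, 1 / ((j : ℝ) - 1 / 2) : ℝ) : ℂ) := by
  have h := digamma_add_nat (z := 1 / 2) (by norm_num) n
  have e : (((N.natAbs : ℂ) + 1) / 2) = 1 / 2 + n := by rw [hN]; push_cast; ring
  have hs : ∑ j ∈ Finset.Icc 1 n, 1 / ((j : ℝ) - 1 / 2) =
      ∑ j ∈ Finset.range n, (1 / 2 + (j : ℝ))⁻¹ := by
    rw [← Finset.Ico_add_one_right_eq_Icc, Finset.sum_Ico_eq_sum_range]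
    refine Finset.sum_congr (by simp) fun j _ => ?_
    push_cast; rw [one_div]; congr 1; ring
  have hl : ((Real.log 2 : ℝ) : ℂ) = Complex.log 2 := by
    rw [Complex.ofReal_log two_pos.le]; norm_num
  rw [hComplex_half, e, h, hs, Complex.digamma_one_half, ← hl,
    show (8 : ℝ) = 2 ^ 3 by norm_num, Real.log_mul (by norm_num) Real.pi_ne_zero,
    Real.log_mul (by norm_num) Real.pi_ne_zero, Real.log_pow]
  push_cast; ring

theorem hComplex_half_odd (N : ℤ) (n : ℕ) (hN : N.natAbs = 2 * n + 1) : hComplex N (1 / 2) =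
    ((-2 * (Real.log (8 * Real.pi) + Real.eulerMascheroniConstant) + 4 * Real.log 2
      + 2 * ∑ j ∈ Finset.Icc 1 n, 1 / (j : ℝ) : ℝ) : ℂ) := by
  have h := digamma_add_nat (z := 1) (by norm_num) n
  have e : (((N.natAbs : ℂ) + 1) / 2) = 1 + n := by rw [hN]; push_cast; ring
  have hs : ∑ j ∈ Finset.Icc 1 n, 1 / (j : ℝ) = ∑ j ∈ Finset.range n, (1 + (j : ℝ))⁻¹ := by
    rw [← Finset.Ico_add_one_right_eq_Icc, Finset.sum_Ico_eq_sum_range]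
    refine Finset.sum_congr (by simp) fun j _ => ?_
    push_cast; rw [one_div]
  rw [hComplex_half, e, h, hs, Complex.digamma_one,
    show (8 : ℝ) = 2 ^ 3 by norm_num, Real.log_mul (by norm_num) Real.pi_ne_zero,
    Real.log_mul (by norm_num) Real.pi_ne_zero, Real.log_pow]
  push_cast; ring


/-! ### Mellin transform in the dilation parameter -/

theorem integral_norm_cpow_mul_comp_mul {Φ : ℝ → ℂ} {w : ℂ} {q : ℝ} (hq : 0 < q) :
    ∫ c in Ioi (0 : ℝ), ‖(c : ℂ) ^ (w - 1) * Φ (c * q)‖ =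
      q ^ (-w.re) * ∫ c in Ioi (0 : ℝ), ‖(c : ℂ) ^ (w - 1) * Φ c‖ := by
  have h := integral_comp_mul_left_Ioi (fun c : ℝ => ‖(c : ℂ) ^ (w - 1) * Φ c‖) 0 hq
  rw [mul_zero, smul_eq_mul] at h
  have e : q ^ (-w.re) = q ^ (-(w.re - 1)) * q⁻¹ := by
    rw [← Real.rpow_neg_one q, ← Real.rpow_add hq]; ring_nf
  rw [e, mul_assoc, ← h, ← integral_const_mul]
  refine setIntegral_congr_fun measurableSet_Ioi fun c (hc : 0 < c) => ?_
  simp only [norm_mul]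
  rw [norm_cpow_sub_one hc, norm_cpow_sub_one (mul_pos hq hc), Real.mul_rpow hq.le hc.le, mul_comm q c,
    ← mul_assoc, ← mul_assoc, ← Real.rpow_add hq]
  simp

section Fubini

variable {K : Type*} [MeasurableSpace K] {μ : Measure K} [SFinite μ]

/-- Substituting in `c`, the integral of the norm over `c` is `|q(y)^{-w}|` times a constant, so
integrability of `G q^{-w}` is enough. -/
theorem integrable_prod_mellin {G : K → ℂ} {q : K → ℝ} {w : ℂ} {Φ : ℝ → ℂ}
    (hq : Measurable q) (hq0 : ∀ᵐ y ∂μ, 0 < q y) (hGm : AEStronglyMeasurable G μ)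
    (hΦm : Measurable Φ) (hΦ : MellinConvergent Φ w)
    (hG : Integrable (fun y => G y * (q y : ℂ) ^ (-w)) μ) :
    Integrable (fun z : ℝ × K => (z.1 : ℂ) ^ (w - 1) * (G z.2 * Φ (z.1 * q z.2)))
      ((volume.restrict (Ioi 0)).prod μ) := by
  have hm : AEStronglyMeasurable
      (fun z : ℝ × K => (z.1 : ℂ) ^ (w - 1) * (G z.2 * Φ (z.1 * q z.2)))
      ((volume.restrict (Ioi 0)).prod μ) := by
    refine AEStronglyMeasurable.mul (by fun_prop : Measurable _).aestronglyMeasurable ?_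
    refine AEStronglyMeasurable.mul hGm.comp_snd ?_
    exact (by fun_prop : Measurable _).aestronglyMeasurable
  rw [integrable_prod_iff' hm]
  refine ⟨?_, ?_⟩
  · filter_upwards [hq0] with y hy
    have h := (MellinConvergent.comp_mul_left (f := Φ) (s := w) hy).2 hΦ
    refine IntegrableOn.congr_fun (h.const_mul (G y)) (fun c _ => ?_) measurableSet_Ioi
    simp only [smul_eq_mul, mul_comm (q y)]; ring
  · refine (hG.norm.mul_const (∫ c in Ioi (0 : ℝ), ‖(c : ℂ) ^ (w - 1) * Φ c‖)).congr ?_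
    filter_upwards [hq0] with y hy
    rw [norm_mul, Complex.norm_cpow_eq_rpow_re_of_pos hy, Complex.neg_re, mul_assoc,
      ← integral_norm_cpow_mul_comp_mul hy, ← integral_const_mul]
    refine integral_congr_ae (ae_of_all _ fun c => ?_)
    simp only [norm_mul]; ring

/-- Averaging over dilations separates variables: the profile `Φ` enters only through its Mellin
transform, so pairings of two functions with two different profiles can be compared. -/
theorem integral_mellin_comp_mul {G : K → ℂ} {q : K → ℝ} {w : ℂ} {Φ : ℝ → ℂ}
    (hq : Measurable q) (hq0 : ∀ᵐ y ∂μ, 0 < q y) (hGm : AEStronglyMeasurable G μ)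
    (hΦm : Measurable Φ) (hΦ : MellinConvergent Φ w)
    (hG : Integrable (fun y => G y * (q y : ℂ) ^ (-w)) μ) :
    ∫ c in Ioi (0 : ℝ), (c : ℂ) ^ (w - 1) * ∫ y, G y * Φ (c * q y) ∂μ =
      (∫ y, G y * (q y : ℂ) ^ (-w) ∂μ) * mellin Φ w := by
  have h := integral_integral_swap (f := fun (c : ℝ) (y : K) => (c : ℂ) ^ (w - 1) *
    (G y * Φ (c * q y))) (integrable_prod_mellin hq hq0 hGm hΦm hΦ hG)
  simp_rw [← integral_const_mul]
  rw [h, ← integral_mul_const]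
  refine integral_congr_ae ?_
  filter_upwards [hq0] with y hy
  have h2 := mellin_comp_mul_left Φ w hy
  rw [smul_eq_mul] at h2
  rw [mul_assoc, ← h2, mellin, ← integral_const_mul]
  refine integral_congr_ae (ae_of_all _ fun c => ?_)
  simp only [smul_eq_mul, mul_comm (q y)]; ring

/-- The profile is controlled only through convergence of its Mellin integral, so the pairing is
known to converge for almost every `c`. This suffices under the integral over `c`. -/
theorem ae_integrable_mellin_section {G : K → ℂ} {q : K → ℝ} {w : ℂ} {Φ : ℝ → ℂ}
    (hq : Measurable q) (hq0 : ∀ᵐ y ∂μ, 0 < q y) (hGm : AEStronglyMeasurable G μ)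
    (hΦm : Measurable Φ) (hΦ : MellinConvergent Φ w)
    (hG : Integrable (fun y => G y * (q y : ℂ) ^ (-w)) μ) :
    ∀ᵐ c ∂(volume.restrict (Ioi (0 : ℝ))), Integrable (fun y => G y * Φ (c * q y)) μ := by
  have h := (integrable_prod_mellin hq hq0 hGm hΦm hΦ hG).prod_right_ae
  filter_upwards [h, ae_restrict_mem measurableSet_Ioi] with c hc (hc0 : 0 < c)
  have hne : (c : ℂ) ^ (w - 1) ≠ 0 := by
    rw [Ne, Complex.cpow_eq_zero_iff]
    exact fun h => hc0.ne' (by exact_mod_cast h.1)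
  refine (hc.const_mul ((c : ℂ) ^ (w - 1))⁻¹).congr (ae_of_all _ fun y => ?_)
  exact inv_mul_cancel_left₀ hne _

end Fubini

/-- The part of the conductor operator applied to a Gaussian that comes from dilations. -/
noncomputable def dilationIntegral (β x : ℝ) : ℝ := ∫ v in Ioi (0 : ℝ), dilationKernel β x v

theorem measurable_dilationIntegral (β : ℝ) : Measurable (dilationIntegral β) :=
  ((measurable_dilationKernel β).stronglyMeasurable.integral_prod_right
    (ν := volume.restrict (Ioi (0 : ℝ)))).measurable

theorem mellin_dilationIntegral {β : ℝ} {w : ℂ} (hw : 0 < w.re) (hwβ : w.re < β) :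
    MellinConvergent (fun x => (dilationIntegral β x : ℂ)) w ∧
      mellin (fun x => (dilationIntegral β x : ℂ)) w =
        Complex.Gamma w * Complex.digamma (β - w) := by
  have e : ∀ x : ℝ, (x : ℂ) ^ (w - 1) • (dilationIntegral β x : ℂ) =
      ∫ v in Ioi (0 : ℝ), (x : ℂ) ^ (w - 1) * (dilationKernel β x v : ℂ) := by
    intro x
    rw [integral_const_mul, integral_complex_ofReal, dilationIntegral, smul_eq_mul]
  refine ⟨?_, ?_⟩
  · have h := (integrable_dilationKernel hw hwβ).integral_prod_left
    simp only [← e] at h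
    exact h
  · rw [mellin, ← integral_cpow_mul_dilationKernel hw hwβ]
    simp only [e]

/-- The profile of the image of a Gaussian under the conductor operator. -/
noncomputable def conductorProfile (β r κ x : ℝ) : ℝ :=
  r * (dilationIntegral β x + (Real.log x - 2 * Real.log κ) * Real.exp (-x))

theorem measurable_conductorProfile (β r κ : ℝ) : Measurable (conductorProfile β r κ) := by
  have := measurable_dilationIntegral β
  unfold conductorProfile
  fun_prop

/-- The three terms of the profile account for the three terms of the spectral function: the
dilation integral for `ψ(β - w)`, the factor `log x` for `ψ(w)`, and the constant for `-2 log κ`. -/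
theorem mellin_conductorProfile {β r κ : ℝ} {w : ℂ} (hw : 0 < w.re) (hwβ : w.re < β) :
    MellinConvergent (fun x => (conductorProfile β r κ x : ℂ)) w ∧
      mellin (fun x => (conductorProfile β r κ x : ℂ)) w = Complex.Gamma w *
        (r * (Complex.digamma w + Complex.digamma (β - w) - 2 * Real.log κ)) := by
  obtain ⟨i1, m1⟩ := mellin_dilationIntegral hw hwβ
  obtain ⟨i2, m2⟩ := mellinConvergent_log_mul_exp_neg hw
  have i3 := mellinConvergent_exp_neg_mul hw one_pos
  have m3 := mellin_exp_neg_mul hw one_pos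
  have e : ∀ x : ℝ, (x : ℂ) ^ (w - 1) • (conductorProfile β r κ x : ℂ) =
      r * (((x : ℂ) ^ (w - 1) • (dilationIntegral β x : ℂ) +
        (x : ℂ) ^ (w - 1) • ((Real.log x * Real.exp (-x) : ℝ) : ℂ)) -
        2 * Real.log κ * ((x : ℂ) ^ (w - 1) • (Real.exp (-(1 * x)) : ℂ))) := by
    intro x
    rw [conductorProfile, one_mul]
    simp only [smul_eq_mul]
    push_cast; ring
  have hi := (((i1.add i2).sub (i3.const_mul (2 * Real.log κ : ℂ))).const_mul (r : ℂ))
  refine ⟨?_, ?_⟩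
  · refine IntegrableOn.congr_fun hi (fun x _ => ?_) measurableSet_Ioi
    rw [e]; rfl
  · rw [mellin] at *
    simp_rw [e]
    have a1 := integral_sub (i1.add i2) (i3.const_mul (2 * Real.log κ : ℂ))
    have a2 := integral_add i1 i2
    simp only [Pi.add_apply] at a1
    rw [integral_const_mul, a1, a2, integral_const_mul, m1, m2, m3, Complex.ofReal_one, Complex.one_cpow]
    ring

/-! ### The conductor operator tested against Gaussians -/

section Conductor

variable {K : Type*} [Field K] [MeasurableSpace K] {P : LocalPlace K}

theorem fourierIntegralAt_const_mul (c : ℂ) (φ : K → ℂ) (x : K) :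
    fourierIntegralAt P (fun y => c * φ y) x = c * fourierIntegralAt P φ x := by
  simp only [fourierIntegralAt, mul_assoc, integral_const_mul]

/-- `A` is moved onto the test function directly. For `B` the duality formula is used twice: with `b
= B f`, and `ψ`, `ψ'` the transforms of `f` and `b`, the pairing `∫ b γ̃` is `∫ ψ' γ = ∫ ψ log|x|
γ`, which is `f` paired with the transform of `log|x| γ`. -/
theorem integral_conductor {f g : Lp ℂ 2 P.haar} (h : IsConductor P f g) {γ γ' : K → ℂ}
    (h1 : Integrable γ P.haar) (h2 : MemLp γ 2 P.haar) (hγ : fourierIntegralAt P γ = γ')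
    (h3 : MemLp γ' 2 P.haar)
    (h4 : Integrable (fun x => (Real.log (P.abs x) : ℂ) * γ x) P.haar)
    (h5 : MemLp (fun x => (Real.log (P.abs x) : ℂ) * γ x) 2 P.haar) :
    Integrable (fun y => f y * ((Real.log (P.abs y) : ℂ) * γ' y)) P.haar ∧
    ∫ y, g y * γ' y ∂P.haar = (∫ y, f y * ((Real.log (P.abs y) : ℂ) * γ' y) ∂P.haar) +
      ∫ y, f y * fourierIntegralAt P (fun x => (Real.log (P.abs x) : ℂ) * γ x) y ∂P.haar := by
  obtain ⟨a, b, ha, ⟨ψ, ψ', hψ, hψψ', hb⟩, rfl⟩ := h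
  have ia : Integrable (fun y => a y * γ' y) P.haar := (Lp.memLp a).integrable_mul h3
  have ib : Integrable (fun y => b y * γ' y) P.haar := (Lp.memLp b).integrable_mul h3
  have ea : (fun y => a y * γ' y) =ᵐ[P.haar] fun y => f y * ((Real.log (P.abs y) : ℂ) * γ' y) := by
    filter_upwards [ha] with y hy
    rw [hy]; ring
  refine ⟨ia.congr ea, ?_⟩
  have e1 := hb γ h1 h2
  have e2 := hψ _ h4 h5
  rw [hγ] at e1
  rw [← e2, ← integral_congr_ae ea]
  have e3 : ∫ x, ψ x * ((Real.log (P.abs x) : ℂ) * γ x) ∂P.haar = ∫ x, ψ' x * γ x ∂P.haar := by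
    refine integral_congr_ae ?_
    filter_upwards [hψψ'] with y hy
    rw [hy]; ring
  rw [e3, e1, ← integral_add ia ib]
  refine integral_congr_ae ?_
  filter_upwards [Lp.coeFn_add a b] with y hy
  rw [hy, Pi.add_apply, add_mul]

/-- A family of Gaussians `p' e^{-cκQ}` on `K`, compatible with the Fourier transform. -/
structure IsGaussianFamily (P : LocalPlace K) (Q : K → ℝ) (p p' : K → ℂ) (n r κ : ℝ) (ι : ℂ) :
    Prop where
  n_nonneg : 0 ≤ n
  r_pos : 0 < r
  κ_pos : 0 < κ
  ι_ne : ι ≠ 0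
  meas_Q : Measurable Q
  Q_nonneg : ∀ y, 0 ≤ Q y
  Q_pos : ∀ᵐ y ∂P.haar, 0 < Q y
  abs_eq : ∀ y, P.abs y = Q y ^ r
  meas_char : Measurable P.char
  norm_char : ∀ x, ‖P.char x‖ = 1
  meas_p : Measurable p
  meas_p' : Measurable p'
  norm_p : ∀ y, ‖p y‖ = Q y ^ (n / 2)
  norm_p' : ∀ y, ‖p' y‖ = Q y ^ (n / 2)
  integrable : ∀ a : ℝ, -r < a → ∀ c : ℝ, 0 < c →
    Integrable (fun y => Q y ^ a * Real.exp (-(c * Q y))) P.haar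
  fourier : ∀ c : ℝ, 0 < c → ∀ x, fourierIntegralAt P
    (fun y => p' y * (Real.exp (-(c * (κ * Q y))) : ℂ)) x =
      ι * (c ^ (-(n + r)) : ℝ) * (p x * (Real.exp (-(κ * Q x / c)) : ℂ))

theorem abs_log_le_rpow_add_rpow {q δ : ℝ} (hq : 0 < q) (hδ : 0 < δ) :
    |Real.log q| ≤ δ⁻¹ * (q ^ δ + q ^ (-δ)) := by
  have h1 := Real.log_le_rpow_div hq.le hδ
  have h2 := Real.log_le_rpow_div (inv_pos.2 hq).le hδ
  rw [Real.log_inv, Real.inv_rpow hq.le, ← Real.rpow_neg hq.le] at h2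
  have p1 := div_pos (Real.rpow_pos_of_pos hq δ) hδ
  have p2 := div_pos (Real.rpow_pos_of_pos hq (-δ)) hδ
  rw [mul_add, inv_mul_eq_div, inv_mul_eq_div]
  exact abs_le.2 ⟨by linarith, by linarith⟩

namespace IsGaussianFamily

variable {Q : K → ℝ} {p p' : K → ℂ} {n r κ : ℝ} {ι : ℂ}

theorem integrable_of_norm_le (hP : IsGaussianFamily P Q p p' n r κ ι) {c : ℝ} (hc : 0 < c)
    {φ : K → ℂ} (hφ : Measurable φ)
    (h : ∀ᵐ y ∂P.haar, ‖φ y‖ = Q y ^ (n / 2) * Real.exp (-(c * Q y))) :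
    Integrable φ P.haar ∧ MemLp φ 2 P.haar ∧
      Integrable (fun y => (Real.log (P.abs y) : ℂ) * φ y) P.haar ∧
      MemLp (fun y => (Real.log (P.abs y) : ℂ) * φ y) 2 P.haar := by
  have hr := hP.r_pos
  have hn := hP.n_nonneg
  have hlogm : Measurable (fun y => (Real.log (P.abs y) : ℂ)) := by
    have := hP.meas_Q
    simp only [hP.abs_eq]
    fun_prop
  -- With this `δ` the exponents `n/2 - δ` and `n - 2δ`, arising from `log` and `log²` near `0`,
  -- stay above the integrability threshold `-r`.
  set δ := r / 4 with hδ
  have hδ0 : 0 < δ := by positivity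
  have hlog : ∀ᵐ y ∂P.haar, ‖(Real.log (P.abs y) : ℂ)‖ ≤ r * δ⁻¹ * (Q y ^ δ + Q y ^ (-δ)) := by
    filter_upwards [hP.Q_pos] with y hy
    rw [Complex.norm_real, Real.norm_eq_abs, hP.abs_eq, Real.log_rpow hy, abs_mul,
      abs_of_pos hr, mul_assoc]
    gcongr
    exact abs_log_le_rpow_add_rpow hy hδ0
  refine ⟨?_, ?_, ?_, ?_⟩
  · refine Integrable.mono' (hP.integrable (n / 2) (by linarith) c hc) hφ.aestronglyMeasurable ?_
    filter_upwards [h] with y hy using hy.le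
  · rw [memLp_two_iff_integrable_sq_norm hφ.aestronglyMeasurable]
    refine (hP.integrable n (by linarith) (2 * c) (by positivity)).congr ?_
    filter_upwards [h, hP.Q_pos] with y hy hQ
    rw [hy, mul_pow, ← Real.exp_nat_mul, ← Real.rpow_mul_natCast hQ.le]
    push_cast; ring_nf
  · refine Integrable.mono' (((hP.integrable (n / 2 + δ) (by linarith) c hc).add
      (hP.integrable (n / 2 - δ) (by linarith) c hc)).const_mul (r * δ⁻¹))
      (hlogm.mul hφ).aestronglyMeasurable ?_
    filter_upwards [h, hlog, hP.Q_pos] with y hy hl hQ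
    rw [norm_mul, hy]
    refine (mul_le_mul_of_nonneg_right hl (by positivity)).trans (le_of_eq ?_)
    rw [Pi.add_apply, Real.rpow_add hQ, sub_eq_add_neg, Real.rpow_add hQ]
    ring
  · have hm : Measurable (fun y => (Real.log (P.abs y) : ℂ) * φ y) := hlogm.mul hφ
    rw [memLp_two_iff_integrable_sq_norm hm.aestronglyMeasurable]
    refine Integrable.mono' (((hP.integrable (n + 2 * δ) (by linarith) (2 * c) (by positivity)).add
      (hP.integrable (n - 2 * δ) (by linarith) (2 * c) (by positivity))).const_mul
        (2 * (r * δ⁻¹) ^ 2)) (hm.norm.pow_const 2).aestronglyMeasurable ?_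
    filter_upwards [h, hlog, hP.Q_pos] with y hy hl hQ
    rw [Real.norm_of_nonneg (by positivity), norm_mul, hy, mul_pow]
    have h1 : ‖(Real.log (P.abs y) : ℂ)‖ ^ 2 ≤
        2 * (r * δ⁻¹) ^ 2 * (Q y ^ (2 * δ) + Q y ^ (-(2 * δ))) := by
      refine (pow_le_pow_left₀ (norm_nonneg _) hl 2).trans ?_
      rw [mul_pow, show Q y ^ (2 * δ) = (Q y ^ δ) ^ 2 by
          rw [← Real.rpow_mul_natCast hQ.le]; push_cast; ring_nf,
        show Q y ^ (-(2 * δ)) = (Q y ^ (-δ)) ^ 2 by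
          rw [← Real.rpow_mul_natCast hQ.le]; push_cast; ring_nf]
      nlinarith [mul_nonneg (sq_nonneg (r * δ⁻¹)) (sq_nonneg (Q y ^ δ - Q y ^ (-δ)))]
    have h2 : (Q y ^ (n / 2) * Real.exp (-(c * Q y))) ^ 2 = Q y ^ n * Real.exp (-(2 * c * Q y)) := by
      rw [mul_pow, ← Real.exp_nat_mul, ← Real.rpow_mul_natCast hQ.le]
      push_cast; ring_nf
    rw [h2]
    refine (mul_le_mul_of_nonneg_right h1 (by positivity)).trans (le_of_eq ?_)
    rw [Pi.add_apply, Real.rpow_add hQ, sub_eq_add_neg, Real.rpow_add hQ]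
    ring

/-- Frullani's formula is used at `q = κQ(x)/c`, which makes `e^{-vq}` merge with the Gaussian
`e^{-κQ/c}` into `e^{-(1+v)κQ/c}`. Transforming for each `v` produces the dilated Gaussian in
`dilationKernel`, with exponent `β = n + r` from the scaling of the transform. The terms `log c -
log κ` correct `log q` to `log|x|`. -/
theorem fourier_log_mul [SFinite P.haar] [MeasurableMul₂ K] [MeasurableNeg K]
    (hP : IsGaussianFamily P Q p p' n r κ ι) {c : ℝ} (hc : 0 < c) (y : K) :
    fourierIntegralAt P (fun x => (Real.log (P.abs x) : ℂ) *
      (p' x * (Real.exp (-(c⁻¹ * (κ * Q x))) : ℂ))) y =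
      ι * (c ^ (n + r) : ℝ) * (p y * ((r * (dilationIntegral (n + r) (c * (κ * Q y)) +
        (Real.log c - Real.log κ) * Real.exp (-(c * (κ * Q y)))) : ℝ) : ℂ)) := by
  have hr := hP.r_pos
  have hκ := hP.κ_pos
  have hQm := hP.meas_Q
  have hpm := hP.meas_p'
  have hcm := hP.meas_char
  set E : ℝ → K → ℂ := fun a x => p' x * (Real.exp (-(a * (κ * Q x))) : ℂ) with hE
  have hEm : ∀ a, Measurable (E a) := fun a => by fun_prop
  have hEn : ∀ a, 0 < a → ∀ᵐ x ∂P.haar, ‖E a x‖ = Q x ^ (n / 2) * Real.exp (-(a * κ * Q x)) := by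
    intro a _
    refine ae_of_all _ fun x => ?_
    rw [hE]
    simp only [norm_mul, hP.norm_p', Complex.norm_real, Real.norm_eq_abs, Real.abs_exp, mul_assoc]
  have hEi : ∀ a, 0 < a → Integrable (E a) P.haar := fun a ha =>
    (hP.integrable_of_norm_le (c := a * κ) (by positivity) (hEm a) (hEn a ha)).1
  have hc' : 0 < c⁻¹ := inv_pos.2 hc
  have hEl := (hP.integrable_of_norm_le (c := c⁻¹ * κ) (by positivity) (hEm _) (hEn _ hc')).2.2.1
  have hmulc : ∀ φ : K → ℂ, Integrable φ P.haar →
      Integrable (fun x => φ x * P.char (-(y * x))) P.haar := by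
    intro φ hφ
    refine hφ.mul_bdd (c := 1) (by fun_prop : Measurable _).aestronglyMeasurable ?_
    exact ae_of_all _ fun x => (hP.norm_char _).le
  -- the Frullani representation of the logarithm
  set F : K → ℝ → ℂ := fun x v => (((Real.exp (-v) - Real.exp (-(v * (κ * Q x / c)))) / v : ℝ) : ℂ) *
    (E c⁻¹ x * P.char (-(y * x))) with hFdef
  have hFm : Measurable (fun z : K × ℝ => F z.1 z.2) := by fun_prop
  have hqlog : ∀ᵐ x ∂P.haar, Real.log (κ * Q x / c) =
      r⁻¹ * Real.log (P.abs x) + (Real.log κ - Real.log c) := by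
    filter_upwards [hP.Q_pos] with x hx
    rw [hP.abs_eq, Real.log_rpow hx, Real.log_div (by positivity) hc.ne',
      Real.log_mul hκ.ne' hx.ne']
    field_simp
    ring
  -- Integrated over `v` first, the norm gives `|log(κQ/c)|` times a Gaussian, a combination of
  -- functions already known to be integrable.
  have hFint : Integrable (fun z : K × ℝ => F z.1 z.2) (P.haar.prod (volume.restrict (Ioi 0))) := by
    rw [integrable_prod_iff hFm.aestronglyMeasurable]
    refine ⟨?_, ?_⟩
    · filter_upwards [hP.Q_pos] with x hx
      exact ((integrableOn_exp_neg_sub_div (q := κ * Q x / c) (by positivity)).ofReal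
        (𝕜 := ℂ)).mul_const (E c⁻¹ x * P.char (-(y * x)))
    · have h1 := ((hEl.const_mul (r⁻¹ : ℂ)).add
        ((hEi _ hc').const_mul (Real.log κ - Real.log c : ℂ))).norm
      refine h1.congr ?_
      filter_upwards [hP.Q_pos, hqlog] with x hx hl
      simp only [hFdef, norm_mul, hP.norm_char, mul_one]
      rw [integral_mul_const]
      simp only [Complex.norm_real, Real.norm_eq_abs]
      rw [integral_abs_exp_neg_sub_div (by positivity : 0 < κ * Q x / c), hl, ← Real.norm_eq_abs,
        ← Complex.norm_real, ← norm_mul]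
      congr 1
      simp only [Pi.add_apply]
      push_cast
      ring
  have hswap := integral_integral_swap (f := F) hFint
  have hL : ∀ᵐ x ∂P.haar, ∫ v in Ioi (0 : ℝ), F x v =
      r⁻¹ * (((Real.log (P.abs x) : ℂ) * E c⁻¹ x) * P.char (-(y * x))) +
      (Real.log κ - Real.log c) * (E c⁻¹ x * P.char (-(y * x))) := by
    filter_upwards [hP.Q_pos, hqlog] with x hx hl
    rw [hFdef]
    dsimp only
    rw [integral_mul_const, integral_complex_ofReal,
      integral_exp_neg_sub_div (by positivity : 0 < κ * Q x / c), hl]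
    push_cast
    ring
  have hR : ∀ v ∈ Ioi (0 : ℝ), ∫ x, F x v ∂P.haar = ι * (c ^ (n + r) : ℝ) * p y *
      (dilationKernel (n + r) (c * (κ * Q y)) v : ℂ) := by
    intro v (hv : 0 < v)
    have h1v : 0 < (1 + v) / c := by positivity
    have e : ∀ x, F x v = (Real.exp (-v) / v : ℂ) * (E c⁻¹ x * P.char (-(y * x))) -
        (v : ℂ)⁻¹ * (E ((1 + v) / c) x * P.char (-(y * x))) := by
      intro x
      have : Real.exp (-((1 + v) / c * (κ * Q x))) =
          Real.exp (-(v * (κ * Q x / c))) * Real.exp (-(c⁻¹ * (κ * Q x))) := by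
        rw [← Real.exp_add]; congr 1; field_simp; ring
      simp only [hFdef, hE, this]
      push_cast; ring
    simp_rw [e]
    rw [integral_sub ((hmulc _ (hEi _ hc')).const_mul _) ((hmulc _ (hEi _ h1v)).const_mul _),
      integral_const_mul, integral_const_mul]
    have f1 := hP.fourier c⁻¹ hc' y
    have f2 := hP.fourier _ h1v y
    rw [fourierIntegralAt] at f1 f2
    rw [f1, f2, dilationKernel, Real.inv_rpow hc.le, Real.rpow_neg hc.le, inv_inv,
      Real.div_rpow (by positivity) hc.le, Real.rpow_neg hc.le, div_inv_eq_mul ((1 + v) ^ (-(n + r)))]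
    have e1 : κ * Q y / c⁻¹ = c * (κ * Q y) := by field_simp
    have e2 : κ * Q y / ((1 + v) / c) = c * (κ * Q y) / (1 + v) := by field_simp
    rw [e1, e2]
    push_cast
    ring
  rw [setIntegral_congr_fun measurableSet_Ioi hR, integral_const_mul, integral_complex_ofReal,
    integral_congr_ae hL, integral_add ((hmulc _ hEl).const_mul _) ((hmulc _ (hEi _ hc')).const_mul _),
    integral_const_mul, integral_const_mul] at hswap
  have f1 := hP.fourier c⁻¹ hc' y
  rw [fourierIntegralAt, Real.inv_rpow hc.le, Real.rpow_neg hc.le, inv_inv,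
    show κ * Q y / c⁻¹ = c * (κ * Q y) by field_simp] at f1
  rw [f1] at hswap
  rw [fourierIntegralAt]
  have hr' : (r : ℂ) ≠ 0 := by exact_mod_cast hr.ne'
  have hd : ∫ v in Ioi (0 : ℝ), dilationKernel (n + r) (c * (κ * Q y)) v =
    dilationIntegral (n + r) (c * (κ * Q y)) := rfl
  rw [hd, ← eq_sub_iff_add_eq, Complex.ofReal_inv, inv_mul_eq_iff_eq_mul₀ hr'] at hswap
  rw [hswap]
  push_cast
  ring

/-- For almost every `c`, pairing `g` with `p e^{-cκQ}` equals pairing `f` with `p` times the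
conductor profile. Taking Mellin transforms in `c` at `w = n/2 + rs` gives the claim: `hχ` turns `p
(κQ)^{-w}` into `χ⁻¹ |y|^{-s}` up to `κ^{-w}`, and `Re w = (n+r)/2` lies strictly between `0` and `n
+ r`. -/
theorem isSpectralFunction [SFinite P.haar] [MeasurableMul₂ K] [MeasurableNeg K]
    (hP : IsGaussianFamily P Q p p' n r κ ι) {χ : K → ℂ}
    (hχ : ∀ y, 0 < Q y → ∀ s : ℂ,
      p y * (Q y : ℂ) ^ (-((n / 2 : ℝ) + r * s)) = (χ y)⁻¹ * (P.abs y : ℂ) ^ (-s)) :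
    IsSpectralFunction P χ (localSpectral n r κ) := by
  intro f g hfg hf hg s hs
  have hr := hP.r_pos
  have hκ := hP.κ_pos
  have hn := hP.n_nonneg
  have hQm := hP.meas_Q
  have hpm := hP.meas_p
  have hpm' := hP.meas_p'
  set w : ℂ := (n / 2 : ℝ) + r * s with hw
  have hwre : w.re = (n + r) / 2 := by simp [hw, hs]; ring
  have hw0 : 0 < w.re := by rw [hwre]; positivity
  have hwβ : w.re < n + r := by rw [hwre]; linarith
  set q : K → ℝ := fun y => κ * Q y with hq
  have hqm : Measurable q := by fun_prop
  have hq0 : ∀ᵐ y ∂P.haar, 0 < q y := by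
    filter_upwards [hP.Q_pos] with y hy using mul_pos hκ hy
  have hκ' : (κ : ℂ) ≠ 0 := by exact_mod_cast hκ.ne'
  have hqw : ∀ h : K → ℂ, ∀ᵐ y ∂P.haar, h y * p y * (q y : ℂ) ^ (-w) =
      (κ : ℂ) ^ (-w) * (h y * ((χ y)⁻¹ * (P.abs y : ℂ) ^ (-s))) := by
    intro h
    filter_upwards [hP.Q_pos] with y hy
    rw [← hχ y hy s, hq]
    dsimp only
    rw [Complex.ofReal_mul, Complex.mul_cpow_ofReal_nonneg hκ.le hy.le]
    ring
  have hint : ∀ h : K → ℂ, AEStronglyMeasurable h P.haar →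
      Integrable (fun y => h y * (P.abs y : ℂ) ^ (-(1 / 2) : ℂ)) P.haar →
      Integrable (fun y => h y * p y * (q y : ℂ) ^ (-w)) P.haar := by
    intro h hm hi
    refine (hi.norm.mul_const (κ ^ (-w.re))).mono' ?_ ?_
    · exact (hm.mul hpm.aestronglyMeasurable).mul (by fun_prop : Measurable _).aestronglyMeasurable
    · filter_upwards [hP.Q_pos] with y hy
      have hay : 0 < P.abs y := by rw [hP.abs_eq]; positivity
      have hqy : 0 < q y := mul_pos hκ hy
      refine le_of_eq ?_
      rw [norm_mul, norm_mul, norm_mul, hP.norm_p, Complex.norm_cpow_eq_rpow_re_of_pos hqy,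
        Complex.norm_cpow_eq_rpow_re_of_pos hay, hP.abs_eq, ← Real.rpow_mul hy.le, hq,
        Complex.neg_re]
      dsimp only
      rw [Real.mul_rpow hκ.le hy.le, hwre]
      have : Q y ^ (n / 2) * Q y ^ (-((n + r) / 2)) = Q y ^ (r * (-(1 / 2) : ℂ).re) := by
        rw [← Real.rpow_add hy]; congr 1; norm_num; ring
      rw [← this]; ring
  have mf := (Lp.memLp f).1
  have mg := (Lp.memLp g).1
  have i1 := hint f mf hf
  have i2 := hint g mg hg
  obtain ⟨cΦ, mΦ⟩ := mellin_conductorProfile (r := r) (κ := κ) hw0 hwβ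
  have mΦm : Measurable (fun x => (conductorProfile (n + r) r κ x : ℂ)) :=
    Complex.measurable_ofReal.comp (measurable_conductorProfile _ _ _)
  have cE := mellinConvergent_exp_neg_mul hw0 one_pos
  have mE := mellin_exp_neg_mul hw0 one_pos
  have A1 := integral_mellin_comp_mul hqm hq0 (mf.mul hpm.aestronglyMeasurable) mΦm cΦ i1
  have A2 := integral_mellin_comp_mul hqm hq0 (mg.mul hpm.aestronglyMeasurable)
    (by fun_prop) cE i2
  have A3 := ae_integrable_mellin_section hqm hq0 (mf.mul hpm.aestronglyMeasurable) mΦm cΦ i1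
  have key : ∀ᵐ (c : ℝ) ∂(volume.restrict (Ioi (0 : ℝ))),
      (c : ℂ) ^ (w - 1) * ∫ y, g y * p y * (Real.exp (-(1 * (c * q y))) : ℂ) ∂P.haar =
      (c : ℂ) ^ (w - 1) * ∫ y, f y * p y * (conductorProfile (n + r) r κ (c * q y) : ℂ) ∂P.haar := by
    filter_upwards [A3, ae_restrict_mem measurableSet_Ioi] with c hic (hc : 0 < c)
    congr 1
    have hc' : 0 < c⁻¹ := inv_pos.2 hc
    have hcβ : 0 < c ^ (n + r) := Real.rpow_pos_of_pos hc _
    have hk : ι * (c ^ (n + r) : ℝ) ≠ 0 := mul_ne_zero hP.ι_ne (by exact_mod_cast hcβ.ne')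
    obtain ⟨t1, t2, t3, t4⟩ := hP.integrable_of_norm_le (c := c⁻¹ * κ)
      (φ := fun y => p' y * (Real.exp (-(c⁻¹ * (κ * Q y))) : ℂ)) (by positivity) (by fun_prop)
      (ae_of_all _ fun x => by
        simp only [norm_mul, hP.norm_p', Complex.norm_real, Real.norm_eq_abs, Real.abs_exp,
          mul_assoc])
    obtain ⟨t5, t6, -, -⟩ := hP.integrable_of_norm_le (c := c * κ)
      (φ := fun y => ι * (c ^ (n + r) : ℝ) * (p y * (Real.exp (-(c * (κ * Q y))) : ℂ)) /
        (ι * (c ^ (n + r) : ℝ))) (by positivity) (by fun_prop)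
      (ae_of_all _ fun x => by
        rw [mul_div_cancel_left₀ _ hk]
        simp only [norm_mul, hP.norm_p, Complex.norm_real, Real.norm_eq_abs, Real.abs_exp,
          mul_assoc])
    have hγ : fourierIntegralAt P (fun y => p' y * (Real.exp (-(c⁻¹ * (κ * Q y))) : ℂ)) =
        fun x => ι * (c ^ (n + r) : ℝ) * (p x * (Real.exp (-(c * (κ * Q x))) : ℂ)) := by
      funext x
      rw [hP.fourier _ hc', Real.inv_rpow hc.le, Real.rpow_neg hc.le, inv_inv,
        show κ * Q x / c⁻¹ = c * (κ * Q x) by field_simp]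
    have t7 : MemLp (fun x => ι * (c ^ (n + r) : ℝ) *
        (p x * (Real.exp (-(c * (κ * Q x))) : ℂ))) 2 P.haar := by
      refine (t6.const_mul (ι * (c ^ (n + r) : ℝ))).ae_eq (ae_of_all _ fun x => ?_)
      exact mul_div_cancel₀ _ hk
    obtain ⟨j1, j2⟩ := integral_conductor hfg t1 t2 hγ t7 t3 t4
    have hfe : fourierIntegralAt P (fun x => (Real.log (P.abs x) : ℂ) *
        (p' x * (Real.exp (-(c⁻¹ * (κ * Q x))) : ℂ))) = _ := funext fun y => hP.fourier_log_mul hc y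
    rw [hfe] at j2
    -- At `x = cκQ(y)` one has `log x - 2 log κ = log Q(y) + (log c - log κ)`; the first summand
    -- comes from `A`, the second from `B`.
    have hsum : ∀ᵐ y ∂P.haar, f y * p y * (conductorProfile (n + r) r κ (c * q y) : ℂ) *
        (ι * (c ^ (n + r) : ℝ)) =
        f y * ((Real.log (P.abs y) : ℂ) * (ι * (c ^ (n + r) : ℝ) *
          (p y * (Real.exp (-(c * (κ * Q y))) : ℂ)))) +
        f y * (ι * (c ^ (n + r) : ℝ) * (p y * ((r * (dilationIntegral (n + r) (c * (κ * Q y)) +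
        (Real.log c - Real.log κ) * Real.exp (-(c * (κ * Q y)))) : ℝ) : ℂ))) := by
      filter_upwards [hP.Q_pos] with y hy
      rw [conductorProfile, hP.abs_eq, Real.log_rpow hy, hq]
      dsimp only
      rw [Real.log_mul hc.ne' (by positivity), Real.log_mul hκ.ne' hy.ne']
      push_cast
      ring
    have hic' := hic.mul_const (ι * (c ^ (n + r) : ℝ))
    -- Integrability of the part containing `dilationIntegral` is obtained by difference: the whole
    -- profile is integrable against `f` for this `c`, and so is the part with `log|y|`.
    have j3 := (hic'.congr hsum).sub j1
    have j4 : Integrable (fun y => f y * (ι * (c ^ (n + r) : ℝ) *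
        (p y * ((r * (dilationIntegral (n + r) (c * (κ * Q y)) +
        (Real.log c - Real.log κ) * Real.exp (-(c * (κ * Q y)))) : ℝ) : ℂ)))) P.haar :=
      j3.congr (ae_of_all _ fun y => by simp only [Pi.sub_apply]; ring)
    rw [← integral_add j1 j4, ← integral_congr_ae hsum, integral_mul_const] at j2
    rw [← mul_left_inj' hk, ← j2, ← integral_mul_const]
    refine integral_congr_ae (ae_of_all _ fun y => ?_)
    simp only [hq, one_mul]
    ring
  have hkey := integral_congr_ae key
  have hΓ := Complex.Gamma_ne_zero_of_re_pos hw0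
  have hκw : (κ : ℂ) ^ (-w) ≠ 0 := by simp [Complex.cpow_eq_zero_iff, hκ']
  simp only [Pi.mul_apply] at A1 A2
  rw [A1, A2, mE, mΦ, integral_congr_ae (hqw g), integral_congr_ae (hqw f), integral_const_mul,
    integral_const_mul, Complex.ofReal_one, Complex.one_cpow, one_mul] at hkey
  have hspec : localSpectral n r κ s =
      r * (Complex.digamma w + Complex.digamma (((n + r : ℝ) : ℂ) - w) - 2 * Real.log κ) := by
    rw [localSpectral, hw]
    congr 4
    push_cast; ring
  rw [hspec]
  apply mul_left_cancel₀ (mul_ne_zero hκw hΓ)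
  linear_combination hkey

end IsGaussianFamily

end Conductor


/-! ### Gaussians at the real place -/

theorem ofReal_sq_cpow {x : ℝ} (hx : 0 < x) (w : ℂ) : ((x ^ 2 : ℝ) : ℂ) ^ w = (x : ℂ) ^ (2 * w) := by
  have hx' : (x : ℂ) ≠ 0 := by exact_mod_cast hx.ne'
  rw [pow_two, Complex.ofReal_mul, Complex.mul_cpow_ofReal_nonneg hx.le hx.le,
    ← Complex.cpow_add _ _ hx', two_mul]

theorem integrable_abs_rpow_mul_exp_neg_mul_sq {a c : ℝ} (ha : -(1 / 2) < a) (hc : 0 < c) :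
    Integrable (fun y : ℝ => (y ^ 2) ^ a * Real.exp (-(c * y ^ 2))) := by
  have h := integral_rpow_mul_exp_neg_mul_rpow (p := 2) (q := 2 * a) (b := c) two_pos
    (by linarith) hc
  have h2 := integral_comp_abs (f := fun y : ℝ => y ^ (2 * a) * Real.exp (-c * y ^ (2 : ℝ)))
  rw [h] at h2
  have hΓ : 0 < Real.Gamma ((2 * a + 1) / 2) := Real.Gamma_pos_of_pos (by linarith)
  -- A nonzero value of the integral certifies integrability, since the integral of a nonintegrable
  -- function is `0` by convention.
  refine (Integrable.of_integral_ne_zero (f := fun y : ℝ => |y| ^ (2 * a) *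
    Real.exp (-c * |y| ^ (2 : ℝ))) (by rw [h2]; positivity)).congr (ae_of_all _ fun y => ?_)
  dsimp only
  rw [Real.rpow_mul (abs_nonneg y), Real.rpow_two, sq_abs, neg_mul]

theorem norm_realPlace_char (x : ℝ) : ‖realPlace.char x‖ = 1 := by
  have : realPlace.char x = Complex.exp (((-(2 * Real.pi * x) : ℝ) : ℂ) * Complex.I) := by
    simp only [realPlace]; congr 1; push_cast; ring
  rw [this, Complex.norm_exp_ofReal_mul_I]

theorem measurable_realPlace_char : Measurable realPlace.char := by
  unfold realPlace; fun_prop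

theorem realPlace_gaussian_integrand (c x y : ℝ) :
    (Real.exp (-(c * (Real.pi * y ^ 2))) : ℂ) * realPlace.char (-(x * y)) =
      Complex.exp (((-(c * Real.pi) : ℝ) : ℂ) * (y : ℂ) ^ 2 + 2 * Real.pi * Complex.I * x * y + 0) := by
  simp only [realPlace, Complex.ofReal_exp]
  rw [← Complex.exp_add]; congr 1; push_cast; ring

theorem realPlace_fourier_gaussian {c : ℝ} (hc : 0 < c) (x : ℝ) :
    ∫ y : ℝ, (Real.exp (-(c * (Real.pi * y ^ 2))) : ℂ) * realPlace.char (-(x * y)) =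
      (c ^ (-(1 / 2) : ℝ) : ℝ) * (Real.exp (-(Real.pi * x ^ 2 / c)) : ℂ) := by
  simp_rw [realPlace_gaussian_integrand]
  have hπ := Real.pi_pos
  rw [integral_cexp_quadratic (by rw [Complex.ofReal_re]; simp; positivity)]
  have hc' : (c : ℂ) ≠ 0 := by exact_mod_cast hc.ne'
  have hπ' : (Real.pi : ℂ) ≠ 0 := by exact_mod_cast hπ.ne'
  congr 1
  · have : (Real.pi : ℂ) / -((-(c * Real.pi) : ℝ) : ℂ) = ((c⁻¹ : ℝ) : ℂ) := by
      push_cast; field_simp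
    rw [this, Real.rpow_neg hc.le, ← Real.inv_rpow hc.le, Complex.ofReal_cpow (by positivity)]
    norm_num
  · rw [Complex.ofReal_exp]
    congr 1
    push_cast
    field_simp
    rw [Complex.I_sq]
    ring

theorem hasDerivAt_realPlace_gaussian (c x y : ℝ) :
    HasDerivAt (fun y : ℝ => (Real.exp (-(c * (Real.pi * y ^ 2))) : ℂ) * realPlace.char (-(x * y)))
      ((-(2 * c * Real.pi * y) + 2 * Real.pi * Complex.I * x) *
        ((Real.exp (-(c * (Real.pi * y ^ 2))) : ℂ) * realPlace.char (-(x * y)))) y := by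
  simp_rw [realPlace_gaussian_integrand]
  have h : HasDerivAt (fun y : ℂ => ((-(c * Real.pi) : ℝ) : ℂ) * y ^ 2 +
      2 * Real.pi * Complex.I * x * y + 0)
      (((-(c * Real.pi) : ℝ) : ℂ) * (2 * y) + 2 * Real.pi * Complex.I * x) (y : ℂ) := by
    have h1 := ((hasDerivAt_pow 2 (y : ℂ)).const_mul ((-(c * Real.pi) : ℝ) : ℂ)).add
      ((hasDerivAt_id (y : ℂ)).const_mul (2 * Real.pi * Complex.I * x : ℂ))
    simp only [add_zero]
    convert! h1 using 1
    simp
  convert! h.cexp.comp_ofReal using 1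
  push_cast; ring

theorem isGaussianFamily_realPlace_even :
    IsGaussianFamily realPlace (fun y : ℝ => y ^ 2) (fun _ => 1) (fun _ => 1) 0 (1 / 2) Real.pi 1 where
  n_nonneg := le_rfl
  r_pos := by norm_num
  κ_pos := Real.pi_pos
  ι_ne := one_ne_zero
  meas_Q := by fun_prop
  Q_nonneg y := sq_nonneg y
  Q_pos := by
    filter_upwards [(measure_singleton (μ := volume) (0 : ℝ) : _)  |> compl_mem_ae_iff.2] with y hy
    exact sq_pos_of_ne_zero hy
  abs_eq y := by
    rw [← Real.sqrt_eq_rpow, Real.sqrt_sq_eq_abs]; rfl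
  meas_char := measurable_realPlace_char
  norm_char := norm_realPlace_char
  meas_p := measurable_const
  meas_p' := measurable_const
  norm_p y := by simp
  norm_p' y := by simp
  integrable a ha c hc := integrable_abs_rpow_mul_exp_neg_mul_sq ha hc
  fourier c hc x := by
    simp only [one_mul, zero_add]
    exact realPlace_fourier_gaussian hc x

/-- The derivative of Gaussian times character integrates to `0`, which expresses the first moment
as `i x / c` times the even Gaussian transform. This is the source of `ι = i` and of the extra power
of `c`. -/
theorem isGaussianFamily_realPlace_odd :
    IsGaussianFamily realPlace (fun y : ℝ => y ^ 2) (fun y => (y : ℂ)) (fun y => (y : ℂ)) 1 (1 / 2)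
      Real.pi Complex.I := by
  refine { isGaussianFamily_realPlace_even with
    n_nonneg := one_pos.le
    ι_ne := Complex.I_ne_zero
    meas_p := Complex.measurable_ofReal
    meas_p' := Complex.measurable_ofReal
    norm_p := fun y => ?_
    norm_p' := fun y => ?_
    fourier := fun c hc x => ?_ }
  · rw [← Real.sqrt_eq_rpow, Real.sqrt_sq_eq_abs, Complex.norm_real, Real.norm_eq_abs]
  · rw [← Real.sqrt_eq_rpow, Real.sqrt_sq_eq_abs, Complex.norm_real, Real.norm_eq_abs]
  · have hπ := Real.pi_pos
    set E : ℝ → ℂ := fun y => (Real.exp (-(c * (Real.pi * y ^ 2))) : ℂ) * realPlace.char (-(x * y))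
      with hE
    have hm : Measurable E := by
      have := measurable_realPlace_char
      fun_prop
    have hn : ∀ y, ‖E y‖ = Real.exp (-(c * Real.pi * y ^ 2)) := fun y => by
      simp only [hE, norm_mul, norm_realPlace_char, Complex.norm_real, Real.norm_eq_abs, Real.abs_exp]
      ring_nf
    have i0 : Integrable E := by
      refine (integrable_abs_rpow_mul_exp_neg_mul_sq (a := 0) (by norm_num)
        (by positivity : 0 < c * Real.pi)).mono' hm.aestronglyMeasurable (ae_of_all _ fun y => ?_)
      rw [hn, Real.rpow_zero, one_mul]
    have i1 : Integrable (fun y : ℝ => (y : ℂ) * E y) := by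
      refine (integrable_abs_rpow_mul_exp_neg_mul_sq (a := 1 / 2) (by norm_num)
        (by positivity : 0 < c * Real.pi)).mono'
        (Complex.measurable_ofReal.mul hm).aestronglyMeasurable (ae_of_all _ fun y => ?_)
      rw [norm_mul, hn, ← Real.sqrt_eq_rpow, Real.sqrt_sq_eq_abs, Complex.norm_real,
        Real.norm_eq_abs]
    have e : ∀ y : ℝ, (-(2 * c * Real.pi * y) + 2 * Real.pi * Complex.I * x) * E y =
        -(2 * c * Real.pi) * (y * E y) + 2 * Real.pi * Complex.I * x * E y := fun y => by ring
    have h := integral_eq_zero_of_hasDerivAt_of_integrable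
      (hasDerivAt_realPlace_gaussian c x) (by
        refine Integrable.congr ((i1.const_mul (-(2 * c * Real.pi) : ℂ)).add
          (i0.const_mul (2 * Real.pi * Complex.I * x : ℂ))) (ae_of_all _ fun y => (e y).symm)) i0
    have h' : ∫ y : ℝ, (-(2 * c * Real.pi : ℂ) * (y * E y) + 2 * Real.pi * Complex.I * x * E y) = 0 := by
      rw [← h]; exact integral_congr_ae (ae_of_all _ fun y => (e y).symm)
    rw [integral_add (i1.const_mul _) (i0.const_mul _), integral_const_mul, integral_const_mul,
      realPlace_fourier_gaussian hc] at h'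
    have hg : fourierIntegralAt realPlace (fun y : ℝ => (y : ℂ) *
        (Real.exp (-(c * (Real.pi * y ^ 2))) : ℂ)) x = ∫ y : ℝ, (y : ℂ) * E y :=
      integral_congr_ae (ae_of_all _ fun y => by simp only [hE]; ring)
    rw [hg]
    have hc' : (c : ℂ) ≠ 0 := by exact_mod_cast hc.ne'
    have hπ' : (Real.pi : ℂ) ≠ 0 := by exact_mod_cast hπ.ne'
    have hcr : c ^ (-(1 + 1 / 2) : ℝ) = c ^ (-(1 / 2) : ℝ) * c⁻¹ := by
      rw [← Real.rpow_neg_one c, ← Real.rpow_add hc]; norm_num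
    rw [hcr]
    generalize (Real.exp (-(Real.pi * x ^ 2 / c)) : ℂ) = G at h' ⊢
    push_cast at h' ⊢
    field_simp
    apply mul_left_cancel₀ (mul_ne_zero two_ne_zero hπ')
    linear_combination -h'

theorem isSpectralFunction_hPlus : IsSpectralFunction realPlace chiPlus hPlus := by
  have : SFinite realPlace.haar := inferInstanceAs (SFinite (volume : Measure ℝ))
  intro f g hfg hf hg s hs
  rw [hPlus_eq hs]
  refine isGaussianFamily_realPlace_even.isSpectralFunction (fun y hy s => ?_) f g hfg hf hg s hs
  have hy' : 0 < |y| := abs_pos.2 (by rintro rfl; simp at hy)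
  have e : realPlace.abs y = |y| := rfl
  rw [e, ← sq_abs, ofReal_sq_cpow hy', chiPlus]
  congr 2
  · simp
  · push_cast; ring

theorem isSpectralFunction_hMinus : IsSpectralFunction realPlace chiMinus hMinus := by
  have : SFinite realPlace.haar := inferInstanceAs (SFinite (volume : Measure ℝ))
  intro f g hfg hf hg s hs
  rw [hMinus_eq hs]
  refine isGaussianFamily_realPlace_odd.isSpectralFunction (fun y hy s => ?_) f g hfg hf hg s hs
  have hy0 : y ≠ 0 := by rintro rfl; simp at hy
  have hy' : 0 < |y| := abs_pos.2 hy0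
  have hy'' : ((|y| : ℝ) : ℂ) ≠ 0 := by exact_mod_cast hy'.ne'
  have e : realPlace.abs y = |y| := rfl
  rw [e, ← sq_abs, ofReal_sq_cpow hy', chiMinus]
  have e2 : (2 * -(((1 / 2 : ℝ) : ℂ) + ((1 / 2 : ℝ) : ℂ) * s)) = -1 + -s := by push_cast; ring
  rw [e2, Complex.cpow_add _ _ hy'', Complex.cpow_neg_one, ← mul_assoc]
  congr 1
  rcases lt_or_gt_of_ne hy0 with h | h
  · rw [sign_neg h, abs_of_neg h]
    have : (y : ℂ) ≠ 0 := by exact_mod_cast hy0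
    push_cast; field_simp; simp
  · rw [sign_pos h, abs_of_pos h]
    have : (y : ℂ) ≠ 0 := by exact_mod_cast hy0
    field_simp; simp

/-! ### Gaussians at the complex place -/

theorem integrable_normSq_rpow_mul_exp_neg_mul {a c : ℝ} (ha : -1 < a) (hc : 0 < c) :
    Integrable (fun z : ℂ => Complex.normSq z ^ a * Real.exp (-(c * Complex.normSq z))) := by
  have h := Complex.integral_rpow_mul_exp_neg_mul_rpow (p := 2) (q := 2 * a) (b := c)
    (by norm_num) (by linarith) hc
  have hΓ : 0 < Real.Gamma ((2 * a + 2) / 2) := Real.Gamma_pos_of_pos (by linarith)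
  have hπ := Real.pi_pos
  refine (Integrable.of_integral_ne_zero (f := fun z : ℂ => ‖z‖ ^ (2 * a) *
    Real.exp (-c * ‖z‖ ^ (2 : ℝ))) (by rw [h]; positivity)).congr (ae_of_all _ fun z => ?_)
  dsimp only
  rw [Real.rpow_mul (norm_nonneg z), Real.rpow_two, ← Complex.normSq_eq_norm_sq, neg_mul]

theorem norm_complexPlace_char (x : ℂ) : ‖complexPlace.char x‖ = 1 := by
  have : complexPlace.char x =
      Complex.exp (((-(2 * Real.pi * (2 * x.re)) : ℝ) : ℂ) * Complex.I) := by
    simp only [complexPlace]; congr 1; push_cast; ring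
  rw [this, Complex.norm_exp_ofReal_mul_I]

theorem measurable_complexPlace_char : Measurable complexPlace.char := by
  unfold complexPlace
  dsimp only
  exact Complex.measurable_exp.comp ((((Complex.measurable_ofReal.comp
    (Complex.measurable_re.const_mul 2)).const_mul _)).neg)

/-- The Gaussian times a character, as the exponential of a quadratic polynomial in `z, z̄`. -/
noncomputable def complexGaussian (c : ℝ) (ζ z : ℂ) : ℂ :=
  Complex.exp (-(2 * Real.pi * c) * (z * (starRingEnd ℂ) z) +
    2 * Real.pi * Complex.I * (ζ * z + (starRingEnd ℂ) ζ * (starRingEnd ℂ) z))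

theorem complexGaussian_eq (c : ℝ) (ζ z : ℂ) : complexGaussian c ζ z =
    (Real.exp (-(c * (2 * Real.pi * Complex.normSq z))) : ℂ) * complexPlace.char (-(ζ * z)) := by
  have h : (((ζ * z).re : ℝ) : ℂ) = (ζ * z + (starRingEnd ℂ) ζ * (starRingEnd ℂ) z) / 2 := by
    rw [← map_mul, Complex.re_eq_add_conj]
  simp only [complexGaussian, complexPlace, Complex.ofReal_exp]
  rw [← Complex.exp_add, Complex.mul_conj]
  congr 1
  simp only [Complex.neg_re, Complex.ofReal_mul, Complex.ofReal_neg, h]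
  push_cast
  ring

theorem norm_complexGaussian (c : ℝ) (ζ z : ℂ) :
    ‖complexGaussian c ζ z‖ = Real.exp (-(c * (2 * Real.pi) * Complex.normSq z)) := by
  rw [complexGaussian_eq, norm_mul, norm_complexPlace_char, Complex.norm_real, Real.norm_eq_abs,
    Real.abs_exp, mul_one]
  ring_nf

theorem hasLineDerivAt_complexGaussian (c : ℝ) (ζ z v : ℂ) :
    HasLineDerivAt ℝ (complexGaussian c ζ) (complexGaussian c ζ z *
      (-(2 * Real.pi * c) * (v * (starRingEnd ℂ) z + z * (starRingEnd ℂ) v) +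
        2 * Real.pi * Complex.I * (ζ * v + (starRingEnd ℂ) ζ * (starRingEnd ℂ) v))) z v := by
  have h1 : HasDerivAt (fun t : ℝ => z + t • v) v 0 := by
    simpa using ((hasDerivAt_id (0 : ℝ)).smul_const v).const_add z
  have h2 : HasDerivAt (fun t : ℝ => (starRingEnd ℂ) (z + t • v)) ((starRingEnd ℂ) v) 0 :=
    (Complex.conjCLE.toContinuousLinearMap.hasFDerivAt.comp_hasDerivAt (0 : ℝ) h1)
  have h3 := (((h1.mul h2).const_mul (-(2 * Real.pi * c) : ℂ)).add
    (((h1.const_mul ζ).add (h2.const_mul ((starRingEnd ℂ) ζ))).const_mul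
      (2 * Real.pi * Complex.I : ℂ))).cexp
  unfold HasLineDerivAt
  convert! h3 using 1
  simp [complexGaussian]

theorem integrable_pow_mul_complexGaussian {c : ℝ} (hc : 0 < c) (ζ : ℂ) (n : ℕ) {φ : ℂ → ℂ}
    (hφ : Continuous φ) (h : ∀ z, ‖φ z‖ = ‖z‖ ^ n) :
    Integrable (fun z : ℂ => φ z * complexGaussian c ζ z) := by
  have hπ := Real.pi_pos
  have hcont : Continuous (complexGaussian c ζ) := by
    unfold complexGaussian; fun_prop
  refine (integrable_normSq_rpow_mul_exp_neg_mul (a := n / 2) (c := c * (2 * Real.pi))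
    (by linarith [(Nat.cast_nonneg n : (0 : ℝ) ≤ n)]) (by positivity)).mono'
    (hφ.mul hcont).aestronglyMeasurable (ae_of_all _ fun z => ?_)
  rw [norm_mul, norm_complexGaussian, h, Complex.normSq_eq_norm_sq, ← Real.rpow_natCast,
    ← Real.rpow_natCast, ← Real.rpow_mul (norm_nonneg _)]
  refine le_of_eq ?_
  congr 2
  push_cast; ring

/-- Induction on `n`, integrating by parts in the directions `1` and `i`. The combination `∂₁ + i
∂ᵢ` is twice `∂/∂z̄`: it annihilates `z^n` and multiplies the Gaussian by a polynomial of degree one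
in `z` alone, so each step contributes the factor `i ζ̄ / c`. -/
theorem integral_pow_mul_complexGaussian {c : ℝ} (hc : 0 < c) (ζ : ℂ) (n : ℕ) :
    ∫ z : ℂ, z ^ n * complexGaussian c ζ z =
      (Complex.I * (starRingEnd ℂ) ζ / c) ^ n *
        (1 / (2 * c) * (Real.exp (-(2 * Real.pi * Complex.normSq ζ / c)) : ℂ)) := by
  have hπ := Real.pi_pos
  have hc' : (c : ℂ) ≠ 0 := by exact_mod_cast hc.ne'
  have hπ' : (Real.pi : ℂ) ≠ 0 := by exact_mod_cast hπ.ne'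
  have hint := fun n : ℕ => integrable_pow_mul_complexGaussian hc ζ n (φ := fun z => z ^ n)
    (by fun_prop) (fun z => norm_pow z n)
  induction n with
  | zero =>
    have h := GaussianFourier.integral_cexp_neg_mul_sq_norm_add (V := ℂ)
      (b := ((2 * Real.pi * c : ℝ) : ℂ)) (by rw [Complex.ofReal_re]; positivity)
      (4 * Real.pi * Complex.I) ((starRingEnd ℂ) ζ)
    simp only [pow_zero, one_mul]
    rw [Complex.finrank_real_complex] at h
    convert! h using 1
    · refine integral_congr_ae (ae_of_all _ fun z => ?_)
      simp only [complexGaussian]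
      rw [Complex.inner, Complex.conj_conj, Complex.mul_conj, Complex.normSq_eq_norm_sq,
        Complex.re_eq_add_conj, map_mul]
      congr 1
      push_cast; ring
    · norm_num
      rw [Complex.normSq_eq_norm_sq, Complex.ofReal_pow]
      congr 1
      · field_simp
      · congr 1
        field_simp
        rw [Complex.I_sq]
        ring
  | succ n ih =>
    have hderiv : ∀ v z : ℂ, HasLineDerivAt ℝ (fun z : ℂ => z ^ n) (n * z ^ (n - 1) * v) z v := by
      intro v z
      have h1 : HasDerivAt (fun t : ℝ => z + t • v) v 0 := by
        simpa using ((hasDerivAt_id (0 : ℝ)).smul_const v).const_add z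
      have h2 := h1.pow n
      unfold HasLineDerivAt
      convert! h2 using 1
      simp
    have hi1 : ∀ v : ℂ, Integrable (fun z : ℂ => (n * z ^ (n - 1) * v) * complexGaussian c ζ z) := by
      intro v
      refine ((hint (n - 1)).const_mul (n * v)).congr (ae_of_all _ fun z => ?_)
      ring
    have hibar : Integrable (fun z : ℂ => (z ^ n * (starRingEnd ℂ) z) * complexGaussian c ζ z) :=
      integrable_pow_mul_complexGaussian hc ζ (n + 1) (by fun_prop) fun z => by
        rw [norm_mul, norm_pow, RCLike.norm_conj, pow_succ]
    have e : ∀ v z : ℂ, z ^ n * (complexGaussian c ζ z *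
      (-(2 * Real.pi * c) * (v * (starRingEnd ℂ) z + z * (starRingEnd ℂ) v) +
        2 * Real.pi * Complex.I * (ζ * v + (starRingEnd ℂ) ζ * (starRingEnd ℂ) v))) =
        (-(2 * Real.pi * c) * v) * ((z ^ n * (starRingEnd ℂ) z) * complexGaussian c ζ z) +
        (-(2 * Real.pi * c) * (starRingEnd ℂ) v) * (z ^ (n + 1) * complexGaussian c ζ z) +
        (2 * Real.pi * Complex.I * (ζ * v + (starRingEnd ℂ) ζ * (starRingEnd ℂ) v)) *
          (z ^ n * complexGaussian c ζ z) := fun v z => by ring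
    have hi2 : ∀ v : ℂ, Integrable (fun z : ℂ => z ^ n * (complexGaussian c ζ z *
      (-(2 * Real.pi * c) * (v * (starRingEnd ℂ) z + z * (starRingEnd ℂ) v) +
        2 * Real.pi * Complex.I * (ζ * v + (starRingEnd ℂ) ζ * (starRingEnd ℂ) v)))) := by
      intro v
      simp_rw [e]
      exact ((hibar.const_mul _).add ((hint (n + 1)).const_mul _)).add ((hint n).const_mul _)
    have hparts : ∀ v : ℂ,
        (-(2 * Real.pi * c) * v) * (∫ z : ℂ, (z ^ n * (starRingEnd ℂ) z) * complexGaussian c ζ z) +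
        (-(2 * Real.pi * c) * (starRingEnd ℂ) v) * (∫ z : ℂ, z ^ (n + 1) * complexGaussian c ζ z) +
        (2 * Real.pi * Complex.I * (ζ * v + (starRingEnd ℂ) ζ * (starRingEnd ℂ) v)) *
          (∫ z : ℂ, z ^ n * complexGaussian c ζ z) =
        -(n * v * ∫ z : ℂ, z ^ (n - 1) * complexGaussian c ζ z) := by
      intro v
      have h := integral_bilinear_hasLineDerivAt_right_eq_neg_left_of_integrable (μ := volume)
        (B := ContinuousLinearMap.mul ℝ ℂ) (hi1 v) (hi2 v) (hint n)
        (fun z _ => hderiv v z) (fun z _ => hasLineDerivAt_complexGaussian c ζ z v)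
      simp only [ContinuousLinearMap.mul_apply', e] at h
      have e2 : ∀ z : ℂ, (n * z ^ (n - 1) * v) * complexGaussian c ζ z =
        n * v * (z ^ (n - 1) * complexGaussian c ζ z) := fun z => by ring
      simp_rw [e2] at h
      have s1 := integral_add ((hibar.const_mul (-(2 * Real.pi * c) * v)).add
        ((hint (n + 1)).const_mul (-(2 * Real.pi * c) * (starRingEnd ℂ) v))) ((hint n).const_mul
        (2 * Real.pi * Complex.I * (ζ * v + (starRingEnd ℂ) ζ * (starRingEnd ℂ) v)))
      have s2 := integral_add (hibar.const_mul (-(2 * Real.pi * c) * v))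
        ((hint (n + 1)).const_mul (-(2 * Real.pi * c) * (starRingEnd ℂ) v))
      simp only [Pi.add_apply] at s1
      rw [s1, s2] at h
      simpa only [integral_const_mul] using h
    have h1 := hparts 1
    have hI := hparts Complex.I
    rw [Complex.conj_I] at hI
    rw [map_one] at h1
    rw [pow_succ, mul_right_comm, ← ih]
    rw [mul_div_assoc', eq_div_iff hc']
    apply mul_left_cancel₀ (mul_ne_zero (by norm_num : (4 : ℂ) ≠ 0) hπ')
    have hI2 := Complex.I_sq
    linear_combination -h1 - Complex.I * hI + (-(2 * Real.pi * c) *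
      (∫ z : ℂ, (z ^ n * (starRingEnd ℂ) z) * complexGaussian c ζ z) +
      2 * Real.pi * c * (∫ z : ℂ, z ^ (n + 1) * complexGaussian c ζ z) +
      2 * Real.pi * Complex.I * (ζ - (starRingEnd ℂ) ζ) *
        (∫ z : ℂ, z ^ n * complexGaussian c ζ z) +
      n * (∫ z : ℂ, z ^ (n - 1) * complexGaussian c ζ z)) * hI2

theorem complexPlace_fourier_pow {c : ℝ} (hc : 0 < c) (n : ℕ) (ζ : ℂ) :
    fourierIntegralAt complexPlace
      (fun z => z ^ n * (Real.exp (-(c * (2 * Real.pi * Complex.normSq z))) : ℂ)) ζ =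
      Complex.I ^ n * (c ^ (-((n : ℝ) + 1)) : ℝ) *
        ((starRingEnd ℂ) ζ ^ n * (Real.exp (-(2 * Real.pi * Complex.normSq ζ / c)) : ℂ)) := by
  have hc' : (c : ℂ) ≠ 0 := by exact_mod_cast hc.ne'
  have h := integral_pow_mul_complexGaussian hc ζ n
  have e : c ^ (-((n : ℝ) + 1)) = (c ^ (n + 1))⁻¹ := by
    rw [Real.rpow_neg hc.le]; norm_cast
  have hm : complexPlace.haar = (2 : ENNReal) • volume := rfl
  rw [fourierIntegralAt, hm, integral_smul_measure]
  have e1 : ∀ z : ℂ, z ^ n * (Real.exp (-(c * (2 * Real.pi * Complex.normSq z))) : ℂ) *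
      complexPlace.char (-(ζ * z)) = z ^ n * complexGaussian c ζ z := fun z => by
    rw [complexGaussian_eq, mul_assoc]
  simp_rw [e1]
  rw [h, e]
  push_cast
  simp only [ENNReal.toReal_ofNat, Complex.real_smul]
  push_cast
  rw [div_pow, mul_pow]
  field_simp
  ring

theorem complexPlace_fourier_conj_pow {c : ℝ} (hc : 0 < c) (n : ℕ) (ζ : ℂ) :
    fourierIntegralAt complexPlace
      (fun z => (starRingEnd ℂ) z ^ n * (Real.exp (-(c * (2 * Real.pi * Complex.normSq z))) : ℂ)) ζ =
      Complex.I ^ n * (c ^ (-((n : ℝ) + 1)) : ℝ) *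
        (ζ ^ n * (Real.exp (-(2 * Real.pi * Complex.normSq ζ / c)) : ℂ)) := by
  have h := congrArg (starRingEnd ℂ) (complexPlace_fourier_pow hc n (-ζ))
  have hchar : ∀ x : ℂ, (starRingEnd ℂ) (complexPlace.char x) = complexPlace.char (-x) := by
    intro x
    simp only [complexPlace]
    rw [← Complex.exp_conj]
    congr 1
    have h2 : (starRingEnd ℂ) 2 = 2 := map_ofNat _ 2
    simp [h2]
  rw [fourierIntegralAt, ← integral_conj] at h
  rw [fourierIntegralAt]
  have e : ∀ y : ℂ, (starRingEnd ℂ) (y ^ n *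
      (Real.exp (-(c * (2 * Real.pi * Complex.normSq y))) : ℂ) * complexPlace.char (-(-ζ * y))) =
      (starRingEnd ℂ) y ^ n * (Real.exp (-(c * (2 * Real.pi * Complex.normSq y))) : ℂ) *
        complexPlace.char (-(ζ * y)) := by
    intro y
    rw [map_mul, map_mul, map_pow, Complex.conj_ofReal, hchar]
    congr 2; ring
  simp_rw [e] at h
  rw [h]
  simp only [map_mul, map_pow, Complex.conj_I, Complex.conj_ofReal, Complex.conj_conj,
    Complex.normSq_neg]
  rw [neg_pow Complex.I, neg_pow ζ]
  have : ((-1 : ℂ) ^ n) * (-1) ^ n = 1 := by rw [← mul_pow]; norm_num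
  linear_combination (Complex.I ^ n * (c ^ (-((n : ℝ) + 1)) : ℝ) *
        (ζ ^ n * (Real.exp (-(2 * Real.pi * Complex.normSq ζ / c)) : ℂ))) * this

theorem isGaussianFamily_complexPlace {p p' : ℂ → ℂ} (n : ℕ) (hp : Measurable p)
    (hp' : Measurable p') (hpn : ∀ z, ‖p z‖ = ‖z‖ ^ n) (hpn' : ∀ z, ‖p' z‖ = ‖z‖ ^ n)
    (hF : ∀ c : ℝ, 0 < c → ∀ ζ, fourierIntegralAt complexPlace
      (fun z => p' z * (Real.exp (-(c * (2 * Real.pi * Complex.normSq z))) : ℂ)) ζ =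
      Complex.I ^ n * (c ^ (-((n : ℝ) + 1)) : ℝ) *
        (p ζ * (Real.exp (-(2 * Real.pi * Complex.normSq ζ / c)) : ℂ))) :
    IsGaussianFamily complexPlace Complex.normSq p p' n 1 (2 * Real.pi) (Complex.I ^ n) where
  n_nonneg := Nat.cast_nonneg n
  r_pos := one_pos
  κ_pos := Real.two_pi_pos
  ι_ne := pow_ne_zero _ Complex.I_ne_zero
  meas_Q := Complex.continuous_normSq.measurable
  Q_nonneg := Complex.normSq_nonneg
  Q_pos := by
    have : ∀ᵐ z : ℂ, 0 < Complex.normSq z := by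
      filter_upwards [compl_mem_ae_iff.2 (measure_singleton (μ := volume) (0 : ℂ))] with z hz
      exact Complex.normSq_pos.2 hz
    exact Measure.ae_smul_measure this 2
  abs_eq y := by rw [Real.rpow_one]; rfl
  meas_char := measurable_complexPlace_char
  norm_char := norm_complexPlace_char
  meas_p := hp
  meas_p' := hp'
  norm_p z := by
    rw [hpn, Complex.normSq_eq_norm_sq, ← Real.rpow_natCast, ← Real.rpow_natCast,
      ← Real.rpow_mul (norm_nonneg _)]
    congr 1; push_cast; ring
  norm_p' z := by
    rw [hpn', Complex.normSq_eq_norm_sq, ← Real.rpow_natCast, ← Real.rpow_natCast,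
      ← Real.rpow_mul (norm_nonneg _)]
    congr 1; push_cast; ring
  integrable a ha c hc :=
    (integrable_normSq_rpow_mul_exp_neg_mul ha hc).smul_measure ENNReal.ofNat_ne_top
  fourier := hF

/-- For `N ≥ 0` the inverse of `χ_N` is `z̄^N (z z̄)^{-N/2}`, so the output polynomial must be
`z̄^N`. The Fourier transform exchanges `z^N` and `z̄^N`, so the input is `z^N`. For `N ≤ 0` the
roles are reversed. -/
theorem isSpectralFunction_hComplex (N : ℤ) :
    IsSpectralFunction complexPlace (chiComplex N) (hComplex N) := by
  have : SFinite complexPlace.haar := inferInstanceAs (SFinite ((2 : ENNReal) • (volume : Measure ℂ)))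
  have hconj : Measurable (starRingEnd ℂ) := Complex.continuous_conj.measurable
  intro f g hfg hf hg s hs
  rw [hComplex_eq N hs]
  have hcpow : ∀ y : ℂ, 0 < Complex.normSq y → ∀ s : ℂ,
      (Complex.normSq y : ℂ) ^ (-(((N.natAbs : ℝ) / 2 : ℝ) + ((1 : ℝ) : ℂ) * s)) =
      ((Complex.normSq y : ℂ) ^ ((N.natAbs : ℂ) / 2))⁻¹ * (complexPlace.abs y : ℂ) ^ (-s) := by
    intro y hy s
    have hq : (Complex.normSq y : ℂ) ≠ 0 := by exact_mod_cast hy.ne'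
    have e : complexPlace.abs y = Complex.normSq y := rfl
    rw [e, ← Complex.cpow_neg, ← Complex.cpow_add _ _ hq]
    congr 1; push_cast; ring
  have hhalf : ∀ y : ℂ, 0 < Complex.normSq y → (Complex.normSq y : ℂ) ^ ((N.natAbs : ℂ) / 2) *
      (Complex.normSq y : ℂ) ^ ((N.natAbs : ℂ) / 2) = y ^ N.natAbs * (starRingEnd ℂ) y ^ N.natAbs := by
    intro y hy
    have hq : (Complex.normSq y : ℂ) ≠ 0 := by exact_mod_cast hy.ne'
    rw [← Complex.cpow_add _ _ hq, add_halves, Complex.cpow_natCast, ← Complex.mul_conj, mul_pow]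
  have hne : ∀ y : ℂ, 0 < Complex.normSq y →
      (Complex.normSq y : ℂ) ^ ((N.natAbs : ℂ) / 2) ≠ 0 := by
    intro y hy
    have hq : (Complex.normSq y : ℂ) ≠ 0 := by exact_mod_cast hy.ne'
    simp [Complex.cpow_eq_zero_iff, hq]
  rcases le_total 0 N with hN | hN
  · refine (isGaussianFamily_complexPlace (p := fun z => (starRingEnd ℂ) z ^ N.natAbs)
      (p' := fun z => z ^ N.natAbs) N.natAbs (hconj.pow_const _) (by fun_prop) (fun z => by simp)
      (fun z => by simp) fun c hc ζ => complexPlace_fourier_pow hc _ ζ).isSpectralFunction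
      (fun y hy s => ?_) f g hfg hf hg s hs
    have hy0 : y ≠ 0 := Complex.normSq_pos.1 hy
    have hN' : (N : ℂ) = (N.natAbs : ℂ) := by
      rw [← Int.cast_natCast, Int.natAbs_of_nonneg hN]
    have hz : y ^ N = y ^ N.natAbs := by
      conv_lhs => rw [← Int.natAbs_of_nonneg hN]
      exact zpow_natCast _ _
    rw [hcpow y hy, chiComplex, ← mul_assoc, hz, hN', neg_div, Complex.cpow_neg _ ((N.natAbs : ℂ) / 2),
      mul_inv, inv_inv]
    congr 1
    have h1 := hhalf y hy
    have h2 := hne y hy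
    have h3 : y ^ N.natAbs ≠ 0 := pow_ne_zero _ hy0
    field_simp
    linear_combination -h1
  · refine (isGaussianFamily_complexPlace (p := fun z => z ^ N.natAbs)
      (p' := fun z => (starRingEnd ℂ) z ^ N.natAbs) N.natAbs (by fun_prop) (hconj.pow_const _)
      (fun z => by simp) (fun z => by simp)
      fun c hc ζ => complexPlace_fourier_conj_pow hc _ ζ).isSpectralFunction
      (fun y hy s => ?_) f g hfg hf hg s hs
    have hy0 : y ≠ 0 := Complex.normSq_pos.1 hy
    have hNN : N = -(N.natAbs : ℤ) := by omega
    have hN' : (N : ℂ) = -(N.natAbs : ℂ) := by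
      rw [← Int.cast_natCast, ← Int.cast_neg, ← hNN]
    have hz : y ^ N = (y ^ N.natAbs)⁻¹ := by
      conv_lhs => rw [hNN]
      rw [zpow_neg, zpow_natCast]
    rw [hcpow y hy, chiComplex, ← mul_assoc, hz, hN', neg_neg, mul_inv, inv_inv]


/-! ### Plancherel's theorem, positive kernels and Schur's test -/

section Plancherel

variable {K : Type*} [Field K] [MeasurableSpace K] {P : LocalPlace K}

/-- The character of the place is a measurable unitary character of the additive group. -/
structure IsUnitaryCharacter (P : LocalPlace K) : Prop where
  meas : Measurable P.char
  norm_eq : ∀ x, ‖P.char x‖ = 1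
  map_add : ∀ x y, P.char (x + y) = P.char x * P.char y

theorem IsUnitaryCharacter.map_zero (hP : IsUnitaryCharacter P) : P.char 0 = 1 := by
  have h := hP.map_add 0 0
  have h1 : P.char 0 ≠ 0 := fun h => by simpa [h] using hP.norm_eq 0
  rw [add_zero] at h
  exact (mul_eq_left₀ h1).1 h.symm

theorem IsUnitaryCharacter.conj (hP : IsUnitaryCharacter P) (x : K) :
    (starRingEnd ℂ) (P.char x) = P.char (-x) := by
  have h2 : P.char x * P.char (-x) = 1 := by rw [← hP.map_add, add_neg_cancel, hP.map_zero]
  rw [← mul_right_inj' (a := P.char x) (fun h => by simpa [h] using hP.norm_eq x), h2,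
    Complex.mul_conj, Complex.normSq_eq_norm_sq, hP.norm_eq]
  simp

theorem IsUnitaryCharacter.integrable_mul_char [MeasurableMul K] (hP : IsUnitaryCharacter P) {φ : K → ℂ}
    (hφ : Integrable φ P.haar) (x : K) : Integrable (fun y => φ y * P.char (x * y)) P.haar := by
  refine hφ.mul_bdd (c := 1) ?_ (ae_of_all _ fun y => (hP.norm_eq _).le)
  exact (hP.meas.comp (measurable_const_mul x)).aestronglyMeasurable

theorem IsUnitaryCharacter.memLp_mul_char [MeasurableMul K] (hP : IsUnitaryCharacter P) {φ : K → ℂ}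
    (hφ : MemLp φ 2 P.haar) (x : K) : MemLp (fun y => φ y * P.char (x * y)) 2 P.haar := by
  refine MemLp.of_le hφ (hφ.1.mul (hP.meas.comp (measurable_const_mul x)).aestronglyMeasurable)
    (ae_of_all _ fun y => ?_)
  rw [norm_mul, hP.norm_eq, mul_one]

/-- The duality formula for integrable functions. -/
theorem integral_fourierIntegralAt_mul [MeasurableMul₂ K] [MeasurableNeg K] [SFinite P.haar]
    (hP : IsUnitaryCharacter P) {φ g : K → ℂ}
    (hφ : Integrable φ P.haar) (hg : Integrable g P.haar) :
    ∫ x, fourierIntegralAt P φ x * g x ∂P.haar = ∫ y, φ y * fourierIntegralAt P g y ∂P.haar := by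
  have hi : Integrable (fun z : K × K => g z.1 * φ z.2 * P.char (-(z.1 * z.2)))
      (P.haar.prod P.haar) := by
    refine (hg.mul_prod hφ).mul_bdd (c := 1) ?_ (ae_of_all _ fun y => (hP.norm_eq _).le)
    exact (hP.meas.comp (by fun_prop)).aestronglyMeasurable
  have h := integral_integral_swap (f := fun x y : K => g x * φ y * P.char (-(x * y))) hi
  simp only [fourierIntegralAt, ← integral_mul_const, ← integral_const_mul]
  have e1 : ∀ x y : K, φ y * P.char (-(x * y)) * g x = g x * φ y * P.char (-(x * y)) :=
    fun x y => by ring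
  have e2 : ∀ x y : K, φ y * (g x * P.char (-(y * x))) = g x * φ y * P.char (-(x * y)) :=
    fun x y => by rw [mul_comm y x]; ring
  simp only [e1, e2]
  exact h

/-- A class of test functions, dense in `L²`, on which the Fourier inversion formula holds. -/
structure IsPlancherelClass (P : LocalPlace K) (S : Set (K → ℂ)) : Prop where
  integrable : ∀ g ∈ S, Integrable g P.haar
  memLp : ∀ g ∈ S, MemLp g 2 P.haar
  neg_mem : ∀ g ∈ S, (fun y => g (-y)) ∈ S
  integrable_fourier : ∀ g ∈ S, Integrable (fourierIntegralAt P g) P.haar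
  inversion : ∀ g ∈ S, ∀ y, fourierIntegralAt P (fourierIntegralAt P g) y = g (-y)
  dense : ∀ f : K → ℂ, MemLp f 2 P.haar → ∀ ε : ℝ, 0 < ε →
    ∃ g ∈ S, eLpNorm (f - g) 2 P.haar ≤ ENNReal.ofReal ε

theorem norm_fourierIntegralAt_le (hP : IsUnitaryCharacter P) (φ : K → ℂ) (x : K) :
    ‖fourierIntegralAt P φ x‖ ≤ ∫ y, ‖φ y‖ ∂P.haar := by
  refine (norm_integral_le_integral_norm _).trans (le_of_eq ?_)
  simp only [norm_mul, hP.norm_eq, mul_one]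

theorem conj_fourierIntegralAt (hP : IsUnitaryCharacter P) (φ : K → ℂ) (x : K) :
    (starRingEnd ℂ) (fourierIntegralAt P φ x) =
      fourierIntegralAt P (fun y => (starRingEnd ℂ) (φ y)) (-x) := by
  rw [fourierIntegralAt, ← integral_conj, fourierIntegralAt]
  simp only [map_mul, hP.conj, neg_mul]

theorem integral_norm_sq_eq {μ : Measure K} {u : K → ℂ} :
    ∫ y, u y * (starRingEnd ℂ) (u y) ∂μ = ((∫ y, ‖u y‖ ^ 2 ∂μ : ℝ) : ℂ) := by
  rw [← integral_complex_ofReal]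
  refine integral_congr_ae (ae_of_all _ fun y => ?_)
  simp [Complex.mul_conj, Complex.normSq_eq_norm_sq]

theorem norm_toLp_sq {μ : Measure K} {u : K → ℂ} (hu : MemLp u 2 μ) :
    ‖hu.toLp u‖ ^ 2 = ∫ y, ‖u y‖ ^ 2 ∂μ := by
  have h := @inner_self_eq_norm_sq_to_K ℂ _ _ _ _ (hu.toLp u)
  rw [L2.inner_def] at h
  have e : ∫ a, inner ℂ (hu.toLp u a) (hu.toLp u a) ∂μ = ∫ y, u y * (starRingEnd ℂ) (u y) ∂μ := by
    refine integral_congr_ae ?_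
    filter_upwards [hu.coeFn_toLp] with y hy
    rw [hy, RCLike.inner_apply]
  rw [e, integral_norm_sq_eq] at h
  apply Complex.ofReal_injective
  rw [h]
  simp

theorem norm_Lp_sq {μ : Measure K} (u : Lp ℂ 2 μ) : ‖u‖ ^ 2 = ∫ y, ‖u y‖ ^ 2 ∂μ := by
  conv_lhs => rw [← Lp.toLp_coeFn u (Lp.memLp u)]
  exact norm_toLp_sq _

theorem norm_integral_mul_le {μ : Measure K} (u : Lp ℂ 2 μ) {v : K → ℂ} (hv : MemLp v 2 μ) :
    ‖∫ y, u y * v y ∂μ‖ ≤ ‖u‖ * ‖hv.toLp v‖ := by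
  have h := norm_inner_le_norm (𝕜 := ℂ) (hv.star.toLp (star v)) u
  rw [L2.inner_def] at h
  have e : ∫ a, inner ℂ (hv.star.toLp (star v) a) (u a) ∂μ = ∫ y, u y * v y ∂μ := by
    refine integral_congr_ae ?_
    filter_upwards [hv.star.coeFn_toLp] with y hy
    rw [hy, RCLike.inner_apply]
    simp
  rw [e, mul_comm] at h
  refine h.trans (le_of_eq ?_)
  congr 1
  rw [Lp.norm_toLp, Lp.norm_toLp]
  congr 1
  exact eLpNorm_congr_norm_ae (ae_of_all _ fun y => by simp)

namespace IsPlancherelClass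

variable {S : Set (K → ℂ)}

/-- The duality formula is applied to `g` and the conjugate of its transform; by inversion the
transform of that conjugate is the conjugate of `g`. -/
theorem integral_norm_sq_fourier [MeasurableMul₂ K] [MeasurableNeg K] [SFinite P.haar]
    (hS : IsPlancherelClass P S) (hP : IsUnitaryCharacter P) {g : K → ℂ} (hg : g ∈ S) :
    ∫ y, ‖fourierIntegralAt P g y‖ ^ 2 ∂P.haar = ∫ y, ‖g y‖ ^ 2 ∂P.haar := by
  have h := integral_fourierIntegralAt_mul hP (hS.integrable g hg)
    (g := fun x => (starRingEnd ℂ) (fourierIntegralAt P g x))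
    ((Complex.conjLIE.integrable_comp_iff (φ := fourierIntegralAt P g)).2 (hS.integrable_fourier g hg))
  rw [integral_norm_sq_eq] at h
  have e : ∀ y, fourierIntegralAt P (fun x => (starRingEnd ℂ) (fourierIntegralAt P g x)) y =
      (starRingEnd ℂ) (g y) := by
    intro y
    have h1 := conj_fourierIntegralAt hP (fourierIntegralAt P g) (-y)
    rw [neg_neg, hS.inversion g hg, neg_neg] at h1
    exact h1.symm
  simp only [e] at h
  rw [integral_norm_sq_eq] at h
  exact_mod_cast h

theorem memLp_fourier (hS : IsPlancherelClass P S) (hP : IsUnitaryCharacter P) {g : K → ℂ}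
    (hg : g ∈ S) : MemLp (fourierIntegralAt P g) 2 P.haar := by
  have hi := hS.integrable_fourier g hg
  rw [memLp_two_iff_integrable_sq_norm hi.1]
  simp only [pow_two]
  refine hi.norm.mul_bdd (c := ∫ y, ‖g y‖ ∂P.haar) hi.1.norm (ae_of_all _ fun y => ?_)
  rw [norm_norm]
  exact norm_fourierIntegralAt_le hP g y

theorem norm_toLp_fourier [MeasurableMul₂ K] [MeasurableNeg K] [SFinite P.haar]
    (hS : IsPlancherelClass P S) (hP : IsUnitaryCharacter P) {g : K → ℂ} (hg : g ∈ S) :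
    ‖(hS.memLp_fourier hP hg).toLp _‖ = ‖(hS.memLp g hg).toLp g‖ := by
  rw [← sq_eq_sq₀ (norm_nonneg _) (norm_nonneg _), norm_toLp_sq, norm_toLp_sq,
    hS.integral_norm_sq_fourier hP hg]

/-- Approximating the conjugate of `u` by members of `S` gives `‖u‖² ≤ M ‖u‖` in the limit. `S` need
only be dense, not a linear subspace. -/
theorem norm_le_of_forall_mem (hS : IsPlancherelClass P S) {u : Lp ℂ 2 P.haar} {M : ℝ} (hM0 : 0 ≤ M)
    (hM : ∀ g (hg : g ∈ S), ‖∫ y, u y * g y ∂P.haar‖ ≤ M * ‖(hS.memLp g hg).toLp g‖) :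
    ‖u‖ ≤ M := by
  have hu := (Lp.memLp u).star
  have hus : ‖hu.toLp (star u)‖ = ‖u‖ := by
    rw [Lp.norm_toLp, Lp.norm_def]
    congr 1
    exact eLpNorm_congr_norm_ae (ae_of_all _ fun y => by simp)
  have key : ∀ ε : ℝ, 0 < ε → ‖u‖ ^ 2 ≤ M * ‖u‖ + (|M| + ‖u‖) * ε := by
    intro ε hε
    obtain ⟨g, hg, hgε⟩ := hS.dense _ hu ε hε
    have hgl := hS.memLp g hg
    have hd := hu.sub hgl
    have hdn : ‖hd.toLp (star (u : K → ℂ) - g)‖ ≤ ε := by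
      rw [Lp.norm_toLp]
      exact ENNReal.toReal_le_of_le_ofReal hε.le hgε
    have h1 : ∫ y, u y * (star (u : K → ℂ)) y ∂P.haar =
        (∫ y, u y * (star (u : K → ℂ) - g) y ∂P.haar) + ∫ y, u y * g y ∂P.haar := by
      have i1 : Integrable (fun y => u y * (star (u : K → ℂ) - g) y) P.haar :=
        (Lp.memLp u).integrable_mul hd
      have i2 : Integrable (fun y => u y * g y) P.haar := (Lp.memLp u).integrable_mul hgl
      rw [← integral_add i1 i2]
      refine integral_congr_ae (ae_of_all _ fun y => ?_)
      simp only [Pi.sub_apply]; ring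
    have h2 : ∫ y, u y * (star (u : K → ℂ)) y ∂P.haar = ((‖u‖ ^ 2 : ℝ) : ℂ) := by
      rw [norm_Lp_sq]
      exact integral_norm_sq_eq
    have h3 : ‖hgl.toLp g - hu.toLp (star u)‖ ≤ ε := by
      rw [norm_sub_rev, ← MemLp.toLp_sub hu hgl]
      exact hdn
    have h4 := abs_norm_sub_norm_le (hgl.toLp g) (hu.toLp (star u))
    rw [hus] at h4
    have h5 : M * ‖hgl.toLp g‖ ≤ M * ‖u‖ + |M| * ε := by
      have h6 : M * (‖hgl.toLp g‖ - ‖u‖) ≤ |M| * ε := by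
        refine (le_abs_self _).trans ?_
        rw [abs_mul]
        exact mul_le_mul_of_nonneg_left (h4.trans h3) (abs_nonneg _)
      linarith
    have h7 := norm_add_le (∫ y, u y * (star (u : K → ℂ) - g) y ∂P.haar) (∫ y, u y * g y ∂P.haar)
    rw [← h1, h2, Complex.norm_of_nonneg (by positivity)] at h7
    have h8 := norm_integral_mul_le u hd
    have h9 := mul_le_mul_of_nonneg_left hdn (norm_nonneg u)
    linarith [hM g hg]
  have h10 : ‖u‖ ^ 2 ≤ M * ‖u‖ := by
    refine le_of_forall_pos_le_add fun δ hδ => ?_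
    have hc : 0 < |M| + ‖u‖ + 1 := by positivity
    refine (key (δ / (|M| + ‖u‖ + 1)) (by positivity)).trans ?_
    have : (|M| + ‖u‖) * (δ / (|M| + ‖u‖ + 1)) ≤ δ := by
      rw [mul_div_assoc', div_le_iff₀ hc]
      nlinarith
    linarith
  rcases (norm_nonneg u).eq_or_lt with h | h
  · rwa [← h]
  · nlinarith

/-- Both inequalities come by testing on `S`: `ψ` against `g`, and `f` against `g` written as the
transform of a transform. The duality formula is demanded only for `g` with transform in `L²`,
because only then do pairings with linear combinations split, as `norm_add_smul` needs for
polarization. -/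
theorem norm_eq [MeasurableMul₂ K] [MeasurableNeg K] [SFinite P.haar] [P.haar.IsNegInvariant]
    (hS : IsPlancherelClass P S) (hP : IsUnitaryCharacter P) {f ψ : Lp ℂ 2 P.haar}
    (h : ∀ g : K → ℂ, Integrable g P.haar → MemLp g 2 P.haar →
      MemLp (fourierIntegralAt P g) 2 P.haar →
      ∫ x, ψ x * g x ∂P.haar = ∫ y, f y * fourierIntegralAt P g y ∂P.haar) : ‖ψ‖ = ‖f‖ := by
  refine le_antisymm (hS.norm_le_of_forall_mem (norm_nonneg _) fun g hg => ?_)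
    (hS.norm_le_of_forall_mem (norm_nonneg _) fun g hg => ?_)
  · rw [h g (hS.integrable g hg) (hS.memLp g hg) (hS.memLp_fourier hP hg),
      ← hS.norm_toLp_fourier hP hg]
    exact norm_integral_mul_le f _
  · have hg' := hS.neg_mem g hg
    have e : fourierIntegralAt P (fourierIntegralAt P fun y => g (-y)) = g := by
      funext y
      rw [hS.inversion _ hg', neg_neg]
    have h1 := h _ (hS.integrable_fourier _ hg') (hS.memLp_fourier hP hg')
      (by rw [e]; exact hS.memLp g hg)
    rw [e] at h1
    rw [← h1]
    refine (norm_integral_mul_le ψ (hS.memLp_fourier hP hg')).trans (le_of_eq ?_)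
    rw [hS.norm_toLp_fourier hP hg', ← sq_eq_sq₀ (by positivity) (by positivity), mul_pow, mul_pow,
      norm_toLp_sq, norm_toLp_sq, integral_neg_eq_self (fun y => ‖g y‖ ^ 2)]

theorem norm_add_smul [MeasurableMul₂ K] [MeasurableNeg K] [SFinite P.haar]
    [P.haar.IsNegInvariant] (hS : IsPlancherelClass P S) (hP : IsUnitaryCharacter P)
    {f ψ f' ψ' : Lp ℂ 2 P.haar} (h : IsL2Fourier P f ψ) (h' : IsL2Fourier P f' ψ') (c : ℂ) :
    ‖ψ + c • ψ'‖ = ‖f + c • f'‖ := by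
  have key : ∀ (u v : Lp ℂ 2 P.haar) {g : K → ℂ}, MemLp g 2 P.haar →
      ∫ x, (u + c • v : Lp ℂ 2 P.haar) x * g x ∂P.haar =
        (∫ x, u x * g x ∂P.haar) + c * ∫ x, v x * g x ∂P.haar := by
    intro u v g hg
    have iu : Integrable (fun x => u x * g x) P.haar := (Lp.memLp u).integrable_mul hg
    have iv : Integrable (fun x => v x * g x) P.haar := (Lp.memLp v).integrable_mul hg
    rw [← integral_const_mul, ← integral_add iu (iv.const_mul c)]
    refine integral_congr_ae ?_
    filter_upwards [Lp.coeFn_add u (c • v), Lp.coeFn_smul c v] with x hx hx'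
    rw [hx, Pi.add_apply, hx', Pi.smul_apply, smul_eq_mul, add_mul, mul_assoc]
  refine hS.norm_eq hP fun g hg1 hg2 hg3 => ?_
  rw [key _ _ hg2, key _ _ hg3, h g hg1 hg2, h' g hg1 hg2]

theorem inner_eq [MeasurableMul₂ K] [MeasurableNeg K] [SFinite P.haar]
    [P.haar.IsNegInvariant] (hS : IsPlancherelClass P S) (hP : IsUnitaryCharacter P)
    {f ψ f' ψ' : Lp ℂ 2 P.haar} (h : IsL2Fourier P f ψ) (h' : IsL2Fourier P f' ψ') :
    inner ℂ ψ ψ' = inner ℂ f f' := by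
  have k := hS.norm_add_smul hP h h'
  have k1 := k 1
  have k2 := k (-1)
  have k3 := k Complex.I
  have k4 := k (-Complex.I)
  rw [one_smul, one_smul] at k1
  rw [neg_one_smul, neg_one_smul, ← sub_eq_add_neg, ← sub_eq_add_neg] at k2
  rw [neg_smul, neg_smul, ← sub_eq_add_neg, ← sub_eq_add_neg] at k4
  rw [inner_eq_sum_norm_sq_div_four, inner_eq_sum_norm_sq_div_four]
  simp only [RCLike.I_to_complex]
  rw [k1, k2, k3, k4]

end IsPlancherelClass

/-- A nonnegative weight `e` whose Fourier transform is a nonnegative even kernel `k`. -/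
structure IsPositiveWeight (P : LocalPlace K) (e k : K → ℝ) : Prop where
  meas : Measurable e
  nonneg : ∀ x, 0 ≤ e x
  le_one : ∀ x, e x ≤ 1
  integrable : Integrable e P.haar
  meas_kernel : Measurable k
  kernel_nonneg : ∀ x, 0 ≤ k x
  kernel_even : ∀ x, k (-x) = k x
  fourier : ∀ x, fourierIntegralAt P (fun y => (e y : ℂ)) x = k x

namespace IsPositiveWeight

variable {e k : K → ℝ}

theorem integrable_ofReal (hek : IsPositiveWeight P e k) :
    Integrable (fun x => (e x : ℂ)) P.haar := hek.integrable.ofReal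

theorem norm_le (hek : IsPositiveWeight P e k) (x : K) : ‖(e x : ℂ)‖ ≤ 1 := by
  rw [Complex.norm_of_nonneg (hek.nonneg x)]
  exact hek.le_one x

theorem memLp (hek : IsPositiveWeight P e k) : MemLp (fun x => (e x : ℂ)) 2 P.haar := by
  have hm : AEStronglyMeasurable (fun x => (e x : ℂ)) P.haar :=
    (Complex.measurable_ofReal.comp hek.meas).aestronglyMeasurable
  rw [memLp_two_iff_integrable_sq_norm hm]
  refine hek.integrable.mono' (hm.norm.pow 2) (ae_of_all _ fun x => ?_)
  rw [Real.norm_of_nonneg (by positivity), Complex.norm_of_nonneg (hek.nonneg x), pow_two]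
  exact mul_le_of_le_one_left (hek.nonneg x) (hek.le_one x)

theorem fourier_mul_conj [MeasurableMul₂ K] (hP : IsUnitaryCharacter P)
    (hek : IsPositiveWeight P e k) {f ψ : Lp ℂ 2 P.haar} (h : IsL2Fourier P f ψ) (y : K) :
    fourierIntegralAt P (fun x => (e x : ℂ) * (starRingEnd ℂ) (ψ x)) y =
      (starRingEnd ℂ) (∫ z, f z * (k (z - y) : ℂ) ∂P.haar) := by
  have h1 := h _ (hP.integrable_mul_char hek.integrable_ofReal y) (hP.memLp_mul_char hek.memLp y)
  have e2 : ∀ z, fourierIntegralAt P (fun x => (e x : ℂ) * P.char (y * x)) z = k (z - y) := by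
    intro z
    rw [← hek.fourier, fourierIntegralAt, fourierIntegralAt]
    refine integral_congr_ae (ae_of_all _ fun x => ?_)
    simp only []
    rw [mul_assoc, ← hP.map_add]
    congr 2; ring
  simp only [e2] at h1
  rw [← h1, ← integral_conj, fourierIntegralAt]
  refine integral_congr_ae (ae_of_all _ fun x => ?_)
  simp only [map_mul, hP.conj, Complex.conj_ofReal]
  ring

/-- The duality formula is applied with `g = e ψ̄`, whose transform is the conjugate of `f`
integrated against the translated kernel. The form in the Fourier variable thus becomes a form in
`f` with kernel `k(z - y)`. -/
theorem integral_mul_norm_sq [MeasurableMul₂ K] (hP : IsUnitaryCharacter P)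
    (hek : IsPositiveWeight P e k) {f ψ : Lp ℂ 2 P.haar} (h : IsL2Fourier P f ψ) :
    ((∫ x, e x * ‖ψ x‖ ^ 2 ∂P.haar : ℝ) : ℂ) =
      ∫ y, f y * (starRingEnd ℂ) (∫ z, f z * (k (z - y) : ℂ) ∂P.haar) ∂P.haar := by
  have hψ : MemLp (fun x => (starRingEnd ℂ) (ψ x)) 2 P.haar := (Lp.memLp ψ).star
  have h1 := h (fun x => (e x : ℂ) * (starRingEnd ℂ) (ψ x)) (hek.memLp.integrable_mul hψ)
    (hψ.of_le (hek.memLp.1.mul hψ.1) (ae_of_all _ fun x => by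
      rw [norm_mul]
      exact mul_le_of_le_one_left (norm_nonneg _) (hek.norm_le x)))
  simp only [hek.fourier_mul_conj hP h] at h1
  rw [← h1, ← integral_complex_ofReal]
  refine integral_congr_ae (ae_of_all _ fun x => ?_)
  simp only []
  rw [mul_left_comm, Complex.mul_conj, Complex.normSq_eq_norm_sq]
  push_cast; ring

theorem two_mul_mul_le_weighted (a b : ℝ) {s t : ℝ} (hs : 0 < s) (ht : 0 < t) :
    2 * (a * b) ≤ a ^ 2 / s * t + b ^ 2 / t * s := by
  have h : a ^ 2 / s * t + b ^ 2 / t * s - 2 * (a * b) = (a * t - b * s) ^ 2 / (s * t) := by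
    field_simp
    ring
  have := div_nonneg (sq_nonneg (a * t - b * s)) (mul_pos hs ht).le
  linarith

/-- Schur's test with the weight `w`. -/
theorem lintegral_lintegral_kernel_le [MeasurableSub₂ K] [SFinite P.haar]
    (hek : IsPositiveWeight P e k) {w ρ : K → ℝ} (hw : Measurable w) (hw0 : ∀ᵐ y ∂P.haar, 0 < w y)
    (hwρ : ∀ᵐ y ∂P.haar, ∫⁻ z, ENNReal.ofReal (k (z - y) * w z) ∂P.haar ≤ ENNReal.ofReal (ρ y * w y))
    {u : K → ℝ} (hu : AEMeasurable u P.haar) :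
    ∫⁻ y, ∫⁻ z, ENNReal.ofReal (u y * (u z * k (z - y))) ∂P.haar ∂P.haar ≤
      ∫⁻ y, ENNReal.ofReal (ρ y * u y ^ 2) ∂P.haar := by
  set F : K → K → ENNReal := fun y z => ENNReal.ofReal (u y ^ 2 / w y * (k (z - y) * w z)) with hF
  have hk := hek.meas_kernel
  have hFm : AEMeasurable (Function.uncurry F) (P.haar.prod P.haar) := by
    have h1 : AEMeasurable (fun p : K × K => u p.1) (P.haar.prod P.haar) := hu.comp_fst
    simp only [hF]
    refine AEMeasurable.ennreal_ofReal (AEMeasurable.mul ((h1.pow_const 2).div ?_) ?_)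
    · exact (by fun_prop : Measurable fun p : K × K => w p.1).aemeasurable
    · exact (by fun_prop : Measurable fun p : K × K => k (p.2 - p.1) * w p.2).aemeasurable
  have hle : ∀ᵐ y ∂P.haar, ∫⁻ z, F y z ∂P.haar ≤ ENNReal.ofReal (ρ y * u y ^ 2) := by
    filter_upwards [hwρ, hw0] with y hy hy0
    simp only [hF]
    have h0 : 0 ≤ u y ^ 2 / w y := by positivity
    simp only [ENNReal.ofReal_mul h0]
    rw [lintegral_const_mul _ (by fun_prop)]
    refine (mul_le_mul_right hy _).trans (le_of_eq ?_)
    rw [← ENNReal.ofReal_mul h0]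
    congr 1
    field_simp
  have hI : ∫⁻ y, ∫⁻ z, F y z ∂P.haar ∂P.haar ≤ ∫⁻ y, ENNReal.ofReal (ρ y * u y ^ 2) ∂P.haar :=
    lintegral_mono_ae hle
  have hI' : ∫⁻ y, ∫⁻ z, F z y ∂P.haar ∂P.haar ≤
      ∫⁻ y, ENNReal.ofReal (ρ y * u y ^ 2) ∂P.haar := by
    rw [lintegral_lintegral_swap hFm] at hI
    exact hI
  -- Weighted arithmetic-geometric mean: `2 u(y)u(z) ≤ u(y)² w(z)/w(y) + u(z)² w(y)/w(z)`. Since `k`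
  -- is even, the two terms are transposes of each other and have the same double integral.
  have hpt : ∀ᵐ y ∂P.haar, ∫⁻ z, 2 * ENNReal.ofReal (u y * (u z * k (z - y))) ∂P.haar ≤
      ∫⁻ z, (F y z + F z y) ∂P.haar := by
    filter_upwards [hw0] with y hy
    refine lintegral_mono_ae ?_
    filter_upwards [hw0] with z hz
    have hk0 := hek.kernel_nonneg (z - y)
    have hk1 : k (y - z) = k (z - y) := by rw [← hek.kernel_even, neg_sub]
    simp only [hF]
    rw [hk1, ← ENNReal.ofReal_add (by positivity) (by positivity),
      show (2 : ENNReal) = ENNReal.ofReal 2 by simp, ← ENNReal.ofReal_mul (by norm_num)]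
    refine ENNReal.ofReal_le_ofReal ?_
    have h := mul_le_mul_of_nonneg_left (two_mul_mul_le_weighted (u y) (u z) hy hz) hk0
    calc _ = k (z - y) * (2 * (u y * u z)) := by ring
      _ ≤ _ := h
      _ = _ := by ring
  have hd : 2 * ∫⁻ y, ∫⁻ z, ENNReal.ofReal (u y * (u z * k (z - y))) ∂P.haar ∂P.haar ≤
      2 * ∫⁻ y, ENNReal.ofReal (ρ y * u y ^ 2) ∂P.haar := by
    rw [two_mul (∫⁻ y, ENNReal.ofReal (ρ y * u y ^ 2) ∂P.haar)]
    refine le_trans ?_ (add_le_add hI hI')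
    have hFm' : AEMeasurable (fun y => ∫⁻ z, F y z ∂P.haar) P.haar := hFm.lintegral_prod_right'
    rw [← lintegral_add_left' hFm']
    rw [← lintegral_const_mul' _ _ (by simp)]
    refine lintegral_mono_ae ?_
    filter_upwards [hpt] with y hy
    rw [lintegral_const_mul' _ _ (by simp), lintegral_add_left' (by simp only [hF]; fun_prop)] at hy
    exact hy
  exact (ENNReal.mul_le_mul_iff_right (by simp) (by simp)).1 hd

theorem integral_mul_norm_sq_le [MeasurableMul₂ K] [MeasurableSub₂ K] [SFinite P.haar]
    (hP : IsUnitaryCharacter P) (hek : IsPositiveWeight P e k) {w ρ : K → ℝ} (hw : Measurable w)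
    (hw0 : ∀ᵐ y ∂P.haar, 0 < w y) (hρ0 : ∀ y, 0 ≤ ρ y)
    (hwρ : ∀ᵐ y ∂P.haar, ∫⁻ z, ENNReal.ofReal (k (z - y) * w z) ∂P.haar ≤ ENNReal.ofReal (ρ y * w y))
    {f ψ : Lp ℂ 2 P.haar} (h : IsL2Fourier P f ψ)
    (hρf : Integrable (fun y => ρ y * ‖f y‖ ^ 2) P.haar) :
    ∫ x, e x * ‖ψ x‖ ^ 2 ∂P.haar ≤ ∫ y, ρ y * ‖f y‖ ^ 2 ∂P.haar := by
  have h0 : 0 ≤ ∫ x, e x * ‖ψ x‖ ^ 2 ∂P.haar :=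
    integral_nonneg fun x => mul_nonneg (hek.nonneg x) (by positivity)
  have h1 : 0 ≤ ∫ y, ρ y * ‖f y‖ ^ 2 ∂P.haar :=
    integral_nonneg fun x => mul_nonneg (hρ0 x) (by positivity)
  rw [← ENNReal.ofReal_le_ofReal_iff h1, ofReal_integral_eq_lintegral_ofReal hρf
    (ae_of_all _ fun y => mul_nonneg (hρ0 y) (by positivity))]
  refine le_trans ?_ (hek.lintegral_lintegral_kernel_le hw hw0 hwρ (u := fun y => ‖f y‖)
    (Lp.memLp f).1.norm.aemeasurable)
  have h2 : ENNReal.ofReal (∫ x, e x * ‖ψ x‖ ^ 2 ∂P.haar) =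
      ‖((∫ x, e x * ‖ψ x‖ ^ 2 ∂P.haar : ℝ) : ℂ)‖ₑ := by
    rw [← ofReal_norm, Complex.norm_of_nonneg h0]
  rw [h2, hek.integral_mul_norm_sq hP h]
  refine (enorm_integral_le_lintegral_enorm _).trans (lintegral_mono fun y => ?_)
  rw [enorm_mul, RCLike.enorm_conj]
  calc _ ≤ ‖f y‖ₑ * ∫⁻ z, ‖f z * (k (z - y) : ℂ)‖ₑ ∂P.haar := by
        gcongr
        exact enorm_integral_le_lintegral_enorm _
    _ = _ := by
        rw [← lintegral_const_mul' _ _ (by simp)]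
        refine lintegral_congr fun z => ?_
        rw [← enorm_mul, ← ofReal_norm, norm_mul, norm_mul,
          Complex.norm_of_nonneg (hek.kernel_nonneg _)]

end IsPositiveWeight

theorem integrable_logMul {f a : Lp ℂ 2 P.haar} (h : IsLogMul P f a) :
    Integrable (fun y => Real.log (P.abs y) * ‖f y‖ ^ 2) P.haar ∧
      inner ℂ a f = ((∫ y, Real.log (P.abs y) * ‖f y‖ ^ 2 ∂P.haar : ℝ) : ℂ) := by
  have e : ∀ᵐ y ∂P.haar, inner ℂ (a y) (f y) =
      ((Real.log (P.abs y) * ‖f y‖ ^ 2 : ℝ) : ℂ) := by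
    filter_upwards [h] with y hy
    rw [hy, RCLike.inner_apply, map_mul, Complex.conj_ofReal, mul_left_comm, Complex.mul_conj,
      Complex.normSq_eq_norm_sq]
    push_cast; ring
  refine ⟨?_, ?_⟩
  · have := ((L2.integrable_inner a f).congr e).re
    exact this
  · rw [L2.inner_def, integral_congr_ae e, integral_complex_ofReal]

/-- `e` represents `L` as a superposition over `t`, up to the constant cutoff `c`. -/
structure IsFrullaniFamily (μ : Measure K) (c : ℝ → ℝ) (e : ℝ → K → ℝ) (L : K → ℝ) (C : ℝ) :
    Prop where
  meas : Measurable (Function.uncurry e)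
  integrableOn : ∀ᵐ y ∂μ, IntegrableOn (fun t => (c t - e t y) / t) (Ioi 0)
  integral_abs_le : ∀ᵐ y ∂μ, ∫ t in Ioi (0 : ℝ), |(c t - e t y) / t| ≤ C * (1 + |L y|)

/-- The bound `C (1 + |L|)` on the absolute integral over `t` is what Fubini needs against `|u|²`,
since both `|u|²` and `L |u|²` are integrable. It is applied to `e` with the transform of `f`, and
to `ρ` with `f` itself. -/
theorem IsFrullaniFamily.integral_swap {μ : Measure K} [SFinite μ] {c : ℝ → ℝ} {e : ℝ → K → ℝ}
    {L : K → ℝ} {C : ℝ} (hc : Measurable c) (h : IsFrullaniFamily μ c e L C) (u : Lp ℂ 2 μ)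
    (hL : Integrable (fun y => L y * ‖u y‖ ^ 2) μ) :
    Integrable (fun y => (∫ t in Ioi (0 : ℝ), (c t - e t y) / t) * ‖u y‖ ^ 2) μ ∧
    (∀ᵐ t ∂(volume.restrict (Ioi (0 : ℝ))), Integrable (fun y => e t y * ‖u y‖ ^ 2) μ) ∧
    IntegrableOn (fun t => (c t * ‖u‖ ^ 2 - ∫ y, e t y * ‖u y‖ ^ 2 ∂μ) / t) (Ioi 0) ∧
    ∫ t in Ioi (0 : ℝ), (c t * ‖u‖ ^ 2 - ∫ y, e t y * ‖u y‖ ^ 2 ∂μ) / t =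
      ∫ y, (∫ t in Ioi (0 : ℝ), (c t - e t y) / t) * ‖u y‖ ^ 2 ∂μ := by
  have hu2 : Integrable (fun y => ‖u y‖ ^ 2) μ :=
    (memLp_two_iff_integrable_sq_norm (Lp.memLp u).1).1 (Lp.memLp u)
  have he := h.meas
  have hi : Integrable (fun p : ℝ × K => (c p.1 - e p.1 p.2) / p.1 * ‖u p.2‖ ^ 2)
      ((volume.restrict (Ioi 0)).prod μ) := by
    have hem : Measurable fun p : ℝ × K => (c p.1 - e p.1 p.2) / p.1 :=
      ((hc.comp measurable_fst).sub he).div measurable_fst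
    have hm : AEStronglyMeasurable (fun p : ℝ × K => (c p.1 - e p.1 p.2) / p.1 * ‖u p.2‖ ^ 2)
        ((volume.restrict (Ioi 0)).prod μ) := hem.aestronglyMeasurable.mul hu2.1.comp_snd
    rw [integrable_prod_iff' hm]
    refine ⟨?_, ?_⟩
    · filter_upwards [h.integrableOn] with y hy
      exact hy.mul_const _
    · have hb : Integrable (fun y => C * (‖u y‖ ^ 2 + |L y * ‖u y‖ ^ 2|)) μ :=
        (hu2.add hL.abs).const_mul C
      refine hb.mono' ?_ ?_
      · exact hm.norm.prod_swap.integral_prod_right'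
      · filter_upwards [h.integral_abs_le] with y hy
        simp only [norm_mul]
        rw [integral_mul_const, Real.norm_of_nonneg (by positivity), Real.norm_of_nonneg (by positivity)]
        refine (mul_le_mul_of_nonneg_right hy (by positivity)).trans (le_of_eq ?_)
        rw [abs_mul, abs_of_nonneg (sq_nonneg ‖u y‖)]
        ring
  have e0 : ∀ᵐ t ∂(volume.restrict (Ioi (0 : ℝ))), Integrable (fun y => e t y * ‖u y‖ ^ 2) μ := by
    filter_upwards [hi.prod_right_ae, ae_restrict_mem measurableSet_Ioi] with t h1 (ht : 0 < t)
    refine ((hu2.const_mul (c t)).sub (h1.const_mul t)).congr (ae_of_all _ fun y => ?_)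
    simp only [Pi.sub_apply]
    field_simp
    ring
  have e1 : ∀ᵐ t ∂(volume.restrict (Ioi (0 : ℝ))), ∫ y, (c t - e t y) / t * ‖u y‖ ^ 2 ∂μ =
      (c t * ‖u‖ ^ 2 - ∫ y, e t y * ‖u y‖ ^ 2 ∂μ) / t := by
    filter_upwards [e0] with t h2
    rw [norm_Lp_sq, ← integral_const_mul, ← integral_sub (hu2.const_mul _) h2, ← integral_div]
    refine integral_congr_ae (ae_of_all _ fun y => ?_)
    simp only []
    ring
  refine ⟨?_, e0, ?_, ?_⟩
  · refine hi.integral_prod_right.congr (ae_of_all _ fun y => ?_)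
    exact integral_mul_const (‖u y‖ ^ 2) fun t => (c t - e t y) / t
  · exact hi.integral_prod_left.congr e1
  · rw [← integral_congr_ae e1]
    rw [integral_integral_swap hi]
    simp only [integral_mul_const]

/-- A lower bound for the conductor operator, from positive kernels `k t = F (e t)` whose Schur
bounds are `ρ t`. -/
theorem conductorBoundedBelowBy_of_kernel [MeasurableMul₂ K] [MeasurableSub₂ K] [MeasurableNeg K]
    [SFinite P.haar] [P.haar.IsNegInvariant] (hP : IsUnitaryCharacter P) {S : Set (K → ℂ)}
    (hS : IsPlancherelClass P S) {c : ℝ → ℝ} (hc : Measurable c) {e k ρ : ℝ → K → ℝ} {w : K → ℝ}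
    {r c₀ c₁ C C' : ℝ} (hr : 0 ≤ r)
    (hek : ∀ t, 0 < t → IsPositiveWeight P (e t) (k t))
    (hw : Measurable w) (hw0 : ∀ᵐ y ∂P.haar, 0 < w y) (hρ0 : ∀ t y, 0 < t → 0 ≤ ρ t y)
    (hwρ : ∀ t, 0 < t → ∀ᵐ y ∂P.haar,
      ∫⁻ z, ENNReal.ofReal (k t (z - y) * w z) ∂P.haar ≤ ENNReal.ofReal (ρ t y * w y))
    (he : IsFrullaniFamily P.haar c e (fun y => Real.log (P.abs y)) C)
    (hρ : IsFrullaniFamily P.haar c ρ (fun y => Real.log (P.abs y)) C')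
    (hlog : ∀ᵐ y ∂P.haar, r * (∫ t in Ioi (0 : ℝ), (c t - e t y) / t) + c₀ ≤ Real.log (P.abs y))
    (hlow : ∀ᵐ y ∂P.haar,
      c₁ ≤ Real.log (P.abs y) + (r * (∫ t in Ioi (0 : ℝ), (c t - ρ t y) / t) + c₀)) :
    ConductorBoundedBelowBy P c₁ := by
  rintro f g ⟨a, b, ha, ⟨ψ, ψ', hψ, hψψ', hb⟩, rfl⟩
  obtain ⟨i1, m1⟩ := integrable_logMul ha
  obtain ⟨i2, m2⟩ := integrable_logMul hψψ'
  rw [hS.inner_eq hP hb hψ] at m2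
  rw [inner_add_left, m1, m2]
  refine ⟨by simp, ?_⟩
  rw [← Complex.ofReal_add, Complex.ofReal_re]
  have hn : ‖ψ‖ ^ 2 = ‖f‖ ^ 2 := by
    rw [hS.norm_eq hP fun g h1 h2 _ => hψ g h1 h2]
  obtain ⟨j1, -, j2, j3⟩ := he.integral_swap hc ψ i2
  obtain ⟨l1, l0, l2, l3⟩ := hρ.integral_swap hc f i1
  have hf2 : Integrable (fun y => ‖f y‖ ^ 2) P.haar :=
    (memLp_two_iff_integrable_sq_norm (Lp.memLp f).1).1 (Lp.memLp f)
  have hψ2 : Integrable (fun y => ‖ψ y‖ ^ 2) P.haar :=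
    (memLp_two_iff_integrable_sq_norm (Lp.memLp ψ).1).1 (Lp.memLp ψ)
  -- `s1` spreads `log|x|` over `t`, with `‖ψ‖ = ‖f‖` making the cutoff terms agree; `s2` is Schur's
  -- test for each `t`; `s3` sums over `t` again and uses the pointwise lower bound.
  have s1 : r * (∫ t in Ioi (0 : ℝ), (c t * ‖f‖ ^ 2 - ∫ y, e t y * ‖ψ y‖ ^ 2 ∂P.haar) / t) +
      c₀ * ‖f‖ ^ 2 ≤ ∫ y, Real.log (P.abs y) * ‖ψ y‖ ^ 2 ∂P.haar := by
    rw [← hn, j3, norm_Lp_sq, ← integral_const_mul, ← integral_const_mul,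
      ← integral_add (j1.const_mul r) (hψ2.const_mul c₀)]
    refine integral_mono_ae ((j1.const_mul r).add (hψ2.const_mul c₀)) i2 ?_
    filter_upwards [hlog] with y hy
    have := mul_le_mul_of_nonneg_right hy (sq_nonneg ‖ψ y‖)
    linarith
  have s2 : ∫ t in Ioi (0 : ℝ), (c t * ‖f‖ ^ 2 - ∫ y, ρ t y * ‖f y‖ ^ 2 ∂P.haar) / t ≤
      ∫ t in Ioi (0 : ℝ), (c t * ‖f‖ ^ 2 - ∫ y, e t y * ‖ψ y‖ ^ 2 ∂P.haar) / t := by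
    rw [hn] at j2
    refine integral_mono_ae l2 j2 ?_
    filter_upwards [l0, ae_restrict_mem measurableSet_Ioi] with t h1 (ht : 0 < t)
    have := (hek t ht).integral_mul_norm_sq_le hP hw hw0 (fun y => hρ0 t y ht) (hwρ t ht) hψ h1
    exact div_le_div_of_nonneg_right (by linarith) (le_of_lt ht)
  have s3 : c₁ * ‖f‖ ^ 2 ≤ (∫ y, Real.log (P.abs y) * ‖f y‖ ^ 2 ∂P.haar) +
      (r * (∫ y, (∫ t in Ioi (0 : ℝ), (c t - ρ t y) / t) * ‖f y‖ ^ 2 ∂P.haar) + c₀ * ‖f‖ ^ 2) := by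
    have i3 : Integrable (fun y => r * ((∫ t in Ioi (0 : ℝ), (c t - ρ t y) / t) * ‖f y‖ ^ 2) +
        c₀ * ‖f y‖ ^ 2) P.haar := (l1.const_mul r).add (hf2.const_mul c₀)
    rw [norm_Lp_sq, ← integral_const_mul, ← integral_const_mul, ← integral_const_mul,
      ← integral_add (l1.const_mul r) (hf2.const_mul c₀), ← integral_add i1 i3]
    refine integral_mono_ae (hf2.const_mul _) (i1.add i3) ?_
    filter_upwards [hlow] with y hy
    have := mul_le_mul_of_nonneg_right hy (sq_nonneg ‖f y‖)
    linarith
  rw [← l3] at s3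
  have s4 := mul_le_mul_of_nonneg_left s2 hr
  linarith

end Plancherel


/-! ### The sharp Schur bound for Gaussian kernels -/

/-- The function `Γ(σ)⁻¹ ∫ c^{σ-1} (1+ct)^{-2σ} e^{-c/(1+ct)} dc`. -/
noncomputable def schurProfile (σ t : ℝ) : ℝ :=
  (Real.Gamma σ)⁻¹ * ∫ c in Ioi (0 : ℝ),
    c ^ (σ - 1) * ((1 + c * t) ^ (-(2 * σ)) * Real.exp (-(c / (1 + c * t))))

theorem schurProfile_nonneg {σ t : ℝ} (hσ : 0 < σ) (ht : 0 < t) : 0 ≤ schurProfile σ t := by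
  have hΓ := Real.Gamma_pos_of_pos hσ
  refine mul_nonneg (inv_nonneg.2 hΓ.le) (setIntegral_nonneg measurableSet_Ioi fun c (hc : 0 < c) => ?_)
  positivity

theorem measurable_schurProfile (σ : ℝ) : Measurable (schurProfile σ) := by
  have h : Measurable (fun p : ℝ × ℝ => p.2 ^ (σ - 1) *
    ((1 + p.2 * p.1) ^ (-(2 * σ)) * Real.exp (-(p.2 / (1 + p.2 * p.1))))) := by fun_prop
  exact ((h.stronglyMeasurable.integral_prod_right
    (ν := volume.restrict (Ioi (0 : ℝ)))).measurable).const_mul _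

theorem integrableOn_schurProfile {σ t : ℝ} (hσ : 0 < σ) (ht : 0 < t) :
    IntegrableOn (fun c : ℝ => c ^ (σ - 1) * ((1 + c * t) ^ (-(2 * σ)) *
      Real.exp (-(c / (1 + c * t))))) (Ioi 0) := by
  have hm : Measurable (fun c : ℝ => c ^ (σ - 1) * ((1 + c * t) ^ (-(2 * σ)) *
      Real.exp (-(c / (1 + c * t))))) := by fun_prop
  have hexp : ∀ c : ℝ, 0 < c → Real.exp (-(c / (1 + c * t))) ≤ 1 := fun c hc =>
    Real.exp_le_one_iff.2 (neg_nonpos.2 (by positivity))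
  rw [← Ioc_union_Ioi_eq_Ioi (zero_le_one' ℝ)]
  refine IntegrableOn.union ?_ ?_
  · have h1 : IntegrableOn (fun c : ℝ => c ^ (σ - 1)) (Ioc 0 1) := by
      rw [← intervalIntegrable_iff_integrableOn_Ioc_of_le zero_le_one]
      exact intervalIntegral.intervalIntegrable_rpow' (by linarith)
    refine Integrable.mono' h1 hm.aestronglyMeasurable ?_
    refine (ae_restrict_iff' measurableSet_Ioc).2 (ae_of_all _ fun c hc => ?_)
    have hc0 : 0 < c := hc.1
    rw [Real.norm_of_nonneg (by positivity)]
    refine mul_le_of_le_one_right (by positivity) (mul_le_one₀ ?_ (by positivity) (hexp c hc0))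
    exact Real.rpow_le_one_of_one_le_of_nonpos (by nlinarith [mul_pos hc0 ht]) (by linarith)
  · have h1 : IntegrableOn (fun c : ℝ => t ^ (-(2 * σ)) * c ^ (-σ - 1)) (Ioi 1) :=
      (integrableOn_Ioi_rpow_of_lt (by linarith) one_pos).const_mul _
    refine Integrable.mono' h1 hm.aestronglyMeasurable ?_
    refine (ae_restrict_iff' measurableSet_Ioi).2 (ae_of_all _ fun c (hc : 1 < c) => ?_)
    have hc0 : 0 < c := by linarith
    rw [Real.norm_of_nonneg (by positivity)]
    have h2 : (1 + c * t) ^ (-(2 * σ)) ≤ t ^ (-(2 * σ)) * c ^ (-(2 * σ)) := by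
      rw [← Real.mul_rpow ht.le hc0.le]
      exact Real.rpow_le_rpow_of_nonpos (by positivity) (by nlinarith) (by linarith)
    calc _ ≤ c ^ (σ - 1) * (t ^ (-(2 * σ)) * c ^ (-(2 * σ)) * 1) := by
          gcongr
          exact hexp c hc0
      _ = t ^ (-(2 * σ)) * (c ^ (σ - 1) * c ^ (-(2 * σ))) := by ring
      _ = _ := by rw [← Real.rpow_add hc0]; ring_nf

theorem integral_schurProfile_scale {σ t q : ℝ} (hσ : 0 < σ) (ht : 0 < t) (hq : 0 < q) :
    IntegrableOn (fun c : ℝ => c ^ (σ - 1) * ((1 + c * t) ^ (-(2 * σ)) *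
      Real.exp (-(c * q / (1 + c * t))))) (Ioi 0) ∧
    ∫ c in Ioi (0 : ℝ), c ^ (σ - 1) * ((1 + c * t) ^ (-(2 * σ)) *
      Real.exp (-(c * q / (1 + c * t)))) = Real.Gamma σ * (schurProfile σ (t / q) * q ^ (-σ)) := by
  set g : ℝ → ℝ := fun c => c ^ (σ - 1) * ((1 + c * (t / q)) ^ (-(2 * σ)) *
    Real.exp (-(c / (1 + c * (t / q))))) with hg
  have hΓ := Real.Gamma_pos_of_pos hσ
  have e : ∀ c ∈ Ioi (0 : ℝ), q ^ (1 - σ) * g (q * c) = c ^ (σ - 1) * ((1 + c * t) ^ (-(2 * σ)) *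
      Real.exp (-(c * q / (1 + c * t)))) := by
    intro c (hc : 0 < c)
    have h1 : q * c * (t / q) = c * t := by field_simp
    simp only [hg, h1]
    have h2 : q ^ (1 - σ) * q ^ (σ - 1) = 1 := by
      rw [← Real.rpow_add hq, show 1 - σ + (σ - 1) = 0 by ring, Real.rpow_zero]
    rw [Real.mul_rpow hq.le hc.le, mul_comm q c]
    linear_combination (c ^ (σ - 1) * ((1 + c * t) ^ (-(2 * σ)) *
      Real.exp (-(c * q / (1 + c * t))))) * h2
  have hgi : IntegrableOn (fun c => g (q * c)) (Ioi 0) := by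
    have := (integrableOn_Ioi_comp_mul_left_iff g 0 hq)
    rw [mul_zero] at this
    exact this.2 (integrableOn_schurProfile hσ (by positivity))
  refine ⟨IntegrableOn.congr_fun (hgi.const_mul (q ^ (1 - σ))) e measurableSet_Ioi, ?_⟩
  rw [← setIntegral_congr_fun measurableSet_Ioi e, integral_const_mul, integral_comp_mul_left_Ioi g 0 hq,
    mul_zero, schurProfile, smul_eq_mul, ← hg, ← mul_assoc (q ^ (1 - σ))]
  rw [show q ^ (1 - σ) * q⁻¹ = q ^ (-σ) by
    rw [← Real.rpow_neg_one q, ← Real.rpow_add hq]; ring_nf]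
  field_simp

/-- The difference of the two integrands of the Mellin–Frullani integral of the profile. -/
theorem integral_dilationKernel_scale {β c : ℝ} (hc : 0 < c) 
    (hK : IntegrableOn (fun v => dilationKernel β c v) (Ioi 0)) :
    IntegrableOn (fun t => (Real.exp (-t) * Real.exp (-c) -
      (1 + c * t) ^ (-β) * Real.exp (-(c / (1 + c * t)))) / t) (Ioi 0) ∧
    ∫ t in Ioi (0 : ℝ), (Real.exp (-t) * Real.exp (-c) -
      (1 + c * t) ^ (-β) * Real.exp (-(c / (1 + c * t)))) / t =
      (∫ v in Ioi (0 : ℝ), dilationKernel β c v) + Real.log c * Real.exp (-c) ∧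
    ∫ t in Ioi (0 : ℝ), |(Real.exp (-t) * Real.exp (-c) -
      (1 + c * t) ^ (-β) * Real.exp (-(c / (1 + c * t)))) / t| ≤
      (∫ v in Ioi (0 : ℝ), |dilationKernel β c v|) + |Real.log c| * Real.exp (-c) := by
  -- Under `v = ct` the term `e^{-v}` of the kernel becomes `e^{-ct}`. Subtracting a Frullani
  -- integrand at `c⁻¹` changes it to `e^{-t}` and adds `log c · e^{-c}` to the integral.
  set g : ℝ → ℝ := fun v => dilationKernel β c v -
    Real.exp (-c) * ((Real.exp (-v) - Real.exp (-(v * c⁻¹))) / v) with hg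
  have hci : 0 < c⁻¹ := inv_pos.2 hc
  have hF := (integrableOn_exp_neg_sub_div hci).const_mul (Real.exp (-c))
  have hgi : IntegrableOn g (Ioi 0) := hK.sub hF
  have e : ∀ t ∈ Ioi (0 : ℝ), c * g (c * t) = (Real.exp (-t) * Real.exp (-c) -
      (1 + c * t) ^ (-β) * Real.exp (-(c / (1 + c * t)))) / t := by
    intro t (ht : 0 < t)
    have h1 : c * t * c⁻¹ = t := by field_simp
    simp only [hg, dilationKernel, h1]
    field_simp
    ring
  have hsc : ∀ f : ℝ → ℝ, ∫ t in Ioi (0 : ℝ), c * f (c * t) = ∫ v in Ioi (0 : ℝ), f v := by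
    intro f
    rw [integral_const_mul, integral_comp_mul_left_Ioi f 0 hc, mul_zero, smul_eq_mul,
      mul_inv_cancel_left₀ hc.ne']
  have hgc : IntegrableOn (fun t => g (c * t)) (Ioi 0) := by
    have := (integrableOn_Ioi_comp_mul_left_iff g 0 hc)
    rw [mul_zero] at this
    exact this.2 hgi
  refine ⟨IntegrableOn.congr_fun (hgc.const_mul c) e measurableSet_Ioi, ?_, ?_⟩
  · rw [← setIntegral_congr_fun measurableSet_Ioi e, hsc, integral_sub hK hF, integral_const_mul,
      integral_exp_neg_sub_div hci, Real.log_inv]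
    ring
  · have e' : ∀ t ∈ Ioi (0 : ℝ), c * |g (c * t)| = |(Real.exp (-t) * Real.exp (-c) -
        (1 + c * t) ^ (-β) * Real.exp (-(c / (1 + c * t)))) / t| := by
      intro t ht
      rw [← e t ht, abs_mul, abs_of_pos hc]
    rw [← setIntegral_congr_fun measurableSet_Ioi e', hsc (fun v => |g v|)]
    have h2 : |Real.log c| * Real.exp (-c) = ∫ v in Ioi (0 : ℝ),
        |Real.exp (-c) * ((Real.exp (-v) - Real.exp (-(v * c⁻¹))) / v)| := by
      simp only [abs_mul, Real.abs_exp]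
      rw [integral_const_mul, integral_abs_exp_neg_sub_div hci, Real.log_inv, abs_neg, mul_comm]
    rw [h2, ← integral_add hK.abs hF.abs]
    exact integral_mono hgi.abs (hK.abs.add hF.abs) fun v => abs_sub _ _

/-- The kernel `(e^{-t} e^{-c} - (1+ct)^{-2σ} e^{-c/(1+ct)}) / t`. -/
noncomputable def schurKernel (σ c t : ℝ) : ℝ :=
  (Real.exp (-t) * Real.exp (-c) - (1 + c * t) ^ (-(2 * σ)) * Real.exp (-(c / (1 + c * t)))) / t

/-- With `β = 2σ` the dilation part contributes `Γ(σ) ψ(2σ - σ)` and the correction `log c · e^{-c}`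
contributes `Γ(σ) ψ(σ)`: the two coincide, whence the factor `2`. -/
theorem integrable_schurKernel {σ : ℝ} (hσ : 0 < σ) :
    Integrable (fun p : ℝ × ℝ => (p.1 : ℂ) ^ ((σ : ℂ) - 1) * (schurKernel σ p.1 p.2 : ℂ))
      ((volume.restrict (Ioi 0)).prod (volume.restrict (Ioi 0))) ∧
    ∫ c in Ioi (0 : ℝ), ∫ t in Ioi (0 : ℝ), (c : ℂ) ^ ((σ : ℂ) - 1) * (schurKernel σ c t : ℂ) =
      2 * Complex.Gamma σ * Complex.digamma σ := by
  have hm : Measurable (fun p : ℝ × ℝ => (p.1 : ℂ) ^ ((σ : ℂ) - 1) * (schurKernel σ p.1 p.2 : ℂ)) := by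
    unfold schurKernel; fun_prop
  have hw : 0 < (σ : ℂ).re := by simpa
  have hI := integrable_dilationKernel (β := 2 * σ) hw (by rw [Complex.ofReal_re]; linarith)
  have hI' := integral_cpow_mul_dilationKernel (β := 2 * σ) hw (by rw [Complex.ofReal_re]; linarith)
  obtain ⟨hl, hl'⟩ := mellinConvergent_log_mul_exp_neg hw
  have hsec : ∀ᵐ c ∂(volume.restrict (Ioi (0 : ℝ))),
      IntegrableOn (fun v => dilationKernel (2 * σ) c v) (Ioi 0) := by
    filter_upwards [hI.prod_right_ae, ae_restrict_mem measurableSet_Ioi] with c hc (hc0 : 0 < c)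
    have hne : (c : ℂ) ^ ((σ : ℂ) - 1) ≠ 0 := by
      rw [Ne, Complex.cpow_eq_zero_iff]
      exact fun h => hc0.ne' (by exact_mod_cast h.1)
    have h2 : Integrable (fun v => (dilationKernel (2 * σ) c v : ℂ)) (volume.restrict (Ioi 0)) :=
      (hc.const_mul ((c : ℂ) ^ ((σ : ℂ) - 1))⁻¹).congr
        (ae_of_all _ fun y => inv_mul_cancel_left₀ hne _)
    exact h2.re
  refine ⟨?_, ?_⟩
  · rw [integrable_prod_iff hm.aestronglyMeasurable]
    refine ⟨?_, ?_⟩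
    · filter_upwards [hsec, ae_restrict_mem measurableSet_Ioi] with c hc (hc0 : 0 < c)
      exact ((integral_dilationKernel_scale hc0 hc).1.ofReal (𝕜 := ℂ)).const_mul _
    · refine Integrable.mono' (hI.integral_norm_prod_left.add
        (integrableOn_rpow_mul_abs_log_mul_exp_neg hσ)) ?_ ?_
      · exact hm.norm.aestronglyMeasurable.integral_prod_right'
      · filter_upwards [hsec, ae_restrict_mem measurableSet_Ioi] with c hc (hc0 : 0 < c)
        have h3 := (integral_dilationKernel_scale hc0 hc).2.2
        rw [Real.norm_of_nonneg (integral_nonneg fun _ => norm_nonneg _)]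
        simp only [norm_mul, norm_cpow_sub_one hc0, Complex.norm_real, Real.norm_eq_abs,
          integral_const_mul, Complex.ofReal_re, Pi.add_apply]
        rw [← mul_add]
        exact mul_le_mul_of_nonneg_left h3 (by positivity)
  · have h1 : ∀ᵐ c : ℝ ∂(volume.restrict (Ioi (0 : ℝ))),
        ∫ t in Ioi (0 : ℝ), (c : ℂ) ^ ((σ : ℂ) - 1) * (schurKernel σ c t : ℂ) =
        (∫ v in Ioi (0 : ℝ), (c : ℂ) ^ ((σ : ℂ) - 1) * (dilationKernel (2 * σ) c v : ℂ)) +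
          (c : ℂ) ^ ((σ : ℂ) - 1) • ((Real.log c * Real.exp (-c) : ℝ) : ℂ) := by
      filter_upwards [hsec, ae_restrict_mem measurableSet_Ioi] with c hc (hc0 : 0 < c)
      rw [integral_const_mul, integral_const_mul, integral_complex_ofReal, integral_complex_ofReal,
        smul_eq_mul, ← mul_add, ← Complex.ofReal_add]
      congr 2
      exact (integral_dilationKernel_scale hc0 hc).2.1
    rw [integral_congr_ae h1, integral_add hI.integral_prod_left hl, hI']
    rw [mellin] at hl'
    rw [hl']
    push_cast
    ring_nf

/-- Integrating `schurKernel` against `c^{σ-1} dc` and dividing by `Γ(σ)` gives this integrand;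
exchanging the integrals evaluates it. This value is the sharp constant of the archimedean lower
bounds. -/
theorem integral_exp_neg_sub_schurProfile {σ : ℝ} (hσ : 0 < σ) :
    IntegrableOn (fun t => (Real.exp (-t) - schurProfile σ t) / t) (Ioi 0) ∧
    ∫ t in Ioi (0 : ℝ), (Real.exp (-t) - schurProfile σ t) / t =
      2 * (Complex.digamma σ).re := by
  obtain ⟨h1, h2⟩ := integrable_schurKernel hσ
  have hΓ := Real.Gamma_pos_of_pos hσ
  have hΓ' : (Real.Gamma σ : ℂ) ≠ 0 := by exact_mod_cast hΓ.ne'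
  have e : ∀ t ∈ Ioi (0 : ℝ), (Complex.Gamma σ)⁻¹ *
      ∫ c in Ioi (0 : ℝ), (c : ℂ) ^ ((σ : ℂ) - 1) * (schurKernel σ c t : ℂ) =
      (((Real.exp (-t) - schurProfile σ t) / t : ℝ) : ℂ) := by
    intro t (ht : 0 < t)
    have i1 := integrableOn_rpow_mul_exp_neg hσ one_pos
    have i2 := integrableOn_schurProfile hσ ht
    have e1 : ∀ c ∈ Ioi (0 : ℝ), (c : ℂ) ^ ((σ : ℂ) - 1) * (schurKernel σ c t : ℂ) =
        ((t⁻¹ * (Real.exp (-t) * (c ^ (σ - 1) * Real.exp (-(1 * c))) - c ^ (σ - 1) *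
          ((1 + c * t) ^ (-(2 * σ)) * Real.exp (-(c / (1 + c * t))))) : ℝ) : ℂ) := by
      intro c (hc : 0 < c)
      rw [show (σ : ℂ) - 1 = ((σ - 1 : ℝ) : ℂ) by push_cast; ring, ← Complex.ofReal_cpow hc.le,
        ← Complex.ofReal_mul, schurKernel, one_mul]
      congr 1
      ring
    rw [setIntegral_congr_fun measurableSet_Ioi e1, integral_complex_ofReal, integral_const_mul,
      integral_sub (i1.const_mul _) i2, integral_const_mul, integral_rpow_mul_exp_neg hσ one_pos,
      Real.one_rpow, one_mul, Complex.Gamma_ofReal, ← Complex.ofReal_inv, ← Complex.ofReal_mul,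
      schurProfile]
    congr 1
    field_simp
  have h3 := (h1.integral_prod_right.const_mul (Complex.Gamma σ)⁻¹)
  have h4 : IntegrableOn (fun t => (((Real.exp (-t) - schurProfile σ t) / t : ℝ) : ℂ)) (Ioi 0) :=
    IntegrableOn.congr_fun h3 e measurableSet_Ioi
  have h5 : ((∫ t in Ioi (0 : ℝ), (Real.exp (-t) - schurProfile σ t) / t : ℝ) : ℂ) =
      2 * Complex.digamma σ := by
    rw [← integral_complex_ofReal, ← setIntegral_congr_fun measurableSet_Ioi e, integral_const_mul,
      ← integral_integral_swap (f := fun c t : ℝ => (c : ℂ) ^ ((σ : ℂ) - 1) *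
        (schurKernel σ c t : ℂ)) h1, h2, Complex.Gamma_ofReal]
    field_simp
  refine ⟨h4.re, ?_⟩
  have h6 := congrArg Complex.re h5
  simpa using h6

theorem integral_exp_neg_sub_schurProfile_scale {σ q : ℝ} (hσ : 0 < σ) (hq : 0 < q) :
    IntegrableOn (fun t => (Real.exp (-t) - schurProfile σ (t / q)) / t) (Ioi 0) ∧
    ∫ t in Ioi (0 : ℝ), (Real.exp (-t) - schurProfile σ (t / q)) / t =
      2 * (Complex.digamma σ).re - Real.log q ∧
    ∫ t in Ioi (0 : ℝ), |(Real.exp (-t) - schurProfile σ (t / q)) / t| ≤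
      (∫ t in Ioi (0 : ℝ), |(Real.exp (-t) - schurProfile σ t) / t|) + |Real.log q| := by
  obtain ⟨i, hi⟩ := integral_exp_neg_sub_schurProfile hσ
  have hqi : 0 < q⁻¹ := inv_pos.2 hq
  have hF := integrableOn_exp_neg_sub_div hqi
  set g : ℝ → ℝ := fun t => (Real.exp (-t) - schurProfile σ t) / t with hg
  have hgc : IntegrableOn (fun t => q⁻¹ * g (q⁻¹ * t)) (Ioi 0) := by
    have := (integrableOn_Ioi_comp_mul_left_iff g 0 hqi)
    rw [mul_zero] at this
    exact (this.2 i).const_mul _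
  have hsc : ∀ f : ℝ → ℝ, ∫ t in Ioi (0 : ℝ), q⁻¹ * f (q⁻¹ * t) = ∫ v in Ioi (0 : ℝ), f v := by
    intro f
    rw [integral_const_mul, integral_comp_mul_left_Ioi f 0 hqi, mul_zero, smul_eq_mul,
      mul_inv_cancel_left₀ hqi.ne']
  have e : ∀ t ∈ Ioi (0 : ℝ), (Real.exp (-t) - Real.exp (-(t * q⁻¹))) / t + q⁻¹ * g (q⁻¹ * t) =
      (Real.exp (-t) - schurProfile σ (t / q)) / t := by
    intro t (ht : 0 < t)
    simp only [hg, mul_comm q⁻¹, div_eq_mul_inv]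
    field_simp
    ring
  refine ⟨IntegrableOn.congr_fun (hF.add hgc) e measurableSet_Ioi, ?_, ?_⟩
  · rw [← setIntegral_congr_fun measurableSet_Ioi e, integral_add hF hgc, hsc, hi,
      integral_exp_neg_sub_div hqi, Real.log_inv]
    ring
  · have h1 : ∫ t in Ioi (0 : ℝ), |(Real.exp (-t) - schurProfile σ (t / q)) / t| ≤
        ∫ t in Ioi (0 : ℝ), (|q⁻¹ * g (q⁻¹ * t)| + |(Real.exp (-t) - Real.exp (-(t * q⁻¹))) / t|) := by
      refine setIntegral_mono_on (IntegrableOn.congr_fun (hF.add hgc) e measurableSet_Ioi).abs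
        (hgc.abs.add hF.abs) measurableSet_Ioi fun t ht => ?_
      rw [← e t ht, add_comm]
      exact abs_add_le _ _
    refine h1.trans (le_of_eq ?_)
    rw [integral_add hgc.abs hF.abs, integral_abs_exp_neg_sub_div hqi, Real.log_inv, abs_neg]
    congr 1
    rw [← hsc fun t => |g t|]
    refine setIntegral_congr_fun measurableSet_Ioi fun t _ => ?_
    simp only [abs_mul, abs_of_pos hqi]

namespace IsGaussianFamily

variable {K : Type*} [Field K] [MeasurableSpace K] {P : LocalPlace K} {Q : K → ℝ} {r κ : ℝ}

theorem isPositiveWeight (hG : IsGaussianFamily P Q (fun _ => 1) (fun _ => 1) 0 r κ 1)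
    (hQ : ∀ y, Q (-y) = Q y) {t : ℝ} (ht : 0 < t) :
    IsPositiveWeight P (fun y => Real.exp (-(t * (κ * Q y))))
      (fun y => t ^ (-r) * Real.exp (-(κ * Q y / t))) where
  meas := by have := hG.meas_Q; fun_prop
  nonneg y := (Real.exp_pos _).le
  le_one y := Real.exp_le_one_iff.2 (neg_nonpos.2
    (mul_nonneg ht.le (mul_nonneg hG.κ_pos.le (hG.Q_nonneg y))))
  integrable := by
    have h := hG.integrable 0 (neg_neg_of_pos hG.r_pos) (t * κ) (mul_pos ht hG.κ_pos)
    simpa only [Real.rpow_zero, one_mul, mul_assoc] using h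
  meas_kernel := by have := hG.meas_Q; fun_prop
  kernel_nonneg y := by positivity
  kernel_even y := by rw [hQ]
  fourier x := by
    have h := hG.fourier t ht x
    simp only [one_mul, zero_add] at h
    rw [h]; push_cast; ring

/-- The kernel `F(e^{-tκQ})` maps Gaussians to Gaussians. -/
theorem integral_kernel_mul_gaussian [MeasurableMul₂ K] [MeasurableNeg K] [SFinite P.haar]
    (hG : IsGaussianFamily P Q (fun _ => 1) (fun _ => 1) 0 r κ 1) (hP : IsUnitaryCharacter P)
    (hQ : ∀ y, Q (-y) = Q y) {t c : ℝ} (ht : 0 < t) (hc : 0 < c) (y : K) :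
    ∫ z, t ^ (-r) * Real.exp (-(κ * Q (z - y) / t)) * Real.exp (-(c * (κ * Q z))) ∂P.haar =
      (1 + c * t) ^ (-r) * Real.exp (-(c * (κ * Q y) / (1 + c * t))) := by
  have hek := hG.isPositiveWeight hQ ht
  have hec := hG.isPositiveWeight hQ hc
  have h := integral_fourierIntegralAt_mul hP (hP.integrable_mul_char hek.integrable_ofReal y)
    hec.integrable_ofReal
  have e2 : ∀ z, fourierIntegralAt P (fun x => (Real.exp (-(t * (κ * Q x))) : ℂ) * P.char (y * x)) z =
      ((t ^ (-r) * Real.exp (-(κ * Q (z - y) / t)) : ℝ) : ℂ) := by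
    intro z
    rw [← hek.fourier, fourierIntegralAt, fourierIntegralAt]
    refine integral_congr_ae (ae_of_all _ fun x => ?_)
    simp only []
    rw [mul_assoc, ← hP.map_add]
    congr 2; ring
  have hs : 0 < t + c⁻¹ := by positivity
  have h3 := hG.fourier (t + c⁻¹) hs (-y)
  simp only [one_mul, zero_add, hQ, fourierIntegralAt, neg_mul, neg_neg] at h3
  simp only [hec.fourier] at h
  apply Complex.ofReal_injective
  rw [← integral_complex_ofReal]
  have e4 : ∀ x, (Real.exp (-(t * (κ * Q x))) : ℂ) * P.char (y * x) *
      ((c ^ (-r) * Real.exp (-(κ * Q x / c)) : ℝ) : ℂ) =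
      ((c ^ (-r) : ℝ) : ℂ) * ((Real.exp (-((t + c⁻¹) * (κ * Q x))) : ℂ) * P.char (y * x)) := by
    intro x
    rw [show -((t + c⁻¹) * (κ * Q x)) = -(t * (κ * Q x)) + -(κ * Q x / c) by ring, Real.exp_add]
    push_cast; ring
  have e5 : c ^ (-r) * (t + c⁻¹) ^ (-r) = (1 + c * t) ^ (-r) := by
    rw [← Real.mul_rpow hc.le hs.le]
    congr 1
    field_simp
    ring
  have e6 : κ * Q y / (t + c⁻¹) = c * (κ * Q y) / (1 + c * t) := by
    field_simp
    ring
  simp only [e2, e4] at h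
  rw [integral_const_mul, h3, ← mul_assoc, ← Complex.ofReal_mul, ← Complex.ofReal_mul, e5, e6] at h
  rw [← h]
  refine integral_congr_ae (ae_of_all _ fun z => ?_)
  simp only [Complex.ofReal_mul]

/-- The weight `(κQ)^{-r/2}`, which is `|y|^{-1/2}` up to a constant, is a Gamma integral of
Gaussians. The kernel maps Gaussians to Gaussians, and the resulting superposition is a rescaled
`schurProfile` times the weight. Schur's condition thus holds with equality. -/
theorem lintegral_kernel_mul_rpow [MeasurableMul₂ K] [MeasurableNeg K] [MeasurableSub₂ K]
    [SFinite P.haar]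
    (hG : IsGaussianFamily P Q (fun _ => 1) (fun _ => 1) 0 r κ 1) (hP : IsUnitaryCharacter P)
    (hQ : ∀ y, Q (-y) = Q y) {t : ℝ} (ht : 0 < t) {y : K} (hy : 0 < Q y) :
    ∫⁻ z, ENNReal.ofReal (t ^ (-r) * Real.exp (-(κ * Q (z - y) / t)) * (κ * Q z) ^ (-(r / 2)))
      ∂P.haar = ENNReal.ofReal (schurProfile (r / 2) (t / (κ * Q y)) * (κ * Q y) ^ (-(r / 2))) := by
  have hσ : 0 < r / 2 := half_pos hG.r_pos
  have hκ := hG.κ_pos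
  have hΓ := Real.Gamma_pos_of_pos hσ
  have hQm := hG.meas_Q
  have hek := hG.isPositiveWeight hQ ht
  set k : K → ℝ := fun z => t ^ (-r) * Real.exp (-(κ * Q z / t)) with hk
  have hkm : Measurable k := hek.meas_kernel
  have hk0 : ∀ z, 0 ≤ k z := hek.kernel_nonneg
  have e1 : ∀ᵐ z ∂P.haar, ENNReal.ofReal (k (z - y) * (κ * Q z) ^ (-(r / 2))) =
      ENNReal.ofReal (Real.Gamma (r / 2))⁻¹ * ∫⁻ c in Ioi (0 : ℝ),
        ENNReal.ofReal (c ^ (r / 2 - 1) * (k (z - y) * Real.exp (-(c * (κ * Q z))))) := by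
    filter_upwards [hG.Q_pos] with z hz
    have hq : 0 < κ * Q z := mul_pos hκ hz
    have h1 := integrableOn_rpow_mul_exp_neg hσ hq
    have h2 := integral_rpow_mul_exp_neg hσ hq
    have h3 : ∀ c : ℝ, c ^ (r / 2 - 1) * (k (z - y) * Real.exp (-(c * (κ * Q z)))) =
        k (z - y) * (c ^ (r / 2 - 1) * Real.exp (-((κ * Q z) * c))) := fun c => by
      rw [mul_comm c (κ * Q z)]; ring
    simp only [h3]
    rw [← ofReal_integral_eq_lintegral_ofReal (h1.const_mul _), integral_const_mul, h2,
      ← ENNReal.ofReal_mul (by positivity)]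
    · congr 1
      field_simp
    · filter_upwards [ae_restrict_mem measurableSet_Ioi] with c (hc : 0 < c)
      have := hk0 (z - y)
      simp only [Pi.zero_apply]
      positivity
  rw [lintegral_congr_ae e1, lintegral_const_mul' _ _ (by simp), lintegral_lintegral_swap]
  · have e2 : ∀ c ∈ Ioi (0 : ℝ), ∫⁻ z, ENNReal.ofReal (c ^ (r / 2 - 1) * (k (z - y) *
        Real.exp (-(c * (κ * Q z))))) ∂P.haar = ENNReal.ofReal (c ^ (r / 2 - 1) *
          ((1 + c * t) ^ (-(2 * (r / 2))) * Real.exp (-(c * (κ * Q y) / (1 + c * t))))) := by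
      intro c (hc : 0 < c)
      rw [show 2 * (r / 2) = r by ring, ← hG.integral_kernel_mul_gaussian hP hQ ht hc,
        ← integral_const_mul, ofReal_integral_eq_lintegral_ofReal]
      · refine Integrable.const_mul ?_ _
        have hec := (hG.isPositiveWeight hQ hc).integrable
        refine hec.bdd_mul (c := t ^ (-r)) (by fun_prop : Measurable _).aestronglyMeasurable
          (ae_of_all _ fun z => ?_)
        rw [Real.norm_of_nonneg (hk0 (z - y))]
        refine mul_le_of_le_one_right (by positivity) (Real.exp_le_one_iff.2 (neg_nonpos.2 ?_))
        have := hG.Q_nonneg (z - y)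
        positivity
      · exact ae_of_all _ fun z => by positivity
    rw [setLIntegral_congr_fun measurableSet_Ioi e2]
    obtain ⟨i3, h3⟩ := integral_schurProfile_scale hσ ht (mul_pos hκ hy)
    rw [← ofReal_integral_eq_lintegral_ofReal i3, h3, ← ENNReal.ofReal_mul (by positivity)]
    · congr 1
      field_simp
    · filter_upwards [ae_restrict_mem measurableSet_Ioi] with c (hc : 0 < c)
      simp only [Pi.zero_apply]
      positivity
  · exact (by fun_prop : Measurable fun p : K × ℝ => ENNReal.ofReal (p.2 ^ (r / 2 - 1) *
      (k (p.1 - y) * Real.exp (-(p.2 * (κ * Q p.1)))))).aemeasurable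

/-- With this weight `∫ (e^{-t} - ρ_t) dt/t = 2ψ(r/2) - log(κQ)`. Multiplied by `r`, its logarithm
cancels `log|y| = r log(κQ) - r log κ`, so the effective potential is constant. -/
theorem conductorBoundedBelowBy [MeasurableMul₂ K] [MeasurableNeg K] [MeasurableSub₂ K]
    [SFinite P.haar] [P.haar.IsNegInvariant]
    (hG : IsGaussianFamily P Q (fun _ => 1) (fun _ => 1) 0 r κ 1) (hP : IsUnitaryCharacter P)
    (hQ : ∀ y, Q (-y) = Q y) {S : Set (K → ℂ)} (hS : IsPlancherelClass P S) :
    ConductorBoundedBelowBy P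
      (2 * r * ((Complex.digamma ((r / 2 : ℝ) : ℂ)).re - Real.log κ)) := by
  have hr := hG.r_pos
  have hσ : 0 < r / 2 := half_pos hr
  have hκ := hG.κ_pos
  have hQm := hG.meas_Q
  have hlog : ∀ᵐ y ∂P.haar, Real.log (P.abs y) = r * Real.log (κ * Q y) - r * Real.log κ := by
    filter_upwards [hG.Q_pos] with y hy
    rw [hG.abs_eq, Real.log_rpow hy, Real.log_mul hκ.ne' hy.ne']
    ring
  have hlogq : ∀ᵐ y ∂P.haar, |Real.log (κ * Q y)| ≤ r⁻¹ * |Real.log (P.abs y)| + |Real.log κ| := by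
    filter_upwards [hlog] with y hy
    have h1 : Real.log (κ * Q y) = r⁻¹ * Real.log (P.abs y) + Real.log κ := by
      rw [hy]; field_simp; ring
    rw [h1]
    refine (abs_add_le _ _).trans (le_of_eq ?_)
    rw [abs_mul, abs_of_pos (inv_pos.2 hr)]
  set M := ∫ t in Ioi (0 : ℝ), |(Real.exp (-t) - schurProfile (r / 2) t) / t| with hM
  have hM0 : 0 ≤ M := integral_nonneg fun _ => abs_nonneg _
  have hri : 0 < r⁻¹ := inv_pos.2 hr
  have hbound : ∀ N : ℝ, 0 ≤ N → ∀ᵐ y ∂P.haar, N + |Real.log (κ * Q y)| ≤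
      (N + |Real.log κ| + r⁻¹) * (1 + |Real.log (P.abs y)|) := by
    intro N hN
    filter_upwards [hlogq] with y hy
    have h0 := abs_nonneg (Real.log (P.abs y))
    have h1 := abs_nonneg (Real.log κ)
    nlinarith [mul_nonneg hN h0, mul_nonneg h1 h0]
  refine conductorBoundedBelowBy_of_kernel hP hS (c := fun t => Real.exp (-t)) (by fun_prop)
    (e := fun t y => Real.exp (-(t * (κ * Q y))))
    (k := fun t y => t ^ (-r) * Real.exp (-(κ * Q y / t)))
    -- The case distinction makes `ρ` nonnegative at every `y`, not only almost everywhere.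
    (ρ := fun t y => if 0 < Q y then schurProfile (r / 2) (t / (κ * Q y)) else 0)
    (w := fun y => (κ * Q y) ^ (-(r / 2))) (c₀ := -(r * Real.log κ)) hr.le
    (fun t ht => hG.isPositiveWeight hQ ht) (by fun_prop) ?_ ?_ ?_
    (C := 0 + |Real.log κ| + r⁻¹) (C' := M + |Real.log κ| + r⁻¹) ⟨by fun_prop, ?_, ?_⟩
    ⟨?_, ?_, ?_⟩ ?_ ?_
  · filter_upwards [hG.Q_pos] with y hy
    positivity
  · intro t y ht
    split_ifs with hy
    · exact schurProfile_nonneg hσ (by positivity)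
    · exact le_rfl
  · intro t ht
    filter_upwards [hG.Q_pos] with y hy
    rw [if_pos hy]
    exact (hG.lintegral_kernel_mul_rpow hP hQ ht hy).le
  · filter_upwards [hG.Q_pos] with y hy
    exact integrableOn_exp_neg_sub_div (mul_pos hκ hy)
  · filter_upwards [hG.Q_pos, hbound 0 le_rfl] with y hy hb
    rw [integral_abs_exp_neg_sub_div (mul_pos hκ hy)]
    rwa [zero_add] at hb
  · have := measurable_schurProfile (r / 2)
    refine Measurable.ite (measurableSet_lt measurable_const (by fun_prop)) (by fun_prop)
      measurable_const
  · filter_upwards [hG.Q_pos] with y hy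
    simp only [if_pos hy]
    exact (integral_exp_neg_sub_schurProfile_scale hσ (mul_pos hκ hy)).1
  · filter_upwards [hG.Q_pos, hbound M hM0] with y hy hb
    simp only [if_pos hy]
    exact (integral_exp_neg_sub_schurProfile_scale hσ (mul_pos hκ hy)).2.2.trans hb
  · filter_upwards [hG.Q_pos, hlog] with y hy hl
    rw [hl, integral_exp_neg_sub_div (mul_pos hκ hy), sub_eq_add_neg]
  · filter_upwards [hG.Q_pos, hlog] with y hy hl
    simp only [if_pos hy]
    rw [hl, (integral_exp_neg_sub_schurProfile_scale hσ (mul_pos hκ hy)).2.1]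
    refine le_of_eq ?_
    ring

end IsGaussianFamily


/-! ### Schwartz functions and the archimedean lower bounds -/

section Schwartz

open scoped SchwartzMap FourierTransform

variable {E : Type*} [NormedAddCommGroup E] [NormedSpace ℝ E] [FiniteDimensional ℝ E]
  [MeasurableSpace E] [BorelSpace E]

theorem exists_schwartzMap_eLpNorm_sub_le {μ : Measure E} [μ.IsAddHaarMeasure] {f : E → ℂ}
    (hf : MemLp f 2 μ) {ε : ℝ} (hε : 0 < ε) :
    ∃ φ : 𝓢(E, ℂ), eLpNorm (f - (φ : E → ℂ)) 2 μ ≤ ENNReal.ofReal ε := by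
  obtain ⟨g, h1, h2, h3⟩ := MemLp.exist_eLpNorm_sub_le (p := 2) (by simp) (by norm_num) hf hε
  exact ⟨h1.toSchwartzMap h2, h3⟩

theorem SchwartzMap.fourierInv_fourierInv {V : Type*} [NormedAddCommGroup V] [InnerProductSpace ℝ V]
    [FiniteDimensional ℝ V] [MeasurableSpace V] [BorelSpace V] (φ : 𝓢(V, ℂ)) (y : V) :
    𝓕⁻ (𝓕⁻ (φ : V → ℂ)) y = φ (-y) := by
  rw [Real.fourierInv_eq_fourier_neg, ← SchwartzMap.fourierInv_coe, ← SchwartzMap.fourier_coe,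
    FourierTransform.fourier_fourierInv_eq]

theorem realPlace_fourier_eq (φ : ℝ → ℂ) : fourierIntegralAt realPlace φ = 𝓕⁻ φ := by
  funext x
  rw [Real.fourierInv_eq', fourierIntegralAt]
  refine integral_congr_ae (ae_of_all _ fun y => ?_)
  simp only [realPlace, smul_eq_mul]
  rw [mul_comm]
  congr 2
  simp only [RCLike.inner_apply, conj_trivial]
  push_cast; ring

theorem isPlancherelClass_realPlace :
    IsPlancherelClass realPlace (range fun φ : 𝓢(ℝ, ℂ) => (φ : ℝ → ℂ)) where
  integrable := by
    rintro _ ⟨φ, rfl⟩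
    exact φ.integrable (μ := volume)
  memLp := by
    rintro _ ⟨φ, rfl⟩
    exact φ.memLp 2 volume
  neg_mem := by
    rintro _ ⟨φ, rfl⟩
    exact ⟨SchwartzMap.compCLMOfContinuousLinearEquiv ℂ (ContinuousLinearEquiv.neg ℝ) φ, rfl⟩
  integrable_fourier := by
    rintro _ ⟨φ, rfl⟩
    rw [realPlace_fourier_eq, ← SchwartzMap.fourierInv_coe]
    exact (𝓕⁻ φ).integrable (μ := volume)
  inversion := by
    rintro _ ⟨φ, rfl⟩ y
    rw [realPlace_fourier_eq, realPlace_fourier_eq, SchwartzMap.fourierInv_fourierInv]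
  dense f hf ε hε := by
    obtain ⟨φ, hφ⟩ := exists_schwartzMap_eLpNorm_sub_le (μ := (volume : Measure ℝ)) hf hε
    exact ⟨φ, ⟨φ, rfl⟩, hφ⟩

theorem isUnitaryCharacter_realPlace : IsUnitaryCharacter realPlace where
  meas := measurable_realPlace_char
  norm_eq := norm_realPlace_char
  map_add x y := by
    simp only [realPlace]
    rw [← Complex.exp_add]
    congr 1; push_cast; ring

theorem conductorBoundedBelowBy_realPlace : ConductorBoundedBelowBy realPlace
    (-(Real.log (8 * Real.pi) + Real.eulerMascheroniConstant) - Real.pi / 2) := by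
  have : SFinite realPlace.haar := inferInstanceAs (SFinite (volume : Measure ℝ))
  have : realPlace.haar.IsNegInvariant := inferInstanceAs (volume : Measure ℝ).IsNegInvariant
  have h := isGaussianFamily_realPlace_even.conductorBoundedBelowBy isUnitaryCharacter_realPlace
    (fun y => neg_sq y) isPlancherelClass_realPlace
  convert h using 1
  have e := hPlus_half
  rw [hPlus_eq (by norm_num), localSpectral_one_half, zero_add] at e
  have e' := congrArg Complex.re e
  rw [Complex.ofReal_re] at e'
  rw [← e']
  norm_num

/-- The map `x ↦ 2 conj x` of `ℂ`. -/
noncomputable def conjDouble : ℂ ≃L[ℝ] ℂ :=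
  Complex.conjCLE.trans (ContinuousLinearEquiv.smulLeft (Units.mk0 (2 : ℝ) two_ne_zero))

theorem conjDouble_apply (x : ℂ) : conjDouble x = 2 * (starRingEnd ℂ) x := by
  simp [conjDouble, Units.smul_def]

/-- The exponent `2 Re(xy)` is the real inner product of `y` with `2x̄`, and the measure contributes
the factor `2`. -/
theorem complexPlace_fourier_eq (φ : ℂ → ℂ) (x : ℂ) :
    fourierIntegralAt complexPlace φ x = 2 * 𝓕⁻ φ (conjDouble x) := by
  rw [Real.fourierInv_eq', fourierIntegralAt]
  simp only [complexPlace]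
  rw [integral_smul_measure]
  simp only [ENNReal.toReal_ofNat, smul_eq_mul, Complex.real_smul, Complex.ofReal_ofNat]
  congr 1
  refine integral_congr_ae (ae_of_all _ fun y => ?_)
  simp only []
  rw [mul_comm (φ y)]
  congr 2
  rw [Complex.inner, conjDouble_apply]
  simp
  ring

theorem integral_comp_conjDouble (g : ℂ → ℂ) : ∫ x, g (conjDouble x) = 4⁻¹ * ∫ x, g x := by
  have h1 : ∫ x : ℂ, g (conjDouble x) = ∫ x : ℂ, g ((2 : ℝ) • x) := by
    have := (Complex.conjLIE.measurePreserving).integral_comp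
      Complex.conjLIE.toHomeomorph.measurableEmbedding (fun x => g ((2 : ℝ) • x))
    rw [← this]
    refine integral_congr_ae (ae_of_all _ fun x => ?_)
    simp [conjDouble_apply]
  rw [h1, Measure.integral_comp_smul]
  simp [Complex.finrank_real_complex]
  norm_num

/-- `conjDouble` is symmetric for the real inner product and has Jacobian `4`. In the double
transform this `4⁻¹` cancels the two factors `2` of the measure, which makes twice Lebesgue measure
self-dual. -/
theorem fourierInv_comp_conjDouble (g : ℂ → ℂ) (y : ℂ) :
    𝓕⁻ (fun x => g (conjDouble x)) (conjDouble y) = 4⁻¹ * 𝓕⁻ g y := by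
  rw [Real.fourierInv_eq', Real.fourierInv_eq', ← integral_comp_conjDouble]
  refine integral_congr_ae (ae_of_all _ fun x => ?_)
  simp only []
  congr 5
  rw [Complex.inner, Complex.inner, conjDouble_apply, conjDouble_apply]
  simp
  ring

instance isAddHaarMeasure_complexPlace : complexPlace.haar.IsAddHaarMeasure :=
  Measure.IsAddHaarMeasure.smul volume two_ne_zero ENNReal.ofNat_ne_top

theorem isPlancherelClass_complexPlace :
    IsPlancherelClass complexPlace (range fun φ : 𝓢(ℂ, ℂ) => (φ : ℂ → ℂ)) where
  integrable := by
    rintro _ ⟨φ, rfl⟩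
    exact φ.integrable
  memLp := by
    rintro _ ⟨φ, rfl⟩
    exact φ.memLp 2 _
  neg_mem := by
    rintro _ ⟨φ, rfl⟩
    exact ⟨SchwartzMap.compCLMOfContinuousLinearEquiv ℂ (ContinuousLinearEquiv.neg ℝ) φ, rfl⟩
  integrable_fourier := by
    rintro _ ⟨φ, rfl⟩
    have e : fourierIntegralAt complexPlace φ = fun x =>
        2 * (SchwartzMap.compCLMOfContinuousLinearEquiv ℂ conjDouble (𝓕⁻ φ)) x := by
      funext x
      rw [complexPlace_fourier_eq, ← SchwartzMap.fourierInv_coe]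
      rfl
    rw [e]
    exact (SchwartzMap.integrable _).const_mul 2
  inversion := by
    rintro _ ⟨φ, rfl⟩ y
    have e : fourierIntegralAt complexPlace φ = fun x => 2 * 𝓕⁻ (φ : ℂ → ℂ) (conjDouble x) :=
      funext fun x => complexPlace_fourier_eq _ x
    dsimp only
    rw [e, fourierIntegralAt_const_mul, complexPlace_fourier_eq, fourierInv_comp_conjDouble,
      SchwartzMap.fourierInv_fourierInv]
    ring
  dense f hf ε hε := by
    obtain ⟨φ, hφ⟩ := exists_schwartzMap_eLpNorm_sub_le hf hε
    exact ⟨φ, ⟨φ, rfl⟩, hφ⟩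

theorem isUnitaryCharacter_complexPlace : IsUnitaryCharacter complexPlace where
  meas := measurable_complexPlace_char
  norm_eq := norm_complexPlace_char
  map_add x y := by
    simp only [complexPlace]
    rw [← Complex.exp_add]
    congr 1; simp only [Complex.add_re]; push_cast; ring

theorem conductorBoundedBelowBy_complexPlace : ConductorBoundedBelowBy complexPlace
    (-2 * (Real.log (8 * Real.pi) + Real.eulerMascheroniConstant)) := by
  have : SFinite complexPlace.haar := inferInstanceAs (SFinite ((2 : ENNReal) • (volume : Measure ℂ)))
  have hG : IsGaussianFamily complexPlace Complex.normSq (fun _ => 1) (fun _ => 1) 0 1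
      (2 * Real.pi) 1 := by
    have := isGaussianFamily_complexPlace (p := fun _ => 1) (p' := fun _ => 1) 0 measurable_const
      measurable_const (by simp) (by simp) fun c hc ζ => by
        simpa using complexPlace_fourier_pow hc 0 ζ
    simpa using this
  have h := hG.conductorBoundedBelowBy isUnitaryCharacter_complexPlace Complex.normSq_neg
    isPlancherelClass_complexPlace
  convert h using 1
  have e := hComplex_half_even 0 0 rfl
  rw [hComplex_eq 0 (by norm_num), localSpectral_one_half] at e
  have e' := congrArg Complex.re e
  rw [Complex.ofReal_re] at e'
  simp only [Int.natAbs_zero, Nat.cast_zero, zero_add] at e'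
  rw [Finset.Icc_eq_empty (by norm_num), Finset.sum_empty, mul_zero, add_zero] at e'
  rw [← e']
  norm_num

end Schwartz


/-! ### Balls, dual balls and Haar measure in an ultrametric field -/

section Ultrametric

open scoped Pointwise

variable {K : Type*} [NormedField K] [IsUltrametricDist K]

theorem ultrametric_norm_add_le {x y : K} {t : ℝ} (hx : ‖x‖ ≤ t) (hy : ‖y‖ ≤ t) : ‖x + y‖ ≤ t :=
  (IsUltrametricDist.norm_add_le_max x y).trans (max_le hx hy)

theorem ultrametric_norm_sub_le {x y : K} {t : ℝ} (hx : ‖x‖ ≤ t) (hy : ‖y‖ ≤ t) : ‖x - y‖ ≤ t := by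
  rw [sub_eq_add_neg]
  exact ultrametric_norm_add_le hx (by rwa [norm_neg])

theorem norm_eq_of_norm_sub_lt {y z : K} (h : ‖z - y‖ < ‖y‖) : ‖z‖ = ‖y‖ := by
  have := IsUltrametricDist.norm_add_eq_max_of_norm_ne_norm h.ne
  rwa [sub_add_cancel, max_eq_right h.le] at this

variable [ProperSpace K] [MeasurableSpace K] [BorelSpace K]

section Scaling

variable (μ : Measure K) [μ.IsAddHaarMeasure]

/-- Multiplication by `ϖ` with `‖ϖ‖ < 1` contracts the Haar measure by a factor `q < 1`. -/
theorem exists_haar_contraction {ϖ : K} (h0 : ϖ ≠ 0) (h1 : ‖ϖ‖ < 1) :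
    ∃ q : ℝ, 0 < q ∧ q < 1 ∧ μ univ = ⊤ ∧
      ∀ (t : ℝ) (n : ℕ), μ.real (Metric.closedBall 0 (‖ϖ‖ ^ n * t)) = q ^ n * μ.real (Metric.closedBall 0 t) := by
  have hϖ : 0 < ‖ϖ‖ := norm_pos_iff.2 h0
  set u : Kˣ := Units.mk0 ϖ h0 with hu
  set q : NNReal := distribHaarChar K u with hq
  have hq0 : 0 < q := distribHaarChar_pos
  have hball : ∀ t : ℝ, u • Metric.closedBall (0 : K) t = Metric.closedBall 0 (‖ϖ‖ * t) := by
    intro t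
    ext x
    rw [mem_smul_set_iff_inv_smul_mem, mem_closedBall_zero_iff, mem_closedBall_zero_iff,
      Units.smul_def, smul_eq_mul, norm_mul]
    simp only [hu, Units.val_inv_eq_inv_val, Units.val_mk0, norm_inv]
    rw [inv_mul_le_iff₀ hϖ]
  have hs : ∀ t : ℝ, μ.real (Metric.closedBall 0 (‖ϖ‖ * t)) = q * μ.real (Metric.closedBall 0 t) := by
    intro t
    rw [← hball, measureReal_def, ← distribHaarChar_mul μ u, ENNReal.toReal_mul]
    rfl
  -- The set `‖ϖ‖ < ‖x‖ ≤ 1` is open and contains `1`, so it has positive measure.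
  have hlt : (q : ℝ) < 1 := by
    have hsub : Metric.closedBall (0 : K) ‖ϖ‖ ⊆ Metric.closedBall 0 1 :=
      Metric.closedBall_subset_closedBall h1.le
    have hopen : IsOpen (Metric.closedBall (0 : K) 1 \ Metric.closedBall 0 ‖ϖ‖) :=
      (IsUltrametricDist.isOpen_closedBall _ one_ne_zero).sdiff Metric.isClosed_closedBall
    have hpos := hopen.measure_pos μ ⟨1, by simp [h1]⟩
    have hfin : μ (Metric.closedBall (0 : K) 1) ≠ ⊤ := (isCompact_closedBall 0 1).measure_lt_top.ne
    have h2 : 0 < μ.real (Metric.closedBall (0 : K) 1 \ Metric.closedBall 0 ‖ϖ‖) :=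
      ENNReal.toReal_pos hpos.ne' (ne_top_of_le_ne_top hfin (measure_mono sdiff_subset))
    rw [measureReal_sdiff hsub measurableSet_closedBall] at h2
    have h3 := hs 1
    rw [mul_one] at h3
    have h4 : 0 < μ.real (Metric.closedBall (0 : K) 1) := by
      have : 0 ≤ μ.real (Metric.closedBall (0 : K) ‖ϖ‖) := measureReal_nonneg
      linarith
    rw [h3] at h2
    by_contra! hge
    nlinarith
  refine ⟨q, hq0, hlt, ?_, fun t n => ?_⟩
  -- Multiplication by `ϖ` preserves the whole space; a finite total mass would have to equal `q <
  -- 1` times itself.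
  · by_contra hfin
    have h5 := distribHaarChar_mul μ u univ
    rw [smul_set_univ] at h5
    have h6 := congrArg ENNReal.toReal h5
    rw [ENNReal.toReal_mul] at h6
    have h7 : 0 < (μ univ).toReal :=
      ENNReal.toReal_pos (isOpen_univ.measure_pos μ univ_nonempty).ne' hfin
    have h8 : (q : ℝ) * (μ univ).toReal = (μ univ).toReal := h6
    nlinarith
  · induction n with
    | zero => simp
    | succ n ih => rw [pow_succ', mul_assoc, hs, ih, pow_succ', mul_assoc]

theorem measureReal_closedBall_pos {t : ℝ} (ht : 0 < t) : 0 < μ.real (Metric.closedBall (0 : K) t) :=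
  ENNReal.toReal_pos (Metric.measure_closedBall_pos μ 0 ht).ne'
    (isCompact_closedBall 0 t).measure_lt_top.ne

/-- The ball is cut into shells `a^{n+1} R < ‖z‖ ≤ a^n R`; on each the integrand is at most its
value at the inner radius, and the shell is enlarged to its ball. The sum is geometric with ratio
`a^{-η} q`. -/
theorem lintegral_closedBall_norm_rpow_le {a q η : ℝ} (ha : 0 < a) (ha1 : a < 1) (hq : 0 < q)
    (hη : 0 < η) (hqη : a ^ (-η) * q < 1)
    (hscale : ∀ (t : ℝ) (n : ℕ), μ.real (Metric.closedBall (0 : K) (a ^ n * t)) =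
      q ^ n * μ.real (Metric.closedBall (0 : K) t)) (hμ0 : μ {(0 : K)} = 0) {R : ℝ} (hR : 0 < R) :
    ∫⁻ z in Metric.closedBall (0 : K) R, ENNReal.ofReal (‖z‖ ^ (-η)) ∂μ ≤
      ENNReal.ofReal (a ^ (-η) / (1 - a ^ (-η) * q) * (R ^ (-η) * μ.real (Metric.closedBall (0 : K) R))) := by
  set V := μ.real (Metric.closedBall (0 : K) R) with hV
  have hV0 : 0 ≤ V := measureReal_nonneg
  have hb : 0 < a ^ (-η) := Real.rpow_pos_of_pos ha _
  have hpt : ∀ᵐ z ∂μ, z ∈ Metric.closedBall (0 : K) R → ENNReal.ofReal (‖z‖ ^ (-η)) ≤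
      ∑' n : ℕ, (Metric.closedBall (0 : K) (a ^ n * R)).indicator
        (fun _ => ENNReal.ofReal ((a ^ (n + 1) * R) ^ (-η))) z := by
    filter_upwards [compl_mem_ae_iff.2 hμ0] with z hz hzR
    have hz0 : 0 < ‖z‖ := norm_pos_iff.2 hz
    rw [mem_closedBall_zero_iff] at hzR
    obtain ⟨n, h1, h2⟩ := exists_nat_pow_near_of_lt_one (div_pos hz0 hR) ((div_le_one hR).2 hzR) ha ha1
    rw [lt_div_iff₀ hR] at h1
    rw [div_le_iff₀ hR] at h2
    refine le_trans ?_ (ENNReal.le_tsum n)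
    rw [indicator_of_mem (by rwa [mem_closedBall_zero_iff])]
    exact ENNReal.ofReal_le_ofReal
      (Real.rpow_le_rpow_of_nonpos (by positivity) h1.le (neg_nonpos.2 hη.le))
  refine (setLIntegral_mono_ae' measurableSet_closedBall hpt).trans ?_
  refine (setLIntegral_le_lintegral _ _).trans ?_
  rw [lintegral_tsum fun n => (measurable_const.indicator measurableSet_closedBall).aemeasurable]
  have hterm : ∀ n : ℕ, ∫⁻ z, (Metric.closedBall (0 : K) (a ^ n * R)).indicator
      (fun _ => ENNReal.ofReal ((a ^ (n + 1) * R) ^ (-η))) z ∂μ =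
      ENNReal.ofReal (a ^ (-η) * (R ^ (-η) * V) * (a ^ (-η) * q) ^ n) := by
    intro n
    rw [lintegral_indicator_const measurableSet_closedBall,
      ← ENNReal.ofReal_toReal (isCompact_closedBall (0 : K) (a ^ n * R)).measure_lt_top.ne,
      ← measureReal_def, hscale, ← ENNReal.ofReal_mul (by positivity)]
    congr 1
    rw [Real.mul_rpow (by positivity) hR.le, ← Real.rpow_natCast a (n + 1), ← Real.rpow_mul ha.le,
      mul_comm _ (-η), Real.rpow_mul ha.le, Real.rpow_natCast, pow_succ, mul_pow]
    ring
  simp only [hterm]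
  have h0 : 0 ≤ a ^ (-η) * q := by positivity
  rw [← ENNReal.ofReal_tsum_of_nonneg (fun n => by positivity)
    ((summable_geometric_of_lt_one h0 hqη).mul_left _), tsum_mul_left,
    tsum_geometric_of_lt_one h0 hqη]
  refine ENNReal.ofReal_le_ofReal (le_of_eq ?_)
  rw [div_eq_mul_inv]; ring

end Scaling

/-- The data of a place whose absolute value is ultrametric, with Fourier inversion. -/
structure IsUltrametricPlace (P : LocalPlace K) (ϖ : K) (r C : ℝ) : Prop where
  unitary : IsUnitaryCharacter P
  exists_trivial : ∃ s : ℝ, 0 < s ∧ ∀ x, ‖x‖ ≤ s → P.char x = 1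
  ne_zero : ϖ ≠ 0
  norm_lt_one : ‖ϖ‖ < 1
  r_pos : 0 < r
  abs_log_le : ∀ y ≠ 0, |Real.log (P.abs y) - r * Real.log ‖y‖| ≤ C
  inversion : ∀ φ : K → ℂ, IsLocallyConstant φ → HasCompactSupport φ → ∀ y,
    fourierIntegralAt P (fourierIntegralAt P φ) y = φ (-y)

variable {P : LocalPlace K}

/-- Translation by the period multiplies the Fourier integral by a number different from `1`. -/
theorem fourierIntegralAt_eq_zero_of_periodic [P.haar.IsAddHaarMeasure] (hP : IsUnitaryCharacter P)
    {φ : K → ℂ} {h x : K} (hφ : ∀ y, φ (y + h) = φ y) (hx : P.char (x * h) ≠ 1) :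
    fourierIntegralAt P φ x = 0 := by
  have e := integral_add_right_eq_self (μ := P.haar) (fun y => φ y * P.char (-(x * y))) h
  have e1 : ∀ y, φ (y + h) * P.char (-(x * (y + h))) =
      P.char (-(x * h)) * (φ y * P.char (-(x * y))) := by
    intro y
    rw [hφ, mul_add, neg_add, hP.map_add]; ring
  simp only [e1] at e
  rw [integral_const_mul] at e
  change P.char (-(x * h)) * fourierIntegralAt P φ x = fourierIntegralAt P φ x at e
  by_contra h0
  refine hx ?_
  have h1 : P.char (-(x * h)) = 1 := (mul_eq_right₀ h0).1 e
  rw [← neg_neg (x * h), ← hP.conj, h1, _root_.map_one]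

/-- The elements orthogonal to the ball of radius `t`. -/
def dualBall (P : LocalPlace K) (t : ℝ) : Set K := {x | ∀ y, ‖y‖ ≤ t → P.char (x * y) = 1}

namespace IsUltrametricPlace

variable {ϖ : K} {r C : ℝ}

theorem char_add_of_trivial (hP : IsUnitaryCharacter P) {x h : K} (hh : P.char h = 1) :
    P.char (x + h) = P.char x := by rw [hP.map_add, hh, mul_one]

theorem continuous_char (h : IsUltrametricPlace P ϖ r C) : Continuous P.char := by
  obtain ⟨s, hs, hs1⟩ := h.exists_trivial
  refine IsLocallyConstant.continuous ((IsLocallyConstant.iff_eventually_eq _).2 fun x => ?_)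
  filter_upwards [Metric.closedBall_mem_nhds x hs] with y hy
  rw [← char_add_of_trivial h.unitary (x := x) (hs1 (y - x) (by rwa [← dist_eq_norm])),
    add_sub_cancel]

theorem isClosed_dualBall (h : IsUltrametricPlace P ϖ r C) (t : ℝ) : IsClosed (dualBall P t) := by
  have hc := h.continuous_char
  simp only [dualBall, ofPred_forall]
  refine isClosed_iInter fun y => isClosed_iInter fun _ => ?_
  exact isClosed_eq (by fun_prop) continuous_const

theorem neg_mem_dualBall {t : ℝ} {x : K} :
    -x ∈ dualBall P t ↔ x ∈ dualBall P t := by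
  have key : ∀ x, x ∈ dualBall P t → -x ∈ dualBall P t := by
    intro x hx y hy
    have := hx (-y) (by rwa [norm_neg])
    rwa [neg_mul, ← mul_neg]
  exact ⟨fun hx => by simpa using key _ hx, key x⟩

theorem isLocallyConstant_indicator {t : ℝ} (ht : 0 < t) :
    IsLocallyConstant ((Metric.closedBall (0 : K) t).indicator fun _ => (1 : ℂ)) := by
  have hb := IsUltrametricDist.isClopen_closedBall (0 : K) ht.ne'
  refine (IsLocallyConstant.iff_eventually_eq _).2 fun x => ?_
  by_cases hx : x ∈ Metric.closedBall (0 : K) t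
  · filter_upwards [hb.isOpen.mem_nhds hx] with y hy
    rw [indicator_of_mem hx, indicator_of_mem hy]
  · filter_upwards [hb.compl.isOpen.mem_nhds hx] with y hy
    rw [indicator_of_notMem hx, indicator_of_notMem hy]

theorem hasCompactSupport_indicator (t : ℝ) :
    HasCompactSupport ((Metric.closedBall (0 : K) t).indicator fun _ => (1 : ℂ)) :=
  HasCompactSupport.intro (isCompact_closedBall 0 t) fun _ hx => indicator_of_notMem hx _

theorem fourier_indicator [P.haar.IsAddHaarMeasure] (h : IsUltrametricPlace P ϖ r C) (t : ℝ) (x : K) :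
    fourierIntegralAt P ((Metric.closedBall (0 : K) t).indicator fun _ => (1 : ℂ)) x =
      ((dualBall P t).indicator (fun _ => P.haar.real (Metric.closedBall (0 : K) t)) x : ℝ) := by
  by_cases hx : x ∈ dualBall P t
  · rw [indicator_of_mem hx, fourierIntegralAt]
    have e : ∀ y, (Metric.closedBall (0 : K) t).indicator (fun _ => (1 : ℂ)) y * P.char (-(x * y)) =
        (Metric.closedBall (0 : K) t).indicator (fun _ => (1 : ℂ)) y := by
      intro y
      by_cases hy : y ∈ Metric.closedBall (0 : K) t
      · rw [← mul_neg, hx (-y) (by simpa using hy), mul_one]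
      · rw [indicator_of_notMem hy, zero_mul]
    simp only [e]
    rw [integral_indicator measurableSet_closedBall]
    simp
  · rw [indicator_of_notMem hx, Complex.ofReal_zero]
    simp only [dualBall, mem_ofPred_eq, not_forall] at hx
    obtain ⟨y, hy, hxy⟩ := hx
    refine fourierIntegralAt_eq_zero_of_periodic h.unitary (h := y) (fun z => ?_) hxy
    have hiff : z + y ∈ Metric.closedBall (0 : K) t ↔ z ∈ Metric.closedBall (0 : K) t := by
      simp only [mem_closedBall_zero_iff]
      exact ⟨fun hz => by simpa using ultrametric_norm_sub_le hz hy, fun hz => ultrametric_norm_add_le hz hy⟩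
    by_cases hz : z ∈ Metric.closedBall (0 : K) t
    · rw [indicator_of_mem hz, indicator_of_mem (hiff.2 hz)]
    · rw [indicator_of_notMem hz, indicator_of_notMem (mt hiff.1 hz)]

/-- Fourier inversion at `0` for the indicator of the ball. It says that the kernel attached to the
ball has total mass `1`. -/
theorem haar_real_mul_dualBall [P.haar.IsAddHaarMeasure] (h : IsUltrametricPlace P ϖ r C) {t : ℝ} (ht : 0 < t) :
    P.haar.real (Metric.closedBall (0 : K) t) * P.haar.real (dualBall P t) = 1 := by
  have e := h.inversion _ (isLocallyConstant_indicator ht) (hasCompactSupport_indicator t) 0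
  rw [neg_zero, indicator_of_mem (by simpa using ht.le), fourierIntegralAt] at e
  simp only [h.fourier_indicator, zero_mul, neg_zero, h.unitary.map_zero, mul_one] at e
  rw [integral_complex_ofReal, integral_indicator (h.isClosed_dualBall t).measurableSet] at e
  simp only [setIntegral_const, smul_eq_mul] at e
  rw [mul_comm]
  exact_mod_cast e

theorem exists_char_ne_one [P.haar.IsAddHaarMeasure] (h : IsUltrametricPlace P ϖ r C) :
    ∃ x, P.char x ≠ 1 := by
  by_contra! hall
  have e := h.haar_real_mul_dualBall one_pos
  -- A trivial character would make the dual ball everything; its infinite measure has real value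
  -- `0`, which contradicts the product being `1`.
  have : dualBall P 1 = univ := eq_univ_of_forall fun x y _ => hall _
  obtain ⟨q, -, -, hu, -⟩ := exists_haar_contraction P.haar h.ne_zero h.norm_lt_one
  rw [this, measureReal_def _ univ, hu] at e
  simp at e

/-- Take `τ = ‖x₀‖` with the character nontrivial at `x₀`. If `‖x‖ > τ/t`, then `x₀ = x · (x₀/x)`
with `‖x₀/x‖ < t`, so `x` is not in the dual ball. -/
theorem exists_dualBall_subset [P.haar.IsAddHaarMeasure] (h : IsUltrametricPlace P ϖ r C) :
    ∃ τ : ℝ, 0 < τ ∧ ∀ t, 0 < t → ∀ x ∈ dualBall P t, ‖x‖ ≤ τ / t := by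
  obtain ⟨x₀, hx₀⟩ := h.exists_char_ne_one
  have h0 : x₀ ≠ 0 := fun h0 => hx₀ (by rw [h0, h.unitary.map_zero])
  refine ⟨‖x₀‖, norm_pos_iff.2 h0, fun t ht x hx => ?_⟩
  by_contra! hlt
  have hx0 : x ≠ 0 := norm_pos_iff.1 (lt_of_le_of_lt (by positivity) hlt)
  refine hx₀ ?_
  have := hx (x₀ / x) (by
    rw [norm_div, div_le_iff₀ (norm_pos_iff.2 hx0)]
    rw [div_lt_iff₀ ht] at hlt
    linarith)
  rwa [mul_div_cancel₀ _ hx0] at this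

theorem closedBall_subset_dualBall {s : ℝ} (hs : ∀ x, ‖x‖ ≤ s → P.char x = 1) {t : ℝ} (ht : 0 < t) :
    Metric.closedBall (0 : K) (s / t) ⊆ dualBall P t := by
  intro x hx y hy
  rw [mem_closedBall_zero_iff, le_div_iff₀ ht] at hx
  refine hs _ ?_
  rw [norm_mul]
  exact (mul_le_mul_of_nonneg_left hy (norm_nonneg x)).trans hx

theorem isPositiveWeight [P.haar.IsAddHaarMeasure] (h : IsUltrametricPlace P ϖ r C) (t : ℝ) :
    IsPositiveWeight P ((Metric.closedBall (0 : K) t).indicator fun _ => 1)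
      ((dualBall P t).indicator fun _ => P.haar.real (Metric.closedBall (0 : K) t)) where
  meas := measurable_const.indicator measurableSet_closedBall
  nonneg _ := indicator_nonneg (fun _ _ => zero_le_one) _
  le_one _ := indicator_le_self' (fun _ _ => zero_le_one) _
  integrable := (integrable_indicator_iff measurableSet_closedBall).2
    (integrableOn_const (isCompact_closedBall 0 t).measure_lt_top.ne)
  meas_kernel := measurable_const.indicator (h.isClosed_dualBall t).measurableSet
  kernel_nonneg _ := indicator_nonneg (fun _ _ => measureReal_nonneg) _
  kernel_even x := by
    by_cases hx : x ∈ dualBall P t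
    · rw [indicator_of_mem hx, indicator_of_mem (neg_mem_dualBall.2 hx)]
    · rw [indicator_of_notMem hx, indicator_of_notMem (mt neg_mem_dualBall.1 hx)]
  fourier x := by
    rw [← h.fourier_indicator]
    congr 1
    funext y
    by_cases hy : y ∈ Metric.closedBall (0 : K) t <;> simp [hy]

end IsUltrametricPlace
end Ultrametric


/-! ### Locally constant functions of compact support as a Plancherel class -/

section Ultrametric

variable {K : Type*} [NormedField K] [ProperSpace K] [IsUltrametricDist K] [MeasurableSpace K]
  [BorelSpace K] {P : LocalPlace K}

theorem IsLocallyConstant.exists_periodic {φ : K → ℂ} (h : IsLocallyConstant φ)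
    (hc : HasCompactSupport φ) : ∃ δ : ℝ, 0 < δ ∧ ∀ x u : K, ‖u‖ ≤ δ → φ (x + u) = φ x := by
  obtain ⟨δ, hδ, hδ'⟩ := lebesgue_number_lemma_of_metric (c := fun v => φ ⁻¹' {v}) hc.isCompact
    (fun v => h.isOpen_fiber v) (fun x _ => mem_iUnion.2 ⟨φ x, rfl⟩)
  have key : ∀ x ∈ tsupport φ, ∀ u : K, ‖u‖ < δ → φ (x + u) = φ x := by
    intro x hx u hu
    obtain ⟨v, hv⟩ := hδ' x hx
    have h1 : φ x = v := hv (Metric.mem_ball_self hδ)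
    have h2 : φ (x + u) = v := hv (by simpa [Metric.mem_ball, dist_eq_norm] using hu)
    rw [h1, h2]
  refine ⟨δ / 2, half_pos hδ, fun x u hu => ?_⟩
  have hu' : ‖u‖ < δ := by linarith
  by_cases hx : x ∈ tsupport φ
  · exact key x hx u hu'
  by_cases hxu : x + u ∈ tsupport φ
  · have := key _ hxu (-u) (by rwa [norm_neg])
    rw [add_neg_cancel_right] at this
    exact this.symm
  · rw [image_eq_zero_of_notMem_tsupport hx, image_eq_zero_of_notMem_tsupport hxu]

/-- A continuous function of compact support is uniformly close to a locally constant one. -/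
theorem exists_isLocallyConstant_dist_le {g : K → ℂ} (hg : Continuous g) (hc : HasCompactSupport g) :
    ∃ R : ℝ, Function.support g ⊆ Metric.closedBall 0 R ∧ ∀ ε : ℝ, 0 < ε →
      ∃ φ : K → ℂ, IsLocallyConstant φ ∧ HasCompactSupport φ ∧
        (∀ x, dist (g x) (φ x) ≤ ε) ∧ Function.support φ ⊆ Metric.closedBall 0 R := by
  obtain ⟨R, hR⟩ := hc.isCompact.isBounded.subset_closedBall (0 : K)
  have hsupp : Function.support g ⊆ Metric.closedBall 0 (max R 1) :=
    (subset_tsupport g).trans (hR.trans (Metric.closedBall_subset_closedBall (le_max_left _ _)))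
  refine ⟨max R 1, hsupp, fun ε hε => ?_⟩
  obtain ⟨δ₀, hδ₀, hδ'⟩ := Metric.uniformContinuous_iff.1 (hc.uniformContinuous_of_continuous hg) ε hε
  set δ := min δ₀ 1 with hδdef
  have hδ : 0 < δ := lt_min hδ₀ one_pos
  have hδ1 : δ ≤ 1 := min_le_right _ _
  have hδ2 := half_pos hδ
  -- Small closed balls are open subgroups. Sampling `g` at one representative per coset gives a
  -- function constant on cosets, and the radius `max R 1 ≥ δ/2` keeps the support in the same ball.
  set G : AddSubgroup K := (IsUltrametricDist.closedBall_openAddSubgroup K hδ2).toAddSubgroup with hG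
  have hGmem : ∀ x : K, x ∈ G ↔ ‖x‖ ≤ δ / 2 := fun x => mem_closedBall_zero_iff
  set s : K → K := fun x => (QuotientAddGroup.mk x : K ⧸ G).out with hs
  have hsx : ∀ x, ‖x - s x‖ ≤ δ / 2 := by
    intro x
    rw [← hGmem, sub_eq_neg_add, ← QuotientAddGroup.eq]
    exact QuotientAddGroup.out_eq' _
  have hsc : ∀ x y : K, ‖y - x‖ ≤ δ / 2 → s y = s x := by
    intro x y hxy
    simp only [hs]
    congr 1
    rw [QuotientAddGroup.eq, ← sub_eq_neg_add, hGmem, norm_sub_rev]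
    exact hxy
  have hsupp' : Function.support (fun x => g (s x)) ⊆ Metric.closedBall 0 (max R 1) := by
    intro x hx
    have h1 := hsupp (show s x ∈ Function.support g from hx)
    rw [mem_closedBall_zero_iff] at h1 ⊢
    have h2 := ultrametric_norm_add_le
      ((hsx x).trans (((half_le_self hδ.le).trans hδ1).trans (le_max_right R 1))) h1
    rwa [sub_add_cancel] at h2
  refine ⟨fun x => g (s x), ?_, ?_, fun x => ?_, hsupp'⟩
  · refine (IsLocallyConstant.iff_eventually_eq _).2 fun x => ?_
    filter_upwards [Metric.closedBall_mem_nhds x hδ2] with y hy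
    rw [hsc x y (by rwa [← dist_eq_norm])]
  · exact HasCompactSupport.of_support_subset_isCompact (isCompact_closedBall 0 _) hsupp'
  · refine (hδ' ?_).le
    rw [dist_eq_norm]
    linarith [hsx x, min_le_left δ₀ 1]

namespace IsUltrametricPlace

variable {ϖ : K} {r C : ℝ} [P.haar.IsAddHaarMeasure]

/-- `φ` is invariant under a small ball, so its transform vanishes off the dual ball, which has
finite measure by `haar_real_mul_dualBall`; there it is bounded by the `L¹` norm of `φ`. -/
theorem integrable_fourier (h : IsUltrametricPlace P ϖ r C) {φ : K → ℂ} (hφ : IsLocallyConstant φ)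
    (hc : HasCompactSupport φ) : Integrable (fourierIntegralAt P φ) P.haar := by
  obtain ⟨δ, hδ, hδ'⟩ := hφ.exists_periodic hc
  have hfin : P.haar (dualBall P δ) ≠ ⊤ := by
    intro htop
    have := h.haar_real_mul_dualBall hδ
    rw [measureReal_def _ (dualBall P δ), htop] at this
    simp at this
  have hm : Measurable (fun z : K × K => φ z.2 * P.char (-(z.1 * z.2))) := by
    have h1 := hφ.continuous.measurable
    have h2 := h.unitary.meas
    fun_prop
  have hF : AEStronglyMeasurable (fourierIntegralAt P φ) P.haar :=
    (hm.stronglyMeasurable.integral_prod_right (ν := P.haar)).aestronglyMeasurable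
  have hb : Integrable ((dualBall P δ).indicator fun _ => ∫ y, ‖φ y‖ ∂P.haar) P.haar :=
    (integrable_indicator_iff (h.isClosed_dualBall δ).measurableSet).2 (integrableOn_const hfin)
  refine hb.mono' hF (ae_of_all _ fun x => ?_)
  by_cases hx : x ∈ dualBall P δ
  · rw [indicator_of_mem hx]
    exact norm_fourierIntegralAt_le h.unitary φ x
  · rw [indicator_of_notMem hx]
    simp only [dualBall, mem_ofPred_eq, not_forall] at hx
    obtain ⟨y, hy, hxy⟩ := hx
    rw [fourierIntegralAt_eq_zero_of_periodic h.unitary (fun z => hδ' z y hy) hxy, norm_zero]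

theorem isPlancherelClass (h : IsUltrametricPlace P ϖ r C) :
    IsPlancherelClass P {φ | IsLocallyConstant φ ∧ HasCompactSupport φ} where
  integrable φ hφ := hφ.1.continuous.integrable_of_hasCompactSupport hφ.2
  memLp φ hφ := hφ.1.continuous.memLp_of_hasCompactSupport hφ.2
  neg_mem φ hφ := ⟨hφ.1.comp_continuous continuous_neg,
    hφ.2.comp_homeomorph (Homeomorph.neg K)⟩
  integrable_fourier φ hφ := h.integrable_fourier hφ.1 hφ.2
  inversion φ hφ := h.inversion φ hφ.1 hφ.2
  dense f hf ε hε := by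
    obtain ⟨g, hg1, hg2, hg3, hg4⟩ := hf.exists_hasCompactSupport_eLpNorm_sub_le (by simp)
      (ε := ENNReal.ofReal (ε / 2)) (by simpa using hε)
    obtain ⟨R, hR, happ⟩ := exists_isLocallyConstant_dist_le hg3 hg1
    set V : ENNReal := P.haar (Metric.closedBall (0 : K) R) ^ (1 / (2 : ENNReal).toReal) with hV
    have hVtop : V ≠ ⊤ :=
      ENNReal.rpow_ne_top_of_nonneg (by simp) (isCompact_closedBall 0 R).measure_lt_top.ne
    have hη : 0 < ε / 2 / (V.toReal + 1) := by positivity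
    obtain ⟨φ, h1, h2, h3, h4⟩ := happ _ hη
    refine ⟨φ, ⟨h1, h2⟩, ?_⟩
    have h5 := eLpNorm_sub_le_of_dist_bdd P.haar (p := 2) (by simp)
      (measurableSet_closedBall (x := (0 : K)) (ε := R)) hη.le h3 hR h4
    have h6 : ENNReal.ofReal (ε / 2 / (V.toReal + 1)) * V ≤ ENNReal.ofReal (ε / 2) := by
      nth_rw 2 [← ENNReal.ofReal_toReal hVtop]
      rw [← ENNReal.ofReal_mul hη.le]
      refine ENNReal.ofReal_le_ofReal ?_
      have hV0 : 0 ≤ V.toReal := ENNReal.toReal_nonneg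
      rw [div_mul_eq_mul_div, div_le_iff₀ (by positivity)]
      nlinarith
    have h7 : f - φ = (f - g) + (g - φ) := by abel
    have hgm : MemLp g 2 P.haar := hg3.memLp_of_hasCompactSupport hg1
    have hφm : MemLp φ 2 P.haar := h1.continuous.memLp_of_hasCompactSupport h2
    rw [h7]
    refine (eLpNorm_add_le (hf.1.sub hgm.1) (hgm.1.sub hφm.1) (by norm_num)).trans ?_
    refine (add_le_add hg2 (h5.trans h6)).trans (le_of_eq ?_)
    rw [← ENNReal.ofReal_add (by positivity) (by positivity), add_halves]

end IsUltrametricPlace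
end Ultrametric


/-! ### Frullani integrals for sharp cutoffs -/

section Cutoff

/-- The Frullani integral of the sharp cutoff `1_{t ≥ 1}` against `1_{t ≥ a}` . -/
theorem integral_indicator_sub_div {a : ℝ} (ha : 0 < a) :
    IntegrableOn (fun t : ℝ => ((Ici (1 : ℝ)).indicator (fun _ => (1 : ℝ)) t -
      (Ici a).indicator (fun _ => (1 : ℝ)) t) / t) (Ioi 0) ∧
    ∫ t in Ioi (0 : ℝ), ((Ici (1 : ℝ)).indicator (fun _ => (1 : ℝ)) t -
      (Ici a).indicator (fun _ => (1 : ℝ)) t) / t = Real.log a ∧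
    ∫ t in Ioi (0 : ℝ), |((Ici (1 : ℝ)).indicator (fun _ => (1 : ℝ)) t -
      (Ici a).indicator (fun _ => (1 : ℝ)) t) / t| = |Real.log a| := by
  have key : ∀ b c : ℝ, 0 < b → b ≤ c →
      IntegrableOn (fun t : ℝ => ((Ici b).indicator (fun _ => (1 : ℝ)) t -
        (Ici c).indicator (fun _ => (1 : ℝ)) t) / t) (Ioi 0) ∧
      ∫ t in Ioi (0 : ℝ), ((Ici b).indicator (fun _ => (1 : ℝ)) t -
        (Ici c).indicator (fun _ => (1 : ℝ)) t) / t = Real.log c - Real.log b ∧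
      ∀ t ∈ Ioi (0 : ℝ), 0 ≤ ((Ici b).indicator (fun _ => (1 : ℝ)) t -
        (Ici c).indicator (fun _ => (1 : ℝ)) t) / t := by
    intro b c hb hbc
    have e : (fun t : ℝ => ((Ici b).indicator (fun _ => (1 : ℝ)) t -
        (Ici c).indicator (fun _ => (1 : ℝ)) t) / t) = (Ico b c).indicator fun t => t⁻¹ := by
      funext t
      by_cases h1 : b ≤ t <;> by_cases h2 : c ≤ t
      · simp [indicator, h1, h2, not_lt.2 h2]
      · simp [indicator, h1, h2, not_le.1 h2]
      · exact absurd (hbc.trans h2) h1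
      · simp [indicator, h1, h2]
    have hsub : Ioi (0 : ℝ) ∩ Ico b c = Ico b c :=
      inter_eq_right.2 fun t ht => lt_of_lt_of_le hb ht.1
    have hii : IntegrableOn (fun t : ℝ => t⁻¹) (Ico b c) := by
      rw [integrableOn_Ico_iff_integrableOn_Ioo, ← integrableOn_Ioc_iff_integrableOn_Ioo,
        ← intervalIntegrable_iff_integrableOn_Ioc_of_le hbc]
      refine intervalIntegral.intervalIntegrable_inv (fun t ht => ?_) continuousOn_id
      rw [uIcc_of_le hbc] at ht
      exact (lt_of_lt_of_le hb ht.1).ne'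
    refine ⟨?_, ?_, fun t (ht : 0 < t) => ?_⟩
    · rw [e, IntegrableOn, integrable_indicator_iff measurableSet_Ico, IntegrableOn,
        Measure.restrict_restrict measurableSet_Ico, inter_comm, hsub]
      exact hii
    · rw [e, setIntegral_indicator measurableSet_Ico, hsub, integral_Ico_eq_integral_Ioo,
        ← integral_Ioc_eq_integral_Ioo, ← intervalIntegral.integral_of_le hbc,
        integral_inv_of_pos hb (hb.trans_le hbc), Real.log_div (hb.trans_le hbc).ne' hb.ne']
    · rw [show ((Ici b).indicator (fun _ => (1 : ℝ)) t - (Ici c).indicator (fun _ => (1 : ℝ)) t) / t =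
        (Ico b c).indicator (fun t => t⁻¹) t from congrFun e t]
      exact indicator_nonneg (fun s hs => inv_nonneg.2 (hb.le.trans hs.1)) t
  rcases le_total 1 a with h | h
  · obtain ⟨k1, k2, k3⟩ := key 1 a one_pos h
    rw [Real.log_one, sub_zero] at k2
    refine ⟨k1, k2, ?_⟩
    rw [abs_of_nonneg (Real.log_nonneg h), ← k2]
    exact setIntegral_congr_fun measurableSet_Ioi fun t ht => abs_of_nonneg (k3 t ht)
  · obtain ⟨k1, k2, k3⟩ := key a 1 ha h
    rw [Real.log_one, zero_sub] at k2
    have e : ∀ t : ℝ, ((Ici (1 : ℝ)).indicator (fun _ => (1 : ℝ)) t -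
        (Ici a).indicator (fun _ => (1 : ℝ)) t) / t = -(((Ici a).indicator (fun _ => (1 : ℝ)) t -
        (Ici (1 : ℝ)).indicator (fun _ => (1 : ℝ)) t) / t) := fun t => by ring
    simp only [e]
    refine ⟨k1.neg, by rw [integral_neg, k2, neg_neg], ?_⟩
    rw [abs_of_nonpos (Real.log_nonpos ha.le h), ← k2]
    refine setIntegral_congr_fun measurableSet_Ioi fun t ht => ?_
    simp only [abs_neg]
    exact abs_of_nonneg (k3 t ht)

/-- The profile `B (t/a)^η` for `t < a`, and `1` for `t ≥ a`. -/
noncomputable def cutoffProfile (B η a t : ℝ) : ℝ := if t < a then B * (t / a) ^ η else 1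

/-- The profile exceeds the sharp cutoff at `a` only by `B (t/a)^η` on `(0, a)`, whose integral
against `dt/t` is `B/η`. -/
theorem integral_cutoffProfile {B η a : ℝ} (hB : 0 ≤ B) (hη : 0 < η) (ha : 0 < a) :
    IntegrableOn (fun t : ℝ => ((Ici (1 : ℝ)).indicator (fun _ => (1 : ℝ)) t -
      cutoffProfile B η a t) / t) (Ioi 0) ∧
    ∫ t in Ioi (0 : ℝ), ((Ici (1 : ℝ)).indicator (fun _ => (1 : ℝ)) t -
      cutoffProfile B η a t) / t = Real.log a - B / η ∧
    ∫ t in Ioi (0 : ℝ), |((Ici (1 : ℝ)).indicator (fun _ => (1 : ℝ)) t -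
      cutoffProfile B η a t) / t| ≤ |Real.log a| + B / η := by
  obtain ⟨k1, k2, k3⟩ := integral_indicator_sub_div ha
  set g : ℝ → ℝ := fun t => (Ioo 0 a).indicator (fun t => B * a ^ (-η) * t ^ (η - 1)) t with hg
  have hii : IntegrableOn (fun t : ℝ => B * a ^ (-η) * t ^ (η - 1)) (Ioo 0 a) := by
    rw [← integrableOn_Ioc_iff_integrableOn_Ioo,
      ← intervalIntegrable_iff_integrableOn_Ioc_of_le ha.le]
    exact (intervalIntegral.intervalIntegrable_rpow' (by linarith)).const_mul _
  have hgi : IntegrableOn g (Ioi 0) :=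
    ((integrable_indicator_iff measurableSet_Ioo).2 hii).integrableOn
  have hgv : ∫ t in Ioi (0 : ℝ), g t = B / η := by
    rw [hg, setIntegral_indicator measurableSet_Ioo,
      inter_eq_right.2 Ioo_subset_Ioi_self, ← integral_Ioc_eq_integral_Ioo,
      ← intervalIntegral.integral_of_le ha.le, intervalIntegral.integral_const_mul,
      integral_rpow (Or.inl (by linarith)), sub_add_cancel, Real.zero_rpow hη.ne', sub_zero]
    rw [mul_assoc, mul_div_assoc', ← Real.rpow_add ha, neg_add_cancel, Real.rpow_zero]
    ring
  have hg0 : ∀ t, 0 ≤ g t := fun t => indicator_nonneg (fun s hs => by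
    have := hs.1
    positivity) t
  have e : ∀ t ∈ Ioi (0 : ℝ), ((Ici (1 : ℝ)).indicator (fun _ => (1 : ℝ)) t -
      (Ici a).indicator (fun _ => (1 : ℝ)) t) / t - g t =
      ((Ici (1 : ℝ)).indicator (fun _ => (1 : ℝ)) t - cutoffProfile B η a t) / t := by
    intro t (ht : 0 < t)
    by_cases hta : t < a
    · rw [hg, cutoffProfile, if_pos hta]
      simp only []
      rw [indicator_of_notMem (notMem_Ici.2 hta), indicator_of_mem (mem_Ioo.2 ⟨ht, hta⟩),
        Real.div_rpow ht.le ha.le, Real.rpow_sub_one ht.ne', Real.rpow_neg ha.le]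
      field_simp
      ring
    · rw [hg, cutoffProfile, if_neg hta]
      simp only []
      rw [indicator_of_mem (mem_Ici.2 (not_lt.1 hta)),
        indicator_of_notMem (fun h : t ∈ Ioo 0 a => hta h.2), sub_zero]
  refine ⟨IntegrableOn.congr_fun (k1.sub hgi) e measurableSet_Ioi, ?_, ?_⟩
  · rw [← setIntegral_congr_fun measurableSet_Ioi e, integral_sub k1 hgi, k2, hgv]
  · rw [← k3, ← hgv, ← integral_add k1.abs hgi]
    refine setIntegral_mono_on (IntegrableOn.congr_fun (k1.sub hgi) e measurableSet_Ioi).abs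
      (k1.abs.add hgi) measurableSet_Ioi fun t ht => ?_
    rw [← e t ht]
    refine (abs_sub _ _).trans ?_
    rw [abs_of_nonneg (hg0 t)]

end Cutoff

/-! ### Schur bound and lower bound at ultrametric places -/

section Ultrametric

variable {K : Type*} [NormedField K] [ProperSpace K] [IsUltrametricDist K] [MeasurableSpace K]
  [BorelSpace K] {P : LocalPlace K}

namespace IsUltrametricPlace

variable {ϖ : K} {r C : ℝ} [P.haar.IsAddHaarMeasure]

theorem haar_singleton_zero (h : IsUltrametricPlace P ϖ r C) : P.haar {(0 : K)} = 0 := by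
  obtain ⟨q, hq0, hq1, -, hq⟩ := exists_haar_contraction P.haar h.ne_zero h.norm_lt_one
  have h1 := hq 0 1
  rw [mul_zero, Metric.closedBall_zero, pow_one] at h1
  have h2 : P.haar.real {(0 : K)} = 0 := by nlinarith
  exact (measureReal_eq_zero_iff isCompact_singleton.measure_lt_top.ne).1 h2

/-- The kernel has mass `1` and lives on a ball of radius of order `1/t`. If `‖y‖` exceeds that
radius, then `‖z‖ = ‖y‖` on the support of `k(z - y)`, so the weight is constant there and `ρ = 1`.
Otherwise `z` stays in the ball of radius `R = τ/t`, where the average of the weight is of order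
`R^{-η}`. -/
theorem schur_bound (h : IsUltrametricPlace P ϖ r C) :
    ∃ τ B η : ℝ, 0 < τ ∧ 0 ≤ B ∧ 0 < η ∧ ∀ t : ℝ, 0 < t → ∀ y : K, y ≠ 0 →
      ∫⁻ z, ENNReal.ofReal ((dualBall P t).indicator
        (fun _ => P.haar.real (Metric.closedBall (0 : K) t)) (z - y) * ‖z‖ ^ (-η)) ∂P.haar ≤
      ENNReal.ofReal (cutoffProfile B η (τ / ‖y‖) t * ‖y‖ ^ (-η)) := by
  obtain ⟨q, hq0, hq1, -, hq⟩ := exists_haar_contraction P.haar h.ne_zero h.norm_lt_one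
  obtain ⟨τ₁, hτ₁, hτD⟩ := h.exists_dualBall_subset
  obtain ⟨s, hs0, hs⟩ := h.exists_trivial
  have hμ0 := h.haar_singleton_zero
  have hϖ : 0 < ‖ϖ‖ := norm_pos_iff.2 h.ne_zero
  set a := ‖ϖ‖ with ha
  have hla : Real.log a < 0 := Real.log_neg hϖ h.norm_lt_one
  have hlq : Real.log q < 0 := Real.log_neg hq0 hq1
  -- This gives `a^{-η} = q^{-1/2}`, hence the convergent ratio `a^{-η} q = q^{1/2} < 1`.
  set η := Real.log q / (2 * Real.log a) with hηdef
  have hη : 0 < η := div_pos_of_neg_of_neg hlq (by linarith)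
  have hqη : a ^ (-η) * q < 1 := by
    have h1 : a ^ (-η) * q = Real.exp (Real.log a * -η + Real.log q) := by
      rw [Real.exp_add, Real.exp_log hq0, Real.rpow_def_of_pos hϖ]
    rw [h1, Real.exp_lt_one_iff, hηdef]
    have : Real.log a * -(Real.log q / (2 * Real.log a)) = -(Real.log q / 2) := by
      field_simp [hla.ne]
    linarith
  set M := a ^ (-η) / (1 - a ^ (-η) * q) with hM
  have hM0 : 0 ≤ M := div_nonneg (by positivity) (by linarith)
  -- the radius `τ` is slightly enlarged to make one inequality strict
  set τ := 2 * τ₁ with hτdef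
  have hτ : 0 < τ := by positivity
  -- Shrunk by `ϖ^N`, the ball of radius `τ/t` fits into the dual ball, so its measure is at most
  -- `q^{-N}` times that of the dual ball.
  obtain ⟨N, hN⟩ := exists_pow_lt_of_lt_one (div_pos hs0 hτ) h.norm_lt_one
  rw [lt_div_iff₀ hτ] at hN
  refine ⟨τ, M * (q ^ N)⁻¹, η, hτ, by positivity, hη, fun t ht y hy => ?_⟩
  have hy0 : 0 < ‖y‖ := norm_pos_iff.2 hy
  set m := P.haar.real (Metric.closedBall (0 : K) t) with hm
  have hm0 : 0 < m := measureReal_closedBall_pos P.haar ht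
  have hmD := h.haar_real_mul_dualBall ht
  have hDm := (h.isClosed_dualBall t).measurableSet
  have hDfin : P.haar (dualBall P t) ≠ ⊤ := by
    intro htop
    rw [measureReal_def _ (dualBall P t), htop] at hmD
    simp at hmD
  by_cases hty : t < τ / ‖y‖
  · rw [cutoffProfile, if_pos hty]
    set R := τ / t with hR
    have hR0 : 0 < R := by positivity
    have hyR : ‖y‖ ≤ R := by
      rw [lt_div_iff₀ hy0] at hty
      rw [hR, le_div_iff₀ ht]
      linarith
    have hVR : m * P.haar.real (Metric.closedBall (0 : K) R) ≤ (q ^ N)⁻¹ := by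
      rw [← mul_le_mul_iff_of_pos_left (pow_pos hq0 N), mul_inv_cancel₀ (pow_pos hq0 N).ne',
        mul_left_comm, ← hq, ← hmD]
      refine mul_le_mul_of_nonneg_left (measureReal_mono ?_ hDfin) hm0.le
      refine (Metric.closedBall_subset_closedBall ?_).trans (closedBall_subset_dualBall hs ht)
      rw [hR, mul_div_assoc']
      gcongr
    have hpt : ∀ z, ENNReal.ofReal ((dualBall P t).indicator (fun _ => m) (z - y) * ‖z‖ ^ (-η)) ≤
        (Metric.closedBall (0 : K) R).indicator
          (fun z => ENNReal.ofReal m * ENNReal.ofReal (‖z‖ ^ (-η))) z := by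
      intro z
      by_cases hz : z - y ∈ dualBall P t
      · have h1 : ‖z - y‖ ≤ R := (hτD t ht _ hz).trans (by rw [hR]; gcongr; linarith)
        have h2 : ‖z‖ ≤ R := by simpa using ultrametric_norm_add_le h1 hyR
        rw [indicator_of_mem hz, indicator_of_mem (by rwa [mem_closedBall_zero_iff]),
          ENNReal.ofReal_mul hm0.le]
      · rw [indicator_of_notMem hz, zero_mul, ENNReal.ofReal_zero]
        exact zero_le
    refine (lintegral_mono hpt).trans ?_
    rw [lintegral_indicator measurableSet_closedBall, lintegral_const_mul' _ _ (by simp)]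
    refine (mul_le_mul_right (lintegral_closedBall_norm_rpow_le P.haar hϖ h.norm_lt_one hq0 hη hqη
      hq hμ0 hR0) _).trans ?_
    rw [← ENNReal.ofReal_mul hm0.le]
    refine ENNReal.ofReal_le_ofReal ?_
    have h3 : t / (τ / ‖y‖) = ‖y‖ / R := by rw [hR]; field_simp
    rw [h3, Real.div_rpow hy0.le hR0.le]
    have h4 : ‖y‖ ^ η / R ^ η * ‖y‖ ^ (-η) = R ^ (-η) := by
      rw [Real.rpow_neg hy0.le, Real.rpow_neg hR0.le]
      have := (Real.rpow_pos_of_pos hy0 η).ne'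
      field_simp
    have h5 : 0 ≤ M * R ^ (-η) := by positivity
    calc _ = M * R ^ (-η) * (m * P.haar.real (Metric.closedBall (0 : K) R)) := by ring
      _ ≤ M * R ^ (-η) * (q ^ N)⁻¹ := mul_le_mul_of_nonneg_left hVR h5
      _ = _ := by rw [mul_assoc (M * (q ^ N)⁻¹), h4]; ring
  · rw [cutoffProfile, if_neg hty, one_mul]
    have hlt : τ₁ / t < ‖y‖ := by
      rw [not_lt, div_le_iff₀ hy0] at hty
      rw [div_lt_iff₀ ht]
      linarith
    have e : ∀ z, ENNReal.ofReal ((dualBall P t).indicator (fun _ => m) (z - y) * ‖z‖ ^ (-η)) =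
        (dualBall P t).indicator (fun _ => ENNReal.ofReal (m * ‖y‖ ^ (-η))) (z - y) := by
      intro z
      by_cases hz : z - y ∈ dualBall P t
      · rw [indicator_of_mem hz, indicator_of_mem hz,
          norm_eq_of_norm_sub_lt ((hτD t ht _ hz).trans_lt hlt)]
      · rw [indicator_of_notMem hz, indicator_of_notMem hz, zero_mul, ENNReal.ofReal_zero]
    simp only [e]
    rw [lintegral_sub_right_eq_self (fun z => (dualBall P t).indicator
      (fun _ => ENNReal.ofReal (m * ‖y‖ ^ (-η))) z), lintegral_indicator_const hDm,
      ← ENNReal.ofReal_toReal hDfin, ← measureReal_def, ← ENNReal.ofReal_mul (by positivity)]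
    refine ENNReal.ofReal_le_ofReal (le_of_eq ?_)
    rw [mul_right_comm, hmD, one_mul]

/-- The sharp cutoffs give `log ‖y‖` exactly for `e` and `log(τ/‖y‖) - B/η` for `ρ`, so `log ‖y‖`
cancels. Replacing `r log ‖y‖` by `log|y|` costs `C` once in each variable. -/
theorem conductorBoundedBelowBy (h : IsUltrametricPlace P ϖ r C) :
    ∃ c : ℝ, ConductorBoundedBelowBy P c := by
  obtain ⟨τ, B, η, hτ, hB, hη, hschur⟩ := h.schur_bound
  have hr := h.r_pos
  have hne : ∀ᵐ y ∂P.haar, y ≠ 0 := compl_mem_ae_iff.2 h.haar_singleton_zero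
  have hC : 0 ≤ C := (abs_nonneg _).trans (h.abs_log_le ϖ h.ne_zero)
  have hri : 0 < r⁻¹ := inv_pos.2 hr
  have hlogn : ∀ y : K, y ≠ 0 → |Real.log ‖y‖| ≤ r⁻¹ * (|Real.log (P.abs y)| + C) := by
    intro y hy
    have h1 := h.abs_log_le y hy
    rw [le_inv_mul_iff₀ hr]
    nth_rw 1 [← abs_of_pos hr]
    rw [← abs_mul]
    have h2 := abs_sub_abs_le_abs_sub (r * Real.log ‖y‖) (Real.log (P.abs y))
    rw [abs_sub_comm] at h2
    linarith
  have hbound : ∀ N : ℝ, 0 ≤ N → ∀ y : K, y ≠ 0 → N + |Real.log ‖y‖| ≤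
      (N + r⁻¹ * (1 + C)) * (1 + |Real.log (P.abs y)|) := by
    intro N hN y hy
    have h1 := hlogn y hy
    have h2 := abs_nonneg (Real.log (P.abs y))
    have h3 : 0 ≤ r⁻¹ * C := by positivity
    nlinarith [mul_nonneg hN h2, mul_nonneg h3 h2]
  have hind : ∀ (t : ℝ) (y : K), (Metric.closedBall (0 : K) t).indicator (fun _ => (1 : ℝ)) y =
      (Ici ‖y‖).indicator (fun _ => 1) t := fun t y => by simp [indicator]
  refine ⟨r * (Real.log τ - B / η) - C - C, ?_⟩
  refine conductorBoundedBelowBy_of_kernel h.unitary h.isPlancherelClass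
    (c := (Ici (1 : ℝ)).indicator fun _ => 1) (measurable_const.indicator measurableSet_Ici)
    (e := fun t => (Metric.closedBall (0 : K) t).indicator fun _ => 1)
    (k := fun t => (dualBall P t).indicator fun _ => P.haar.real (Metric.closedBall (0 : K) t))
    (ρ := fun t y => cutoffProfile B η (τ / ‖y‖) t) (w := fun y => ‖y‖ ^ (-η)) (c₀ := -C)
    (C := 0 + r⁻¹ * (1 + C)) (C' := (|Real.log τ| + B / η) + r⁻¹ * (1 + C)) hr.le
    (fun t _ => h.isPositiveWeight t) (by fun_prop) ?_ ?_ ?_ ⟨?_, ?_, ?_⟩ ⟨?_, ?_, ?_⟩ ?_ ?_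
  · filter_upwards [hne] with y hy
    have := norm_pos_iff.2 hy
    positivity
  · intro t y ht
    rw [cutoffProfile]
    split_ifs with hlt
    · positivity
    · exact zero_le_one
  · intro t ht
    filter_upwards [hne] with y hy
    exact hschur t ht y hy
  · have : Function.uncurry (fun t => (Metric.closedBall (0 : K) t).indicator fun _ => (1 : ℝ)) =
        {z : ℝ × K | ‖z.2‖ ≤ z.1}.indicator fun _ => 1 := by
      funext z
      simp [Function.uncurry, indicator]
    rw [this]
    exact measurable_const.indicator (measurableSet_le (by fun_prop) (by fun_prop))
  · filter_upwards [hne] with y hy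
    simp only [hind]
    exact (integral_indicator_sub_div (norm_pos_iff.2 hy)).1
  · filter_upwards [hne] with y hy
    simp only [hind]
    rw [(integral_indicator_sub_div (norm_pos_iff.2 hy)).2.2]
    have := hbound 0 le_rfl y hy
    rwa [zero_add] at this
  · simp only [Function.uncurry_def, cutoffProfile]
    exact Measurable.ite (measurableSet_lt (by fun_prop) (by fun_prop)) (by fun_prop)
      measurable_const
  · filter_upwards [hne] with y hy
    exact (integral_cutoffProfile hB hη (div_pos hτ (norm_pos_iff.2 hy))).1
  · filter_upwards [hne] with y hy
    have hy0 := norm_pos_iff.2 hy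
    refine (integral_cutoffProfile hB hη (div_pos hτ hy0)).2.2.trans ?_
    refine le_trans ?_ (hbound (|Real.log τ| + B / η) (by positivity) y hy)
    rw [Real.log_div hτ.ne' hy0.ne']
    linarith [abs_sub (Real.log τ) (Real.log ‖y‖)]
  · filter_upwards [hne] with y hy
    simp only [hind]
    rw [(integral_indicator_sub_div (norm_pos_iff.2 hy)).2.1]
    linarith [(abs_le.1 (h.abs_log_le y hy)).1]
  · filter_upwards [hne] with y hy
    have hy0 := norm_pos_iff.2 hy
    rw [(integral_cutoffProfile hB hη (div_pos hτ hy0)).2.1, Real.log_div hτ.ne' hy0.ne']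
    linarith [(abs_le.1 (h.abs_log_le y hy)).1]

end IsUltrametricPlace
end Ultrametric


/-! ### The additive character of `ℚ_p` -/

section PadicCharacter

variable (p : ℕ) [Fact p.Prime]

theorem norm_sub_padicFract_le_one (x : ℚ_[p]) : ‖x - (padicFract p x : ℚ_[p])‖ ≤ 1 := by
  have hp : (p : ℚ_[p]) ≠ 0 := by exact_mod_cast (Fact.out : p.Prime).ne_zero
  set n := (-x.valuation).toNat with hn
  set z : ℤ_[p] := ⟨x * (p : ℚ_[p]) ^ n, norm_mul_pow_neg_valuation_le_one p x⟩ with hz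
  have h1 := (PadicInt.norm_le_pow_iff_mem_span_pow _ n).2 (PadicInt.appr_spec n z)
  have h2 : x - (padicFract p x : ℚ_[p]) =
      ((z - (z.appr n : ℤ_[p]) : ℤ_[p]) : ℚ_[p]) / (p : ℚ_[p]) ^ n := by
    rw [padicFract]
    push_cast
    rw [eq_div_iff (pow_ne_zero n hp), sub_mul, div_mul_cancel₀ _ (pow_ne_zero n hp)]
  rw [h2, norm_div, norm_pow, Padic.norm_p, inv_pow, div_inv_eq_mul]
  have hp0 : (0 : ℝ) < (p : ℝ) ^ n := by
    have : 0 < p := (Fact.out : p.Prime).pos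
    positivity
  rw [PadicInt.norm_def] at h1
  calc _ ≤ (p : ℝ) ^ (-(n : ℤ)) * (p : ℝ) ^ n := mul_le_mul_of_nonneg_right h1 hp0.le
    _ = 1 := by rw [zpow_neg, zpow_natCast, inv_mul_cancel₀ hp0.ne']

theorem exists_padicFract_mul_pow (x : ℚ_[p]) :
    ∃ (a : ℤ) (n : ℕ), padicFract p x * (p : ℚ) ^ n = a := by
  have hp : (p : ℚ) ≠ 0 := by exact_mod_cast (Fact.out : p.Prime).ne_zero
  refine ⟨((PadicInt.appr (⟨x * (p : ℚ_[p]) ^ (-x.valuation).toNat,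
    norm_mul_pow_neg_valuation_le_one p x⟩ : ℤ_[p]) (-x.valuation).toNat : ℕ) : ℤ),
    (-x.valuation).toNat, ?_⟩
  rw [padicFract, div_mul_cancel₀ _ (pow_ne_zero _ hp)]
  exact (Int.cast_natCast _).symm

/-- A rational whose denominator is a power of `p` and which is `p`-integral is an integer. Applied
to the additivity defect of `padicFract`, this makes the exponential multiplicative. -/
theorem exists_int_of_padic_norm_le_one {q : ℚ} {a : ℤ} {n : ℕ} (hq : q * (p : ℚ) ^ n = a)
    (h : ‖(q : ℚ_[p])‖ ≤ 1) : ∃ k : ℤ, q = k := by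
  have hp : (p : ℚ) ≠ 0 := by exact_mod_cast (Fact.out : p.Prime).ne_zero
  have h1 : ‖((a : ℤ) : ℚ_[p])‖ ≤ (p : ℝ) ^ (-(n : ℤ)) := by
    have h2 : ((a : ℤ) : ℚ_[p]) = (q : ℚ_[p]) * (p : ℚ_[p]) ^ n := by
      exact_mod_cast (congrArg (fun r : ℚ => (r : ℚ_[p])) hq).symm
    rw [h2, norm_mul, norm_pow, Padic.norm_p, inv_pow, zpow_neg, zpow_natCast]
    exact mul_le_of_le_one_left (by positivity) h
  obtain ⟨k, hk⟩ := (Padic.norm_int_le_pow_iff_dvd a n).1 h1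
  refine ⟨k, ?_⟩
  have : q * (p : ℚ) ^ n = k * (p : ℚ) ^ n := by
    rw [hq, hk]; push_cast; ring
  exact mul_right_cancel₀ (pow_ne_zero n hp) this

theorem exp_two_pi_I_mul_int (k : ℤ) :
    Complex.exp (2 * Real.pi * Complex.I * (k : ℂ)) = 1 := by
  rw [mul_comm]
  exact Complex.exp_int_mul_two_pi_mul_I k

theorem exp_padicFract_of_norm_le_one {x : ℚ_[p]} (hx : ‖x‖ ≤ 1) :
    Complex.exp (2 * Real.pi * Complex.I * (padicFract p x : ℂ)) = 1 := by
  obtain ⟨a, n, ha⟩ := exists_padicFract_mul_pow p x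
  have h1 : ‖(padicFract p x : ℚ_[p])‖ ≤ 1 := by
    rw [show (padicFract p x : ℚ_[p]) = x - (x - (padicFract p x : ℚ_[p])) by ring]
    exact ultrametric_norm_sub_le hx (norm_sub_padicFract_le_one p x)
  obtain ⟨k, hk⟩ := exists_int_of_padic_norm_le_one p ha h1
  rw [hk]
  exact_mod_cast exp_two_pi_I_mul_int k

theorem exp_padicFract_add (x y : ℚ_[p]) :
    Complex.exp (2 * Real.pi * Complex.I * (padicFract p (x + y) : ℂ)) =
      Complex.exp (2 * Real.pi * Complex.I * (padicFract p x : ℂ)) *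
        Complex.exp (2 * Real.pi * Complex.I * (padicFract p y : ℂ)) := by
  obtain ⟨a, l, ha⟩ := exists_padicFract_mul_pow p x
  obtain ⟨b, m, hb⟩ := exists_padicFract_mul_pow p y
  obtain ⟨c, n, hc⟩ := exists_padicFract_mul_pow p (x + y)
  have hd : (padicFract p (x + y) - padicFract p x - padicFract p y) * (p : ℚ) ^ (l + m + n) =
      ((c * p ^ (l + m) - a * p ^ (m + n) - b * p ^ (l + n) : ℤ) : ℚ) := by
    push_cast
    rw [← ha, ← hb, ← hc]
    ring
  have hn : ‖((padicFract p (x + y) - padicFract p x - padicFract p y : ℚ) : ℚ_[p])‖ ≤ 1 := by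
    have e : ((padicFract p (x + y) - padicFract p x - padicFract p y : ℚ) : ℚ_[p]) =
        ((x - (padicFract p x : ℚ_[p])) + (y - (padicFract p y : ℚ_[p]))) -
          (x + y - (padicFract p (x + y) : ℚ_[p])) := by
      push_cast; ring
    rw [e]
    exact ultrametric_norm_sub_le (ultrametric_norm_add_le (norm_sub_padicFract_le_one p x)
      (norm_sub_padicFract_le_one p y)) (norm_sub_padicFract_le_one p _)
  obtain ⟨k, hk⟩ := exists_int_of_padic_norm_le_one p hd hn
  have hk' : padicFract p (x + y) = padicFract p x + padicFract p y + k := by linarith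
  rw [← Complex.exp_add, hk', ← mul_one (Complex.exp (_ + _)), ← exp_two_pi_I_mul_int k,
    ← Complex.exp_add]
  congr 1
  push_cast; ring

end PadicCharacter

theorem isUltrametricDist_of_normedAlgebra_padic (p : ℕ) [Fact p.Prime] (K : Type*)
    [NormedField K] [NormedAlgebra ℚ_[p] K] : IsUltrametricDist K := by
  refine IsUltrametricDist.isUltrametricDist_of_forall_norm_natCast_le_one fun n => ?_
  rw [← map_natCast (algebraMap ℚ_[p] K), norm_algebraMap']
  exact_mod_cast Padic.norm_int_le_one (n : ℤ)

/-! ### Finite extensions of `ℚ_p` -/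

section FinitePlace

variable (p : ℕ) [Fact p.Prime] (K : Type*) [NormedField K] [NormedAlgebra ℚ_[p] K]
  [FiniteDimensional ℚ_[p] K]

/-- The difference is unchanged when `y` is multiplied by a power of `p`, as the field norm is
homogeneous of degree `d` over `ℚ_p`. This brings `y` into the compact annulus `p⁻¹ ≤ ‖y‖ ≤ 1`,
where continuity bounds it. A bounded discrepancy is enough for a lower bound. -/
theorem exists_abs_log_norm_sub_le : ∃ C : ℝ, ∀ y : K, y ≠ 0 →
    |Real.log ‖Algebra.norm ℚ_[p] y‖ - Module.finrank ℚ_[p] K * Real.log ‖y‖| ≤ C := by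
  have : ProperSpace K := FiniteDimensional.proper ℚ_[p] K
  have hp1 : (1 : ℝ) < p := by exact_mod_cast (Fact.out : p.Prime).one_lt
  have hp0 : (0 : ℝ) < p := by linarith
  have hpK : (p : ℚ_[p]) ≠ 0 := by exact_mod_cast (Fact.out : p.Prime).ne_zero
  set d : ℕ := Module.finrank ℚ_[p] K with hd
  have hcont : Continuous fun y : K => Algebra.norm ℚ_[p] y := by
    have h1 : Continuous fun y : K =>
        Algebra.leftMulMatrix (Module.finBasis ℚ_[p] K) y :=
      (Algebra.leftMulMatrix (Module.finBasis ℚ_[p] K)).toLinearMap.continuous_of_finiteDimensional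
    simp only [Algebra.norm_eq_matrix_det (Module.finBasis ℚ_[p] K)]
    exact h1.matrix_det
  set A : Set K := {y | (p : ℝ)⁻¹ ≤ ‖y‖ ∧ ‖y‖ ≤ 1} with hA
  have hAc : IsCompact A := by
    refine (isCompact_closedBall (0 : K) 1).of_isClosed_subset ?_ fun y hy => by
      simpa using hy.2
    exact (isClosed_le continuous_const continuous_norm).inter
      (isClosed_le continuous_norm continuous_const)
  have hA0 : ∀ y ∈ A, y ≠ 0 := fun y hy => norm_pos_iff.1 (lt_of_lt_of_le (inv_pos.2 hp0) hy.1)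
  have hlogc : ContinuousOn (fun y : K => Real.log ‖Algebra.norm ℚ_[p] y‖) A :=
    hcont.norm.continuousOn.log fun y hy =>
      (norm_pos_iff.2 (Algebra.norm_ne_zero_iff.2 (hA0 y hy))).ne'
  obtain ⟨C₁, hC₁⟩ := hAc.exists_bound_of_continuousOn hlogc
  refine ⟨C₁ + d * Real.log p, fun y hy => ?_⟩
  have hy0 := norm_pos_iff.2 hy
  obtain ⟨n, hn1, hn2⟩ := exists_mem_Ico_zpow hy0 hp1
  set c : ℚ_[p] := (p : ℚ_[p]) ^ (n + 1) with hc
  have hcn : ‖c‖ = (p : ℝ) ^ (-(n + 1)) := by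
    rw [hc, norm_zpow, Padic.norm_p, inv_zpow, zpow_neg]
  have hc0 : 0 < ‖c‖ := by rw [hcn]; positivity
  set z : K := algebraMap ℚ_[p] K c * y with hz
  have hzn : ‖z‖ = ‖c‖ * ‖y‖ := by rw [hz, norm_mul, norm_algebraMap']
  have hzA : z ∈ A := by
    refine ⟨?_, ?_⟩
    · rw [hzn, hcn, show (p : ℝ)⁻¹ = (p : ℝ) ^ (-(n + 1)) * (p : ℝ) ^ n by
        rw [← zpow_add₀ hp0.ne', ← zpow_neg_one]; congr 1; ring]
      exact mul_le_mul_of_nonneg_left hn1 (by positivity)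
    · rw [hzn, hcn, show (1 : ℝ) = (p : ℝ) ^ (-(n + 1)) * (p : ℝ) ^ (n + 1) by
        rw [← zpow_add₀ hp0.ne']; simp]
      exact mul_le_mul_of_nonneg_left hn2.le (by positivity)
  have hNz : ‖Algebra.norm ℚ_[p] z‖ = ‖c‖ ^ d * ‖Algebra.norm ℚ_[p] y‖ := by
    rw [hz, map_mul, norm_mul, Algebra.norm_algebraMap, norm_pow]
  have hNy : 0 < ‖Algebra.norm ℚ_[p] y‖ := norm_pos_iff.2 (Algebra.norm_ne_zero_iff.2 hy)
  have e : Real.log ‖Algebra.norm ℚ_[p] y‖ - d * Real.log ‖y‖ =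
      Real.log ‖Algebra.norm ℚ_[p] z‖ - d * Real.log ‖z‖ := by
    rw [hNz, hzn, Real.log_mul (by positivity) hNy.ne', Real.log_mul hc0.ne' hy0.ne', Real.log_pow]
    ring
  have hz1 : |Real.log ‖z‖| ≤ Real.log p := by
    have h1 : 0 < ‖z‖ := norm_pos_iff.2 (hA0 z hzA)
    have h2 := Real.log_le_log (inv_pos.2 hp0) hzA.1
    rw [Real.log_inv] at h2
    rw [abs_of_nonpos (Real.log_nonpos h1.le hzA.2)]
    linarith
  rw [e]
  refine (abs_sub _ _).trans (add_le_add (hC₁ z hzA) ?_)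
  rw [abs_mul, Nat.abs_cast]
  exact mul_le_mul_of_nonneg_left hz1 (Nat.cast_nonneg d)

variable [MeasurableSpace K] [BorelSpace K]

theorem exists_finitePlace_char_eq_one (μ : Measure K) :
    ∃ s : ℝ, 0 < s ∧ ∀ x, ‖x‖ ≤ s → (finitePlace p K μ).char x = 1 := by
  have hT : Continuous (Algebra.trace ℚ_[p] K) := LinearMap.continuous_of_finiteDimensional _
  have h0 := hT.tendsto 0
  rw [map_zero] at h0
  obtain ⟨s, hs, hs'⟩ := Metric.eventually_nhds_iff_ball.1
    (h0.eventually (Metric.closedBall_mem_nhds 0 one_pos))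
  refine ⟨s / 2, half_pos hs, fun x hx => exp_padicFract_of_norm_le_one p ?_⟩
  have := hs' x (by rw [mem_ball_zero_iff]; linarith)
  simpa using this

theorem isUnitaryCharacter_finitePlace (μ : Measure K) :
    IsUnitaryCharacter (finitePlace p K μ) := by
  have hadd : ∀ x y, (finitePlace p K μ).char (x + y) =
      (finitePlace p K μ).char x * (finitePlace p K μ).char y := by
    intro x y
    simp only [finitePlace, map_add]
    exact exp_padicFract_add p _ _
  refine ⟨?_, fun x => ?_, hadd⟩
  · obtain ⟨s, hs, hs'⟩ := exists_finitePlace_char_eq_one p K μ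
    refine (IsLocallyConstant.continuous
      ((IsLocallyConstant.iff_eventually_eq _).2 fun x => ?_)).measurable
    filter_upwards [Metric.closedBall_mem_nhds x hs] with y hy
    rw [← add_sub_cancel x y, hadd, hs' (y - x) (by rwa [← dist_eq_norm]), mul_one]
  · simp only [finitePlace]
    rw [show 2 * Real.pi * Complex.I * (padicFract p (Algebra.trace ℚ_[p] K x) : ℂ) =
      ((2 * Real.pi * (padicFract p (Algebra.trace ℚ_[p] K x) : ℝ) : ℝ) : ℂ) * Complex.I by
        push_cast; ring]
    exact Complex.norm_exp_ofReal_mul_I _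

theorem exists_conductorBoundedBelowBy_finitePlace (μ : Measure K) [μ.IsAddHaarMeasure]
    (hμ : IsSelfDualHaar p K μ) : ∃ c : ℝ, ConductorBoundedBelowBy (finitePlace p K μ) c := by
  have : ProperSpace K := FiniteDimensional.proper ℚ_[p] K
  have : IsUltrametricDist K := isUltrametricDist_of_normedAlgebra_padic p K
  have : (finitePlace p K μ).haar.IsAddHaarMeasure := ‹μ.IsAddHaarMeasure›
  have hp1 : (1 : ℝ) < p := by exact_mod_cast (Fact.out : p.Prime).one_lt
  obtain ⟨C, hC⟩ := exists_abs_log_norm_sub_le p K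
  have hplace : IsUltrametricPlace (finitePlace p K μ) (algebraMap ℚ_[p] K p)
      (Module.finrank ℚ_[p] K) C :=
    { unitary := isUnitaryCharacter_finitePlace p K μ
      exists_trivial := exists_finitePlace_char_eq_one p K μ
      ne_zero := by
        rw [Ne, map_eq_zero]
        exact_mod_cast (Fact.out : p.Prime).ne_zero
      norm_lt_one := by
        rw [norm_algebraMap', Padic.norm_p]
        exact inv_lt_one_of_one_lt₀ hp1
      r_pos := by exact_mod_cast Module.finrank_pos
      abs_log_le := hC
      inversion := hμ }
  exact hplace.conductorBoundedBelowBy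

end FinitePlace

theorem mainTheorem6 :
    -- the spectral functions on the critical line
    (IsSpectralFunction realPlace chiPlus hPlus ∧ CriticalLineShape hPlus) ∧
    (IsSpectralFunction realPlace chiMinus hMinus ∧ CriticalLineShape hMinus) ∧
    (∀ N : ℤ, IsSpectralFunction complexPlace (chiComplex N) (hComplex N) ∧
      CriticalLineShape (hComplex N)) ∧
    -- their minimal values
    hPlus (1 / 2) =
      ((-(Real.log (8 * Real.pi) + Real.eulerMascheroniConstant) - Real.pi / 2 : ℝ) : ℂ) ∧
    hMinus (1 / 2) =
      ((-(Real.log (8 * Real.pi) + Real.eulerMascheroniConstant) + Real.pi / 2 : ℝ) : ℂ) ∧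
    (∀ N : ℤ, hComplex N (1 / 2) =
      ((-2 * Real.log (2 * Real.pi) : ℝ) : ℂ)
        + 2 * Complex.digamma (((N.natAbs : ℂ) + 1) / 2)) ∧
    (∀ (N : ℤ) (n : ℕ), N.natAbs = 2 * n → hComplex N (1 / 2) =
      ((-2 * (Real.log (8 * Real.pi) + Real.eulerMascheroniConstant)
        + 2 * ∑ j ∈ Finset.Icc 1 n, 1 / ((j : ℝ) - 1 / 2) : ℝ) : ℂ)) ∧
    (∀ (N : ℤ) (n : ℕ), N.natAbs = 2 * n + 1 → hComplex N (1 / 2) =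
      ((-2 * (Real.log (8 * Real.pi) + Real.eulerMascheroniConstant) + 4 * Real.log 2
        + 2 * ∑ j ∈ Finset.Icc 1 n, 1 / (j : ℝ) : ℝ) : ℂ)) ∧
    -- the conductor operator is bounded below, at the real, complex and finite places
    ConductorBoundedBelowBy realPlace
      (-(Real.log (8 * Real.pi) + Real.eulerMascheroniConstant) - Real.pi / 2) ∧
    ConductorBoundedBelowBy complexPlace
      (-2 * (Real.log (8 * Real.pi) + Real.eulerMascheroniConstant)) ∧
    (∀ (p : ℕ) [Fact p.Prime] (K : Type*) [NormedField K] [NormedAlgebra ℚ_[p] K]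
      [FiniteDimensional ℚ_[p] K] [MeasurableSpace K] [BorelSpace K]
      (μ : Measure K) [μ.IsAddHaarMeasure], IsSelfDualHaar p K μ →
        ∃ c : ℝ, ConductorBoundedBelowBy (finitePlace p K μ) c) := by
  refine ⟨⟨isSpectralFunction_hPlus,
      criticalLineShape_of_localSpectral le_rfl (by norm_num) fun _ => hPlus_eq⟩,
    ⟨isSpectralFunction_hMinus,
      criticalLineShape_of_localSpectral one_pos.le (by norm_num) fun _ => hMinus_eq⟩,
    fun N => ⟨isSpectralFunction_hComplex N,
      criticalLineShape_of_localSpectral (Nat.cast_nonneg _) one_pos fun _ => hComplex_eq N⟩,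
    hPlus_half, hMinus_half, hComplex_half, hComplex_half_even, hComplex_half_odd,
    conductorBoundedBelowBy_realPlace, conductorBoundedBelowBy_complexPlace, ?_⟩
  intro p _ K _ _ _ _ _ μ _ hμ
  exact exists_conductorBoundedBelowBy_finitePlace p K μ hμ
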